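/- In the single-machine total tardiness problem $1||\sum T_i$ one is given $n$ jobs with processing times $p_i\in\mathbb{Z}_{\ge 0}$ and due dates $d_i\in\mathbb{Z}$, and asks for a sequence $\sigma$ of the jobs, processed without idle time from time $0$, that minimizes $\sum_i \max\{C_i-d_i,0\}$, where $C_i$ is the completion time of job $i$ in $\sigma$. Running times are numbers of steps of a random access machine (unit-cost addition, subtraction, comparison, indirect reading and writing); $O^*(c^n)$ means at most $q(n)\,c^n$ steps on every instance with $n$ jobs, for some polynomial $q$. Polynomial space means that the number of memory cells in use is bounded by a polynomial in $n$ and the binary length of their contents by a polynomial in the binary length of the instance. An instance has $\mathrm{LPT}=\mathrm{EDD}$ if some sequence of its jobs is at once a longest-processing-time-first sequence (ties by non-decreasing due date) and an earliest-due-date-first sequence (ties by non-decreasing processing time). 1. There is an algorithm with an integer parameter $k\ge 2$, and numbers $\epsilon_k$ with $\epsilon_k\to 0$ as $k\to\infty$, such that for every fixed $k\ge 2$ the algorithm solves $1||\sum T_i$ to optimality on all instances, in polynomial space and in $O^*((2+\epsilon_k)^n)$ time. Its running time on $n$ jobs is bounded by some function $T(n)$ (depending on $k$) for which, with some polynomial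 $p$ (depending on $k$), $$T(n)\le 2T(n-1)+(5k-1)\,T(n-k-1)+p(n)\qquad (n\ge 2k).$$ Moreover, up to a polynomial factor, instances with $\mathrm{LPT}=\mathrm{EDD}$ are worst-case instances: for every fixed $k\ge2$ there is a polynomial $q$ such that for every instance with $n$ jobs there is an instance with $n$ jobs and $\mathrm{LPT}=\mathrm{EDD}$ on which the algorithm takes at least a fraction $1/q(n)$ of the number of steps it takes on the given one. 2. Consequently, for every $\epsilon>0$, the problem $1||\sum T_i$ can be solved in $O^*((2+\epsilon)^n)$ time and polynomial space. -/

import Mathlib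

/-! ### The problem: single machine total tardiness -/

/-- An instance with `n` jobs: job `i` has processing time `p i` and due date `d i`. -/
structure TardinessInstance (n : ℕ) where
  p : Fin n → ℕ
  d : Fin n → ℤ

namespace TardinessInstance

variable {n : ℕ}

/-- A sequence is a permutation `σ`, where `σ i` is the job in position `i`.  Jobs are processed
without idle time from time `0`; this is the completion time of the job in position `i`. -/
def completionTime (I : TardinessInstance n) (σ : Equiv.Perm (Fin n)) (i : Fin n) : ℤ :=
  ∑ j ∈ Finset.univ.filter (fun j => j ≤ i), (I.p (σ j) : ℤ)

/-- `∑ max (C - d) 0` over all jobs. -/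
def totalTardiness (I : TardinessInstance n) (σ : Equiv.Perm (Fin n)) : ℤ :=
  ∑ i, max (I.completionTime σ i - I.d (σ i)) 0

def IsOptimal (I : TardinessInstance n) (σ : Equiv.Perm (Fin n)) : Prop :=
  ∀ τ : Equiv.Perm (Fin n), I.totalTardiness σ ≤ I.totalTardiness τ

/-- `π` lists the jobs by longest processing time first, ties by due date. -/
def IsLPT (I : TardinessInstance n) (π : Equiv.Perm (Fin n)) : Prop :=
  ∀ i j, i < j → I.p (π j) < I.p (π i) ∨ (I.p (π i) = I.p (π j) ∧ I.d (π i) ≤ I.d (π j))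

/-- `π` lists the jobs by earliest due date first, ties by processing time. -/
def IsEDD (I : TardinessInstance n) (π : Equiv.Perm (Fin n)) : Prop :=
  ∀ i j, i < j → I.d (π i) < I.d (π j) ∨ (I.d (π i) = I.d (π j) ∧ I.p (π i) ≤ I.p (π j))

/-- Instances with `LPT = EDD`: some sequence is both an LPT and an EDD sequence. -/
def LPTEqEDD (I : TardinessInstance n) : Prop :=
  ∃ π : Equiv.Perm (Fin n), I.IsLPT π ∧ I.IsEDD π

/-- The length of the instance in binary (up to a constant factor). -/
def bitSize (I : TardinessInstance n) : ℕ :=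
  n + ∑ i, (Nat.size (I.p i) + Nat.size (I.d i).natAbs)

end TardinessInstance

/-! ### The machine model: a random access machine

The instructions are those of the classical RAM (constants, addition, subtraction, indirect read,
indirect write, test for positivity), with structured control instead of jumps.  A program names
finitely many registers; the memory is accessed through addresses held in registers. -/

inductive RamProg where
  /-- `R[x] := c` -/
  | const (x : ℕ) (c : ℤ)
  /-- `R[x] := R[y] + R[z]` -/
  | plus (x y z : ℕ)
  /-- `R[x] := R[y] - R[z]` -/
  | minus (x y z : ℕ)
  /-- `R[x] := M[R[y]]` -/
  | load (x y : ℕ)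
  /-- `M[R[x]] := R[y]` -/
  | store (x y : ℕ)
  /-- first `a`, then `b` -/
  | seq (a b : RamProg)
  /-- if `R[x] > 0` then `a` else `b` -/
  | cond (x : ℕ) (a b : RamProg)
  /-- while `R[x] > 0` do `a` -/
  | loop (x : ℕ) (a : RamProg)

/-- Registers and memory. A negative address is read as address `0`. -/
structure RamState where
  reg : ℕ → ℤ
  mem : ℕ → ℤ

def RamState.setReg (s : RamState) (x : ℕ) (v : ℤ) : RamState :=
  { s with reg := Function.update s.reg x v }

def RamState.setMem (s : RamState) (a : ℕ) (v : ℤ) : RamState :=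
  { s with mem := Function.update s.mem a v }

/-- A configuration: the parts of the program that remain to be executed (finite control; this list
never gets longer than the nesting depth of the program allows) and the state. -/
structure RamConfig where
  todo : List RamProg
  state : RamState

/-- One step of the machine; every instruction and every test costs one step. -/
def RamConfig.step : RamConfig → RamConfig
  | ⟨[], s⟩ => ⟨[], s⟩
  | ⟨.const x c :: k, s⟩ => ⟨k, s.setReg x c⟩
  | ⟨.plus x y z :: k, s⟩ => ⟨k, s.setReg x (s.reg y + s.reg z)⟩
  | ⟨.minus x y z :: k, s⟩ => ⟨k, s.setReg x (s.reg y - s.reg z)⟩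
  | ⟨.load x y :: k, s⟩ => ⟨k, s.setReg x (s.mem (s.reg y).toNat)⟩
  | ⟨.store x y :: k, s⟩ => ⟨k, s.setMem (s.reg x).toNat (s.reg y)⟩
  | ⟨.seq a b :: k, s⟩ => ⟨a :: b :: k, s⟩
  | ⟨.cond x a b :: k, s⟩ => ⟨(if 0 < s.reg x then a else b) :: k, s⟩
  | ⟨.loop x a :: k, s⟩ => ⟨if 0 < s.reg x then a :: .loop x a :: k else k, s⟩

namespace RamProg

variable {n : ℕ}

/-- The initial state: the registers hold `n`, then the additional parameters `args`, then zeros;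
the memory holds `p 0, …, p (n-1), d 0, …, d (n-1)`, then zeros. -/
def initState (args : List ℕ) (I : TardinessInstance n) : RamState where
  reg r := ((n :: args).getD r 0 : ℕ)
  mem a :=
    if h : a < n then (I.p ⟨a, h⟩ : ℤ)
    else if h : a - n < n then I.d ⟨a - n, h⟩
    else 0

/-- The configuration after `t` steps on the parameters `args` and the instance `I`. -/
def run (A : RamProg) (args : List ℕ) (I : TardinessInstance n) (t : ℕ) : RamConfig :=
  RamConfig.step^[t] ⟨[A], initState args I⟩

/-- The program has halted after at most `t` steps. -/
def HaltsWithin (A : RamProg) (args : List ℕ) (I : TardinessInstance n) (t : ℕ) : Prop :=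
  (A.run args I t).todo = []

/-- On every instance the program halts with an optimal sequence in the memory cells
`2n, …, 3n-1` (the cell `2n + i` holds the number of the job in position `i`). -/
def SolvesTotalTardiness (A : RamProg) (args : List ℕ) : Prop :=
  ∀ (n : ℕ) (I : TardinessInstance n), ∃ t : ℕ, A.HaltsWithin args I t ∧
    ∃ σ : Equiv.Perm (Fin n), I.IsOptimal σ ∧
      ∀ i : Fin n, (A.run args I t).state.mem (2 * n + i) = ((σ i : ℕ) : ℤ)

/-- Every instance with `n` jobs is processed in at most `T n` steps. -/
def TimeBoundedBy (A : RamProg) (args : List ℕ) (T : ℕ → ℕ) : Prop :=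
  ∀ (n : ℕ) (I : TardinessInstance n), A.HaltsWithin args I (T n)

/-- Running time `O*(c ^ n)`: at most `q(n) * c ^ n` steps on `n` jobs, for a polynomial `q`. -/
def RunsInOStar (A : RamProg) (args : List ℕ) (c : ℝ) : Prop :=
  ∃ q : Polynomial ℕ, ∀ (n : ℕ) (I : TardinessInstance n),
    ∃ t : ℕ, A.HaltsWithin args I t ∧ (t : ℝ) ≤ (q.eval n : ℕ) * c ^ n

/-- Up to a polynomial factor (as in `O*`), the instances with `LPT = EDD` are worst-case instances:
every instance with `n` jobs needs at most `q(n)` times as many steps as some instance with `n` jobs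
and `LPT = EDD`. -/
def WorstCaseLPTEqEDD (A : RamProg) (args : List ℕ) : Prop :=
  ∃ q : Polynomial ℕ, ∀ (n : ℕ) (I : TardinessInstance n),
    ∃ J : TardinessInstance n, J.LPTEqEDD ∧
      ∀ t : ℕ, A.HaltsWithin args J t → A.HaltsWithin args I (q.eval n * t)

/-- Polynomial space: throughout the computation only the first `q(n)` memory cells are in use, and
every register and every cell holds an integer of at most `q(bitSize)` bits. -/
def UsesPolySpace (A : RamProg) (args : List ℕ) : Prop :=
  ∃ q : Polynomial ℕ, ∀ (n : ℕ) (I : TardinessInstance n) (t : ℕ),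
    (∀ a, (A.run args I t).state.mem a ≠ 0 → a < q.eval n) ∧
    (∀ a, ((A.run args I t).state.mem a).natAbs < 2 ^ q.eval I.bitSize) ∧
    (∀ r, ((A.run args I t).state.reg r).natAbs < 2 ^ q.eval I.bitSize)

end RamProg

/-! ### Sequences of jobs as lists and Lawler's decomposition -/

/-! The core is Lawler's decomposition (`exists_split_seqCost_le`). For a longest job `x` there is
an optimal sequence and a due date threshold `D ≥ d x` such that exactly the other jobs due by `D`
precede `x`. Number the jobs by due date. Then the jobs before and after `x` are separated by a cut
`c > x`, so `x` is followed by an index segment and preceded by a segment without `x`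
(`optCost_split_le`, `exists_optCost_split`).

Branching on every cut separately would cost more than `2 ^ n`. The program therefore computes, for
an alive set `A`, a whole table at once: entry `(u, v)` is the optimal cost of the jobs of `A` with
index in `[u, v)`, started when all earlier jobs of `A` are done (`segCost`). To fill the lines from
`b` on, let `l` be the first longest alive job from `b` on. Solve once without `l`, from `b` on;
solve once with `l` alive, from `l + 1` on. These two tables contain both sides of every cut for
every entry with `u ≤ l < v`, so a polynomial minimisation gives the remaining entries
(`newEntry_eq`). Both calls concern at most one job fewer, whence at most `4 * 2 ^ s - 3` polynomial
rounds for `s` jobs. One table and a stack of depth at most `n` suffice, since the second call only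
overwrites lines that are no longer needed (`guardedRun_solve`).

The table yields a cost. A sequence is obtained position by position: every remaining job is tried
as the next one, and a cheapest is fixed (`bestFirst_optimal`, `PositionInv.snoc`). This costs only
a polynomial factor, so the total time is of order `n ^ 5 * 2 ^ n` (`programTime_le`).

For the worst case claim, let processing times decrease strictly and due dates increase strictly.
The longest job from `b` on is then always the first, both calls have exactly one job fewer, and at
least `2 ^ (n - 1)` steps are made (`worstCase_program`). The recurrence is met by the same time
bound with its polynomial factor shifted by a constant depending on `k` (`shiftedTime_recurrence`).

On the machine level, every instruction at most doubles the largest absolute value (above 1). A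
round has polynomially many steps, and an explicit invariant bounds the values afresh at each round
head; so numbers keep polynomially many bits (`LocalExec.guarded`, `two_pow_mul_valueBound_lt`). -/

/-- The total tardiness of the jobs of a list, processed in this order from time `t` on. -/
def seqCost {ι : Type*} (p d : ι → ℤ) : ℤ → List ι → ℤ
  | _, [] => 0
  | t, j :: l => max (t + p j - d j) 0 + seqCost p d (t + p j) l

section SeqCost

variable {ι : Type*} (p d : ι → ℤ)

theorem seqCost_nonneg (t : ℤ) (l : List ι) : 0 ≤ seqCost p d t l := by
  induction l generalizing t with
  | nil => simp [seqCost]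
  | cons j l ih => exact add_nonneg (le_max_right _ _) (ih _)

theorem seqCost_append (t : ℤ) (l l' : List ι) :
    seqCost p d t (l ++ l') = seqCost p d t l + seqCost p d (t + (l.map p).sum) l' := by
  induction l generalizing t with
  | nil => simp [seqCost]
  | cons j l ih => simp [seqCost, ih, add_assoc]

theorem seqCost_mono {t t' : ℤ} (h : t ≤ t') (l : List ι) :
    seqCost p d t l ≤ seqCost p d t' l := by
  induction l generalizing t t' with
  | nil => simp [seqCost]
  | cons j l ih =>
    simp only [seqCost]
    have := ih (show t + p j ≤ t' + p j by linarith)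
    have : max (t + p j - d j) 0 ≤ max (t' + p j - d j) 0 := max_le_max (by linarith) le_rfl
    linarith

theorem seqCost_map {κ : Type*} (f : κ → ι) (t : ℤ) (l : List κ) :
    seqCost p d t (l.map f) = seqCost (p ∘ f) (d ∘ f) t l := by
  induction l generalizing t with
  | nil => rfl
  | cons j l ih => simp [seqCost, ih]

variable {p} (hp : ∀ i, 0 ≤ p i)
include hp

theorem sum_map_nonneg (l : List ι) : 0 ≤ (l.map p).sum :=
  List.sum_nonneg (by simpa using fun i _ => hp i)

theorem seqCost_filter_le (f : ι → Bool) (t : ℤ) (l : List ι) :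
    seqCost p d t (l.filter f) ≤ seqCost p d t l := by
  induction l generalizing t with
  | nil => simp
  | cons j l ih =>
    by_cases h : f j
    · simp [h, seqCost, ih]
    · simp only [h, List.filter_cons, seqCost]
      have h1 := ih t
      have h2 := seqCost_mono p d (show t ≤ t + p j by linarith [hp j]) l
      have h3 := le_max_right (t + p j - d j) 0
      simp only [Bool.false_eq_true, if_false]
      linarith

theorem seqCost_eq_zero (t : ℤ) (l : List ι) (h : ∀ i ∈ l, t + (l.map p).sum ≤ d i) :
    seqCost p d t l = 0 := by
  induction l generalizing t with
  | nil => rfl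
  | cons j l ih =>
    simp only [List.map_cons, List.sum_cons, List.mem_cons, forall_eq_or_imp] at h
    have h0 := sum_map_nonneg hp l
    rw [seqCost, ih (t + p j) (fun i hi => by have := h.2 i hi; linarith)]
    rw [max_eq_right (by linarith [h.1])]; rfl

/-- Every job finishes by `C` and is thus tardy by at most `Δ`. This crude estimate later bounds the
size of the table entries. -/
theorem seqCost_le_of_le (t C Δ : ℤ) (l : List ι) (hC : t + (l.map p).sum ≤ C) (hΔ : 0 ≤ Δ)
    (hCΔ : ∀ i ∈ l, C - d i ≤ Δ) : seqCost p d t l ≤ l.length * Δ := by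
  induction l generalizing t with
  | nil => simp [seqCost]
  | cons j l ih =>
    simp only [List.map_cons, List.sum_cons, List.mem_cons, forall_eq_or_imp] at hC hCΔ
    have h0 := sum_map_nonneg hp l
    have h1 := ih (t + p j) (by linarith) hCΔ.2
    have h2 : max (t + p j - d j) 0 ≤ Δ := max_le (by linarith [hCΔ.1]) hΔ
    simp only [seqCost, List.length_cons, Nat.cast_add, Nat.cast_one]
    linarith

/-- Exchanging a longest job with a later job that is due before it or before its completion. -/
theorem seqCost_exchange_le (t : ℤ) (x i : ι) (l₁ l₂ : List ι) (hi : p i ≤ p x)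
    (hd : d i ≤ max (d x) (t + p x)) :
    seqCost p d t (i :: l₁ ++ x :: l₂) ≤ seqCost p d t (x :: l₁ ++ i :: l₂) := by
  have h0 := sum_map_nonneg hp l₁
  have h1 := seqCost_mono p d (show t + p i ≤ t + p x by linarith) l₁
  have h2 : t + p i + (l₁.map p).sum + p x = t + p x + (l₁.map p).sum + p i := by ring
  simp only [List.cons_append, seqCost, seqCost_append]
  rw [h2]
  have h3 := hp i
  generalize (l₁.map p).sum = s at *
  -- If `d i ≤ d x`, giving the earlier completion to the job due earlier does no harm. If `d i ≤ t
  -- + p x`, then `i` was tardy ever since `t + p x`, so moving it forward gains at least `s + p i`,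
  -- which is the most that `x` can lose.
  have h4 : max (t + p i - d i) 0 + max (t + p x + s + p i - d x) 0 ≤
      max (t + p x - d x) 0 + max (t + p x + s + p i - d i) 0 := by
    rcases le_max_iff.1 hd with h | h <;> omega
  linarith

/-- Lawler's decomposition: around a longest job `x`, the jobs can be split by a due date. -/
theorem exists_split_seqCost_le (t : ℤ) (x : ι) (A B : List ι)
    (hx : ∀ i ∈ B ++ A, p i ≤ p x) :
    ∃ D, d x ≤ D ∧ ∃ B' A', (B' ++ x :: A').Perm (B ++ x :: A) ∧ (∀ i ∈ B', d i ≤ D) ∧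
      (∀ i ∈ A', D < d i) ∧ seqCost p d t (B' ++ x :: A') ≤ seqCost p d t (B ++ x :: A) := by
  -- The measure is the number of jobs after `x`: every exchange moves `x` to a later position.
  induction hn : A.length using Nat.strong_induction_on generalizing A B with
  | _ n ih =>
  set C := t + (B.map p).sum + p x with hC
  by_cases hA : ∃ i ∈ A, d i ≤ max (d x) C
  · obtain ⟨i, hi, hdi⟩ := hA
    obtain ⟨A₁, A₂, rfl⟩ := List.append_of_mem hi
    have hperm : (B ++ i :: A₁ ++ x :: A₂).Perm (B ++ x :: (A₁ ++ i :: A₂)) := by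
      rw [List.append_assoc]
      refine List.Perm.append_left _ ?_
      classical
      rw [List.perm_iff_count]
      intro a
      simp only [List.cons_append, List.count_cons, List.count_append]
      ring
    have hx' : ∀ j ∈ (B ++ i :: A₁) ++ A₂, p j ≤ p x := by
      intro j hj
      refine hx j ?_
      simp only [List.mem_append, List.mem_cons] at hj ⊢
      tauto
    obtain ⟨D, hD, B', A', h1, h2, h3, h4⟩ := ih A₂.length (by simp [← hn]; omega) A₂ (B ++ i :: A₁)
      hx' rfl
    refine ⟨D, hD, B', A', h1.trans hperm, h2, h3, h4.trans ?_⟩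
    rw [List.append_assoc, seqCost_append, seqCost_append p d t B]
    have := seqCost_exchange_le d hp (t + (B.map p).sum) x i A₁ A₂ (hx i (by simp)) hdi
    simpa using this
  · push Not at hA
    -- No exchange is left, so all jobs after `x` are due after the threshold `max (d x) C`. Jobs
    -- before `x` that are due after it move directly behind `x`: they still finish by `C`, hence on
    -- time, and everything else in front only gets earlier.
    refine ⟨max (d x) C, le_max_left _ _, B.filter (fun i => ¬ max (d x) C < d i),
      B.filter (fun i => max (d x) C < d i) ++ A, ?_, ?_, ?_, ?_⟩
    · have h := List.filter_append_perm (fun i => decide (max (d x) C < d i)) B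
      classical
      rw [List.perm_iff_count] at h ⊢
      intro a
      have := h a
      simp only [List.count_cons, List.count_append, decide_not] at this ⊢
      omega
    · intro i hi
      simpa using (List.mem_filter.1 hi).2
    · intro i hi
      rcases List.mem_append.1 hi with hi | hi
      · simpa using (List.mem_filter.1 hi).2
      · exact hA i hi
    · set X := B.filter (fun i => max (d x) C < d i) with hX
      set Y := B.filter (fun i => ¬ max (d x) C < d i) with hY
      have hs : (Y.map p).sum + (X.map p).sum = (B.map p).sum := by
        have h := ((List.filter_append_perm (fun i => decide (max (d x) C < d i)) B).map p).sum_eq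
        simp only [List.map_append, List.sum_append] at h
        rw [← h, hX, hY]
        simp only [decide_not]
        ring
      have hX0 := sum_map_nonneg hp X
      have h1 : seqCost p d (t + (Y.map p).sum + p x) X = 0 := by
        refine seqCost_eq_zero d hp _ _ fun i hi => ?_
        have hi' : max (d x) C < d i := by simpa using (List.mem_filter.1 hi).2
        have := le_max_right (d x) C
        linarith
      have h2 : seqCost p d t Y ≤ seqCost p d t B := seqCost_filter_le d hp _ t B
      simp only [seqCost_append, seqCost, h1, zero_add]
      rw [show t + (Y.map p).sum + p x + (X.map p).sum = t + (B.map p).sum + p x by linarith]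
      have h3 : max (t + (Y.map p).sum + p x - d x) 0 ≤ max (t + (B.map p).sum + p x - d x) 0 :=
        max_le_max (by linarith) le_rfl
      linarith

end SeqCost

/-! ### Optimal costs of sets of jobs -/

/-- The list `l` enumerates the finite set `S`. -/
def Enumerates (S : Finset ℕ) (l : List ℕ) : Prop := l.Nodup ∧ l.toFinset = S

theorem Enumerates.sum_map {S : Finset ℕ} {l : List ℕ} (h : Enumerates S l) (p : ℕ → ℤ) :
    (l.map p).sum = ∑ i ∈ S, p i := by
  rw [← h.2, List.sum_toFinset _ h.1]

theorem Enumerates.mem_iff {S : Finset ℕ} {l : List ℕ} (h : Enumerates S l) {i : ℕ} :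
    i ∈ l ↔ i ∈ S := by rw [← h.2, List.mem_toFinset]

theorem enumerates_toList (S : Finset ℕ) : Enumerates S S.toList :=
  ⟨S.nodup_toList, S.toList_toFinset⟩

theorem Enumerates.append_cons {S T : Finset ℕ} {l l' : List ℕ} {x : ℕ} (h : Enumerates S l)
    (h' : Enumerates T l') (hd : Disjoint S T) (hS : x ∉ S) (hT : x ∉ T) :
    Enumerates (insert x (S ∪ T)) (l ++ x :: l') := by
  constructor
  · rw [List.nodup_append']
    refine ⟨h.1, List.nodup_cons.2 ⟨by rwa [h'.mem_iff], h'.1⟩, ?_⟩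
    intro i hi hi'
    rw [h.mem_iff] at hi
    rcases List.mem_cons.1 hi' with rfl | hi'
    · exact hS hi
    · rw [h'.mem_iff] at hi'
      exact Finset.disjoint_left.1 hd hi hi'
  · ext i
    simp only [List.mem_toFinset, List.mem_append, List.mem_cons, h.mem_iff, h'.mem_iff,
      Finset.mem_insert, Finset.mem_union]
    tauto

/-- The least total tardiness of the jobs in `S`, processed from time `t` on. -/
noncomputable def optCost (p d : ℕ → ℤ) (t : ℤ) (S : Finset ℕ) : ℤ :=
  sInf {x | ∃ l, Enumerates S l ∧ seqCost p d t l = x}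

section OptCost

variable (p d : ℕ → ℤ)

theorem optCost_le (t : ℤ) {S : Finset ℕ} {l : List ℕ} (h : Enumerates S l) :
    optCost p d t S ≤ seqCost p d t l :=
  csInf_le ⟨0, by rintro _ ⟨l, -, rfl⟩; exact seqCost_nonneg p d t l⟩ ⟨l, h, rfl⟩

theorem exists_optCost (t : ℤ) (S : Finset ℕ) :
    ∃ l, Enumerates S l ∧ seqCost p d t l = optCost p d t S :=
  Int.csInf_mem (s := {x | ∃ l, Enumerates S l ∧ seqCost p d t l = x})
    ⟨_, S.toList, enumerates_toList S, rfl⟩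
    ⟨0, by rintro _ ⟨l, -, rfl⟩; exact seqCost_nonneg p d t l⟩

theorem optCost_nonneg (t : ℤ) (S : Finset ℕ) : 0 ≤ optCost p d t S := by
  obtain ⟨l, -, h⟩ := exists_optCost p d t S
  exact h ▸ seqCost_nonneg p d t l

theorem optCost_empty (t : ℤ) : optCost p d t ∅ = 0 :=
  le_antisymm (optCost_le p d t (l := []) ⟨List.nodup_nil, rfl⟩) (optCost_nonneg p d t ∅)

theorem optCost_cons_le (t : ℤ) {S : Finset ℕ} {j : ℕ} (hj : j ∈ S) :
    optCost p d t S ≤ max (t + p j - d j) 0 + optCost p d (t + p j) (S.erase j) := by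
  obtain ⟨l, hl, h⟩ := exists_optCost p d (t + p j) (S.erase j)
  rw [← h]
  refine optCost_le p d t (l := j :: l) ⟨List.nodup_cons.2 ⟨?_, hl.1⟩, ?_⟩
  · simp [hl.mem_iff]
  · rw [List.toFinset_cons, hl.2, Finset.insert_erase hj]

/-- Cutting off the head of an optimal list; together with `optCost_cons_le` this justifies choosing
the sequence one position at a time. -/
theorem exists_optCost_cons (t : ℤ) {S : Finset ℕ} (hS : S.Nonempty) :
    ∃ j ∈ S, optCost p d t S = max (t + p j - d j) 0 + optCost p d (t + p j) (S.erase j) := by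
  obtain ⟨l, hl, h⟩ := exists_optCost p d t S
  cases l with
  | nil =>
    have := hl.2
    simp only [List.toFinset_nil] at this
    exact absurd this.symm hS.ne_empty
  | cons j l =>
    have hj : j ∈ S := hl.mem_iff.1 (by simp)
    refine ⟨j, hj, le_antisymm (optCost_cons_le p d t hj) ?_⟩
    rw [← h, seqCost]
    refine add_le_add_right (optCost_le p d _ ⟨(List.nodup_cons.1 hl.1).2, ?_⟩) _
    have := hl.2
    rw [List.toFinset_cons] at this
    rw [← this, Finset.erase_insert (by simpa using (List.nodup_cons.1 hl.1).1)]

/-- Concatenating optimal lists for both sides of the cut with `x` in between is a feasible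
sequence. This direction needs neither that `x` is longest nor any order of the due dates. -/
theorem optCost_split_le (t : ℤ) {S : Finset ℕ} {x c : ℕ} (hx : x ∈ S) (hc : x < c) :
    optCost p d t S ≤ optCost p d t ((S.filter (· < c)).erase x) +
      max (t + ∑ i ∈ S.filter (· < c), p i - d x) 0 +
      optCost p d (t + ∑ i ∈ S.filter (· < c), p i) (S.filter (c ≤ ·)) := by
  have hxS : x ∈ S.filter (· < c) := Finset.mem_filter.2 ⟨hx, hc⟩
  obtain ⟨l, hl, h⟩ := exists_optCost p d t ((S.filter (· < c)).erase x)
  obtain ⟨l', hl', h'⟩ := exists_optCost p d (t + ∑ i ∈ S.filter (· < c), p i) (S.filter (c ≤ ·))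
  have hU : insert x ((S.filter (· < c)).erase x ∪ S.filter (c ≤ ·)) = S := by
    rw [← Finset.insert_union, Finset.insert_erase hxS]
    ext i
    simp only [Finset.mem_union, Finset.mem_filter, ← and_or_left]
    exact and_iff_left (lt_or_ge i c)
  have hE : Enumerates S (l ++ x :: l') := by
    rw [← hU]
    refine hl.append_cons hl' ?_ (by simp) (by simp [hc])
    rw [Finset.disjoint_left]
    intro i hi hi'
    simp only [Finset.mem_erase, Finset.mem_filter] at hi hi'
    omega
  refine (optCost_le p d t hE).trans (le_of_eq ?_)
  have hs := hl.sum_map p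
  have hs' := Finset.add_sum_erase _ p hxS
  rw [← h, ← h']
  simp only [seqCost_append, seqCost, hs]
  rw [show t + ∑ i ∈ (S.filter (· < c)).erase x, p i + p x = t + ∑ i ∈ S.filter (· < c), p i by
    rw [← hs']; ring]
  ring

variable {p} (hp : ∀ i, 0 ≤ p i)
include hp

/-- Lawler's threshold on due dates becomes a threshold on indices because the indices follow the
due date order. Equal due dates cause no trouble: they fall on the same side of the threshold. -/
theorem exists_optCost_split (t : ℤ) {S : Finset ℕ} {x v : ℕ} (hx : x ∈ S)
    (hmax : ∀ i ∈ S, p i ≤ p x) (hd : ∀ i ∈ S, ∀ j ∈ S, i ≤ j → d i ≤ d j)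
    (hv : ∀ i ∈ S, i < v) :
    ∃ c, x < c ∧ c ≤ v ∧ optCost p d t S = optCost p d t ((S.filter (· < c)).erase x) +
      max (t + ∑ i ∈ S.filter (· < c), p i - d x) 0 +
      optCost p d (t + ∑ i ∈ S.filter (· < c), p i) (S.filter (c ≤ ·)) := by
  obtain ⟨l, hl, h⟩ := exists_optCost p d t S
  obtain ⟨B₀, A₀, rfl⟩ := List.append_of_mem (hl.mem_iff.2 hx)
  obtain ⟨D, hD, B, A, hperm, hB, hA, hle⟩ := exists_split_seqCost_le d hp t x A₀ B₀ (by
    intro i hi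
    refine hmax i (hl.mem_iff.1 ?_)
    simp only [List.mem_append, List.mem_cons] at hi ⊢
    tauto)
  have hE : Enumerates S (B ++ x :: A) :=
    ⟨hperm.nodup_iff.2 hl.1, by rw [← hl.2]; exact List.toFinset_eq_of_perm _ _ hperm⟩
  have hAS : ∀ i ∈ A, i ∈ S := fun i hi => hE.mem_iff.1 (by simp [hi])
  have hBS : ∀ i ∈ B, i ∈ S := fun i hi => hE.mem_iff.1 (by simp [hi])
  have hBA : ∀ i ∈ B, ∀ j ∈ A, i < j := fun i hi j hj => by
    by_contra hij
    have := hd j (hAS j hj) i (hBS i hi) (not_lt.1 hij)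
    linarith [hB i hi, hA j hj]
  have hxA : ∀ j ∈ A, x < j := fun j hj => by
    by_contra hij
    have := hd j (hAS j hj) x hx (not_lt.1 hij)
    linarith [hA j hj]
  -- The cut is the least index after `x` in the sequence, or the end `v` if `x` comes last.
  obtain ⟨c, hxc, hcv, hcB, hcA⟩ : ∃ c, x < c ∧ c ≤ v ∧ (∀ i ∈ B, i < c) ∧ ∀ j ∈ A, c ≤ j := by
    rcases A.toFinset.eq_empty_or_nonempty with h0 | h0
    · rw [List.toFinset_eq_empty_iff] at h0
      exact ⟨v, hv x hx, le_rfl, fun i hi => hv i (hBS i hi), by simp [h0]⟩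
    · have hm := List.mem_toFinset.1 (A.toFinset.min'_mem h0)
      exact ⟨A.toFinset.min' h0, hxA _ hm, (hv _ (hAS _ hm)).le, fun i hi => hBA i hi _ hm,
        fun j hj => Finset.min'_le _ _ (List.mem_toFinset.2 hj)⟩
  refine ⟨c, hxc, hcv, le_antisymm (optCost_split_le p d t hx hxc) ?_⟩
  have hnd := List.nodup_append'.1 hE.1
  have hnd2 := List.nodup_cons.1 hnd.2.1
  have hxB : x ∉ B := fun hxB => hnd.2.2 hxB (by simp)
  have hBE : Enumerates ((S.filter (· < c)).erase x) B := by
    refine ⟨hnd.1, ?_⟩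
    ext i
    simp only [List.mem_toFinset, Finset.mem_erase, Finset.mem_filter]
    constructor
    · exact fun hi => ⟨fun hix => hxB (hix ▸ hi), hBS i hi, hcB i hi⟩
    · rintro ⟨h1, h2, h3⟩
      have h4 := hE.mem_iff.2 h2
      simp only [List.mem_append, List.mem_cons] at h4
      rcases h4 with h4 | h4 | h4
      · exact h4
      · exact absurd h4 h1
      · exact absurd (hcA i h4) (by omega)
  have hAE : Enumerates (S.filter (c ≤ ·)) A := by
    refine ⟨hnd2.2, ?_⟩
    ext i
    simp only [List.mem_toFinset, Finset.mem_filter]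
    constructor
    · exact fun hi => ⟨hAS i hi, hcA i hi⟩
    · rintro ⟨h2, h3⟩
      have h4 := hE.mem_iff.2 h2
      simp only [List.mem_append, List.mem_cons] at h4
      rcases h4 with h4 | h4 | h4
      · exact absurd (hcB i h4) (by omega)
      · omega
      · exact h4
  have h1 := optCost_le p d t hBE
  have h2 := optCost_le p d (t + ∑ i ∈ S.filter (· < c), p i) hAE
  have hs := hBE.sum_map p
  have hs' := Finset.add_sum_erase _ p (Finset.mem_filter.2 ⟨hx, hxc⟩ : x ∈ S.filter (· < c))
  rw [← h]
  refine le_trans ?_ hle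
  simp only [seqCost_append, seqCost]
  rw [show t + (B.map p).sum + p x = t + ∑ i ∈ S.filter (· < c), p i by rw [hs, ← hs']; ring]
  linarith

theorem optCost_le_card_mul (t C Δ : ℤ) {S : Finset ℕ} (hC : t + ∑ i ∈ S, p i ≤ C) (hΔ : 0 ≤ Δ)
    (h : ∀ i ∈ S, C - d i ≤ Δ) : optCost p d t S ≤ S.card * Δ := by
  have hE := enumerates_toList S
  refine (optCost_le p d t hE).trans ?_
  have := seqCost_le_of_le d hp t C Δ S.toList (by rwa [hE.sum_map]) hΔ
    (fun i hi => h i (hE.mem_iff.1 hi))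
  simpa using this

end OptCost

/-! ### Reasoning about runs of the machine -/

/-- All memory cells from `m` on hold zero. -/
def SupportedBelow (m : ℕ) (s : RamState) : Prop := ∀ a, m ≤ a → s.mem a = 0

/-- All registers and memory cells hold integers of absolute value at most `B`. -/
def BoundedBy (B : ℤ) (s : RamState) : Prop := (∀ r, |s.reg r| ≤ B) ∧ ∀ a, |s.mem a| ≤ B

/-- Executing the programs in `a` (and leaving those in `a'`) leads from `s` to `s'` in `t` steps.
On the way the memory beyond `m` stays empty, and the values at most double in each step. -/
def LocalRun (m : ℕ) (a a' : List RamProg) (s s' : RamState) (t : ℕ) : Prop :=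
  ∀ k, RamConfig.step^[t] ⟨a ++ k, s⟩ = ⟨a' ++ k, s'⟩ ∧
    (∀ i < t, k.length < (RamConfig.step^[i] ⟨a ++ k, s⟩).todo.length) ∧
    ∀ i ≤ t, (SupportedBelow m s → SupportedBelow m (RamConfig.step^[i] ⟨a ++ k, s⟩).state) ∧
      ∀ B, 1 ≤ B → BoundedBy B s → BoundedBy (2 ^ i * B) (RamConfig.step^[i] ⟨a ++ k, s⟩).state

/-- Executing the programs in `a` (and leaving those in `a'`) leads from `s` to `s'` in `t` steps,
through states that satisfy `G`. -/
def GuardedRun (G : RamState → Prop) (a a' : List RamProg) (s s' : RamState) (t : ℕ) : Prop :=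
  ∀ k, RamConfig.step^[t] ⟨a ++ k, s⟩ = ⟨a' ++ k, s'⟩ ∧
    ∀ i < t, k.length < (RamConfig.step^[i] ⟨a ++ k, s⟩).todo.length ∧
      G (RamConfig.step^[i] ⟨a ++ k, s⟩).state

/-- The program `a` leads from `s` to `s'` in at most `T` steps. -/
def LocalExec (m : ℕ) (a : RamProg) (s s' : RamState) (T : ℕ) : Prop :=
  ∃ t ≤ T, LocalRun m [a] [] s s' t

theorem LocalRun.refl (m : ℕ) (a : List RamProg) (s : RamState) : LocalRun m a a s s 0 := by
  intro k
  refine ⟨rfl, by simp, fun i hi => ?_⟩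
  obtain rfl : i = 0 := by omega
  exact ⟨id, fun B _ h => by simpa using h⟩

theorem LocalRun.trans {m : ℕ} {a a' a'' : List RamProg} {s s' s'' : RamState} {t t' : ℕ}
    (h : LocalRun m a a' s s' t) (h' : LocalRun m a' a'' s' s'' t') :
    LocalRun m a a'' s s'' (t + t') := by
  intro k
  obtain ⟨h1, h2, h3⟩ := h k
  obtain ⟨h1', h2', h3'⟩ := h' k
  have key : ∀ i, RamConfig.step^[t + i] ⟨a ++ k, s⟩ = RamConfig.step^[i] ⟨a' ++ k, s'⟩ := by
    intro i
    rw [add_comm, Function.iterate_add_apply, h1]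
  have hlast := h3 t le_rfl
  rw [h1] at hlast
  refine ⟨by rw [key, h1'], fun i hi => ?_, fun i hi => ?_⟩
  · rcases lt_or_ge i t with hit | hit
    · exact h2 i hit
    · obtain ⟨j, rfl⟩ := Nat.exists_eq_add_of_le hit
      rw [key]
      exact h2' j (by omega)
  · rcases lt_or_ge i t with hit | hit
    · exact h3 i hit.le
    · obtain ⟨j, rfl⟩ := Nat.exists_eq_add_of_le hit
      rw [key]
      obtain ⟨h4, h5⟩ := h3' j (by omega)
      refine ⟨fun hs => h4 (hlast.1 hs), fun B hB hs => ?_⟩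
      have := h5 (2 ^ t * B) (by nlinarith [pow_pos (show (0 : ℤ) < 2 by norm_num) t])
        (hlast.2 B hB hs)
      rwa [← mul_assoc, ← pow_add, add_comm j t] at this

theorem LocalRun.append {m : ℕ} {a a' : List RamProg} {s s' : RamState} {t : ℕ}
    (h : LocalRun m a a' s s' t) (b : List RamProg) :
    LocalRun m (a ++ b) (a' ++ b) s s' t := by
  intro k
  obtain ⟨h1, h2, h3⟩ := h (b ++ k)
  simp only [List.append_assoc]
  refine ⟨h1, fun i hi => lt_of_le_of_lt ?_ (h2 i hi), h3⟩
  simp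

theorem LocalRun.one {m : ℕ} {a : RamProg} {a' : List RamProg} {s s' : RamState}
    (h : ∀ k, RamConfig.step ⟨a :: k, s⟩ = ⟨a' ++ k, s'⟩)
    (hs : SupportedBelow m s → SupportedBelow m s')
    (hB : ∀ B, 1 ≤ B → BoundedBy B s → BoundedBy (2 * B) s') : LocalRun m [a] a' s s' 1 := by
  intro k
  refine ⟨h k, fun i hi => ?_, fun i hi => ?_⟩
  · obtain rfl : i = 0 := by omega
    simp
  · obtain rfl | rfl : i = 0 ∨ i = 1 := by omega
    · exact ⟨id, fun B _ h => by simpa using h⟩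
    · simp only [Function.iterate_one, List.cons_append, List.nil_append, h, pow_one]
      exact ⟨hs, hB⟩

theorem BoundedBy.mono {B B' : ℤ} {s : RamState} (h : BoundedBy B s) (hB : B ≤ B') :
    BoundedBy B' s :=
  ⟨fun r => (h.1 r).trans hB, fun a => (h.2 a).trans hB⟩

theorem BoundedBy.setReg {B : ℤ} {s : RamState} (h : BoundedBy B s) (x : ℕ) {v : ℤ}
    (hv : |v| ≤ B) : BoundedBy B (s.setReg x v) := by
  refine ⟨fun r => ?_, h.2⟩
  simp only [RamState.setReg, Function.update_apply]
  split_ifs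
  · exact hv
  · exact h.1 r

theorem BoundedBy.setMem {B : ℤ} {s : RamState} (h : BoundedBy B s) (a : ℕ) {v : ℤ}
    (hv : |v| ≤ B) : BoundedBy B (s.setMem a v) := by
  refine ⟨h.1, fun r => ?_⟩
  simp only [RamState.setMem, Function.update_apply]
  split_ifs
  · exact hv
  · exact h.2 r

namespace RamProg

/-- The effect of a program without loops. -/
def effect : RamProg → RamState → RamState
  | .const x c, s => s.setReg x c
  | .plus x y z, s => s.setReg x (s.reg y + s.reg z)
  | .minus x y z, s => s.setReg x (s.reg y - s.reg z)
  | .load x y, s => s.setReg x (s.mem (s.reg y).toNat)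
  | .store x y, s => s.setMem (s.reg x).toNat (s.reg y)
  | .seq a b, s => b.effect (a.effect s)
  | .cond x a b, s => if 0 < s.reg x then a.effect s else b.effect s
  | .loop _ _, s => s

/-- The program has no loops, uses only the constants `-1`, `0`, `1` and, started in `s`, writes
only to memory cells below `m`. -/
def Straight (m : ℕ) : RamProg → RamState → Prop
  | .const _ c, _ => |c| ≤ 1
  | .plus _ _ _, _ => True
  | .minus _ _ _, _ => True
  | .load _ _, _ => True
  | .store x _, s => (s.reg x).toNat < m
  | .seq a b, s => a.Straight m s ∧ b.Straight m (a.effect s)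
  | .cond x a b, s => if 0 < s.reg x then a.Straight m s else b.Straight m s
  | .loop _ _, _ => False

/-- The number of nodes of a program; it bounds the running time of a program without loops. -/
def nodes : RamProg → ℕ
  | .seq a b => a.nodes + b.nodes + 1
  | .cond _ a b => a.nodes + b.nodes + 1
  | .loop _ a => a.nodes + 1
  | _ => 1

/-- The programs of a list, one after the other; register `2` is reset to `0` at the end. -/
def block : List RamProg → RamProg
  | [] => .const 2 0
  | a :: l => .seq a (block l)

end RamProg

theorem LocalExec.mono {m : ℕ} {a : RamProg} {s s' : RamState} {T T' : ℕ}
    (h : LocalExec m a s s' T) (hT : T ≤ T') : LocalExec m a s s' T' := by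
  obtain ⟨t, ht, h⟩ := h
  exact ⟨t, ht.trans hT, h⟩

theorem LocalExec.congr {m : ℕ} {a : RamProg} {s s' t t' : RamState} {T : ℕ}
    (h : LocalExec m a s s' T) (hs : s = t) (hs' : s' = t') : LocalExec m a t t' T :=
  hs ▸ hs' ▸ h

theorem LocalExec.seq {m : ℕ} {a b : RamProg} {s s' s'' : RamState} {T T' : ℕ}
    (h : LocalExec m a s s' T) (h' : LocalExec m b s' s'' T') :
    LocalExec m (.seq a b) s s'' (T + T' + 1) := by
  obtain ⟨t, ht, h⟩ := h
  obtain ⟨t', ht', h'⟩ := h'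
  refine ⟨1 + t + t', by omega, ?_⟩
  refine LocalRun.trans (LocalRun.trans (a' := [a, b]) (LocalRun.one (fun k => rfl) id ?_)
    (h.append [b])) h'
  exact fun B hB hs => hs.mono (by linarith)

theorem LocalExec.cond_pos {m x : ℕ} {a b : RamProg} {s s' : RamState} {T : ℕ}
    (hx : 0 < s.reg x) (h : LocalExec m a s s' T) : LocalExec m (.cond x a b) s s' (T + 1) := by
  obtain ⟨t, ht, h⟩ := h
  refine ⟨1 + t, by omega, LocalRun.trans (LocalRun.one (fun k => ?_) id ?_) h⟩
  · simp [RamConfig.step, hx]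
  · exact fun B hB hs => hs.mono (by linarith)

theorem LocalExec.cond_neg {m x : ℕ} {a b : RamProg} {s s' : RamState} {T : ℕ}
    (hx : ¬ 0 < s.reg x) (h : LocalExec m b s s' T) : LocalExec m (.cond x a b) s s' (T + 1) := by
  obtain ⟨t, ht, h⟩ := h
  refine ⟨1 + t, by omega, LocalRun.trans (LocalRun.one (fun k => ?_) id ?_) h⟩
  · simp [RamConfig.step, hx]
  · exact fun B hB hs => hs.mono (by linarith)

/-- Symbolic execution of loop-free code: a run is replaced by the computable `effect`, which `simp`
can evaluate. Constants of absolute value at most 1 and sums of two registers respect the doubling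
bound because `B` is at least 1. -/
theorem LocalExec.effect {m : ℕ} {a : RamProg} {s : RamState} (h : a.Straight m s) :
    LocalExec m a s (a.effect s) a.nodes := by
  induction a generalizing s with
  | const x c =>
    refine ⟨1, le_rfl, LocalRun.one (fun k => rfl) id fun B hB hs => ?_⟩
    exact (hs.mono (by linarith)).setReg x (le_trans h (by linarith))
  | plus x y z =>
    refine ⟨1, le_rfl, LocalRun.one (fun k => rfl) id fun B hB hs => ?_⟩
    refine (hs.mono (by linarith)).setReg x ((abs_add_le _ _).trans ?_)
    linarith [hs.1 y, hs.1 z]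
  | minus x y z =>
    refine ⟨1, le_rfl, LocalRun.one (fun k => rfl) id fun B hB hs => ?_⟩
    refine (hs.mono (by linarith)).setReg x ((abs_sub _ _).trans ?_)
    linarith [hs.1 y, hs.1 z]
  | load x y =>
    refine ⟨1, le_rfl, LocalRun.one (fun k => rfl) id fun B hB hs => ?_⟩
    exact (hs.mono (by linarith)).setReg x ((hs.2 _).trans (by linarith))
  | store x y =>
    refine ⟨1, le_rfl, LocalRun.one (fun k => rfl) (fun hs a ha => ?_) fun B hB hs => ?_⟩
    · have hne : a ≠ (s.reg x).toNat := (lt_of_lt_of_le h ha).ne'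
      simpa [RamProg.effect, RamState.setMem, Function.update_apply, hne] using hs a ha
    · exact (hs.mono (by linarith)).setMem _ ((hs.1 _).trans (by linarith))
  | seq a b iha ihb => exact (iha h.1).seq (ihb h.2)
  | cond x a b iha ihb =>
    by_cases hx : 0 < s.reg x
    · simp only [RamProg.Straight, if_pos hx] at h
      simp only [RamProg.effect, if_pos hx]
      exact ((iha h).cond_pos hx).mono (by simp [RamProg.nodes])
    · simp only [RamProg.Straight, if_neg hx] at h
      simp only [RamProg.effect, if_neg hx]
      exact ((ihb h).cond_neg hx).mono (by simp [RamProg.nodes])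
  | loop x a => exact h.elim

theorem LocalExec.of_effect {m : ℕ} {a : RamProg} {s s' : RamState} (h : a.Straight m s)
    (hs : a.effect s = s') : LocalExec m a s s' a.nodes :=
  hs ▸ LocalExec.effect h

/-- A loop whose body leads from `f j` to `f (j + 1)` in each of `N` rounds. -/
theorem LocalExec.loop {m x : ℕ} {a : RamProg} {N T : ℕ} (f : ℕ → RamState)
    (hx : ∀ j < N, 0 < (f j).reg x) (ha : ∀ j < N, LocalExec m a (f j) (f (j + 1)) T)
    (hN : ¬ 0 < (f N).reg x) : LocalExec m (.loop x a) (f 0) (f N) (N * (T + 1) + 1) := by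
  have key : ∀ j ≤ N, ∃ t ≤ j * (T + 1),
      LocalRun m [.loop x a] [.loop x a] (f 0) (f j) t := by
    intro j
    induction j with
    | zero => exact fun _ => ⟨0, by simp, LocalRun.refl _ _ _⟩
    | succ j ih =>
      intro hj
      obtain ⟨t, ht, h⟩ := ih (by omega)
      obtain ⟨t', ht', h'⟩ := ha j (by omega)
      refine ⟨t + (1 + t'), by nlinarith, h.trans (LocalRun.trans (a' := [a, .loop x a])
        (LocalRun.one (fun k => ?_) id ?_) (h'.append [.loop x a]))⟩
      · simp [RamConfig.step, hx j (by omega)]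
      · exact fun B hB hs => hs.mono (by linarith)
  obtain ⟨t, ht, h⟩ := key N le_rfl
  refine ⟨t + 1, by omega, h.trans (LocalRun.one (fun k => ?_) id ?_)⟩
  · simp [RamConfig.step, hN]
  · exact fun B hB hs => hs.mono (by linarith)

/-! ### Composition of runs that stay inside a set of states -/

theorem GuardedRun.refl (G : RamState → Prop) (a : List RamProg) (s : RamState) :
    GuardedRun G a a s s 0 :=
  fun _ => ⟨rfl, by simp⟩

theorem GuardedRun.trans {G : RamState → Prop} {a a' a'' : List RamProg} {s s' s'' : RamState}
    {t t' : ℕ} (h : GuardedRun G a a' s s' t) (h' : GuardedRun G a' a'' s' s'' t') :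
    GuardedRun G a a'' s s'' (t + t') := by
  intro k
  obtain ⟨h1, h2⟩ := h k
  obtain ⟨h1', h2'⟩ := h' k
  have key : ∀ i, RamConfig.step^[t + i] ⟨a ++ k, s⟩ = RamConfig.step^[i] ⟨a' ++ k, s'⟩ := by
    intro i
    rw [add_comm, Function.iterate_add_apply, h1]
  refine ⟨by rw [key, h1'], fun i hi => ?_⟩
  rcases lt_or_ge i t with hit | hit
  · exact h2 i hit
  · obtain ⟨j, rfl⟩ := Nat.exists_eq_add_of_le hit
    rw [key]
    exact h2' j (by omega)

theorem GuardedRun.append {G : RamState → Prop} {a a' : List RamProg} {s s' : RamState} {t : ℕ}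
    (h : GuardedRun G a a' s s' t) (b : List RamProg) :
    GuardedRun G (a ++ b) (a' ++ b) s s' t := by
  intro k
  obtain ⟨h1, h2⟩ := h (b ++ k)
  simp only [List.append_assoc]
  refine ⟨h1, fun i hi => ⟨lt_of_le_of_lt ?_ (h2 i hi).1, (h2 i hi).2⟩⟩
  simp

theorem GuardedRun.one {G : RamState → Prop} {a : RamProg} {a' : List RamProg} {s : RamState}
    (h : ∀ k, RamConfig.step ⟨a :: k, s⟩ = ⟨a' ++ k, s⟩) (hs : G s) :
    GuardedRun G [a] a' s s 1 := by
  intro k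
  refine ⟨h k, fun i hi => ?_⟩
  obtain rfl : i = 0 := by omega
  exact ⟨by simp, hs⟩

theorem GuardedRun.seq {G : RamState → Prop} {a b : RamProg} {s s' s'' : RamState} {t t' : ℕ}
    (h : GuardedRun G [a] [] s s' t) (h' : GuardedRun G [b] [] s' s'' t') (hs : G s) :
    GuardedRun G [.seq a b] [] s s'' (1 + t + t') :=
  ((GuardedRun.one (a' := [a, b]) (fun _ => rfl) hs).trans (h.append [b])).trans h'

theorem GuardedRun.cond_pos {G : RamState → Prop} {x : ℕ} {a b : RamProg} {s s' : RamState}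
    {t : ℕ} (hx : 0 < s.reg x) (h : GuardedRun G [a] [] s s' t) (hs : G s) :
    GuardedRun G [.cond x a b] [] s s' (1 + t) :=
  (GuardedRun.one (fun k => by simp [RamConfig.step, hx]) hs).trans h

theorem GuardedRun.cond_neg {G : RamState → Prop} {x : ℕ} {a b : RamProg} {s s' : RamState}
    {t : ℕ} (hx : ¬ 0 < s.reg x) (h : GuardedRun G [b] [] s s' t) (hs : G s) :
    GuardedRun G [.cond x a b] [] s s' (1 + t) :=
  (GuardedRun.one (fun k => by simp [RamConfig.step, hx]) hs).trans h

/-- One round of a loop. -/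
theorem GuardedRun.loop_round {G : RamState → Prop} {x : ℕ} {a : RamProg} {s s' : RamState}
    {t : ℕ} (hx : 0 < s.reg x) (h : GuardedRun G [a] [] s s' t) (hs : G s) :
    GuardedRun G [.loop x a] [.loop x a] s s' (1 + t) :=
  (GuardedRun.one (a' := [a, .loop x a]) (fun k => by simp [RamConfig.step, hx]) hs).trans
    (h.append [.loop x a])

theorem GuardedRun.loop_exit {G : RamState → Prop} {x : ℕ} {a : RamProg} {s : RamState}
    (hx : ¬ 0 < s.reg x) (hs : G s) : GuardedRun G [.loop x a] [] s s 1 :=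
  GuardedRun.one (fun k => by simp [RamConfig.step, hx]) hs

/-- The states with empty memory beyond `m` and values bounded by `B`. -/
def WithinBounds (m : ℕ) (B : ℤ) (s : RamState) : Prop := SupportedBelow m s ∧ BoundedBy B s

/-- Doubling at most `τ` times turns the relative growth bound into one fixed guard. After each
piece an invariant can reset the bound to `B`, so the doublings do not accumulate over the
exponentially long run. -/
theorem LocalExec.guarded {m T τ : ℕ} {B : ℤ} {a : RamProg} {s s' : RamState}
    (h : LocalExec m a s s' T) (hT : T ≤ τ) (hB : 1 ≤ B) (hs : WithinBounds m B s) :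
    ∃ t ≤ T, GuardedRun (WithinBounds m (2 ^ τ * B)) [a] [] s s' t := by
  obtain ⟨t, ht, h⟩ := h
  refine ⟨t, ht, fun k => ⟨(h k).1, fun i hi => ⟨(h k).2.1 i hi, ?_, ?_⟩⟩⟩
  · exact ((h k).2.2 i hi.le).1 hs.1
  · refine (((h k).2.2 i hi.le).2 B hB hs.2).mono ?_
    exact mul_le_mul_of_nonneg_right (pow_le_pow_right₀ (by norm_num) (by omega)) (by linarith)

/-- A loop of `N` rounds that preserves an indexed invariant. -/
theorem GuardedRun.loop {G : RamState → Prop} {x : ℕ} {a : RamProg} {N T : ℕ} (L : ℕ → ℕ)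
    (Inv : ℕ → RamState → Prop) (hG : ∀ j ≤ N, ∀ s, Inv j s → G s)
    (hround : ∀ j < N, ∀ s, Inv j s → 0 < s.reg x ∧
      ∃ s' t, L j ≤ t ∧ t ≤ T ∧ GuardedRun G [a] [] s s' t ∧ Inv (j + 1) s')
    (hexit : ∀ s, Inv N s → ¬ 0 < s.reg x) {s : RamState} (hs : Inv 0 s) :
    ∃ s' t, ∑ j ∈ Finset.range N, L j ≤ t ∧ t ≤ N * (T + 1) + 1 ∧
      GuardedRun G [.loop x a] [] s s' t ∧ Inv N s' := by
  have key : ∀ j ≤ N, ∃ s' t, ∑ i ∈ Finset.range j, L i ≤ t ∧ t ≤ j * (T + 1) ∧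
      GuardedRun G [.loop x a] [.loop x a] s s' t ∧ Inv j s' := by
    intro j
    induction j with
    | zero => exact fun _ => ⟨s, 0, by simp, by simp, GuardedRun.refl _ _ _, hs⟩
    | succ j ih =>
      intro hj
      obtain ⟨s', t, hl, ht, h, hI⟩ := ih (by omega)
      obtain ⟨hx, s'', t', hl', ht', h', hI'⟩ := hround j (by omega) s' hI
      refine ⟨s'', t + (1 + t'), ?_, by nlinarith,
        h.trans (GuardedRun.loop_round hx h' (hG j (by omega) s' hI)), hI'⟩
      rw [Finset.sum_range_succ]
      omega
  obtain ⟨s', t, hl, ht, h, hI⟩ := key N le_rfl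
  exact ⟨s', t + 1, by omega, by omega,
    h.trans (GuardedRun.loop_exit (hexit s' hI) (hG N le_rfl s' hI)), hI⟩

/-! ### Registers and memory layout of the program -/

notation "r_n" => 0
notation "r_one" => 1
notation "r_zero" => 2
notation "r_P" => 3
notation "r_D" => 4
notation "r_I" => 5
notation "r_A" => 6
notation "r_L" => 7
notation "r_B" => 8
notation "r_X" => 9
notation "r_w" => 10
notation "r_start" => 11
notation "r_pos" => 12
notation "r_op" => 13
notation "r_j" => 14
notation "r_cj" => 15
notation "r_best" => 16
notation "r_bj" => 17
notation "r_st" => 18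
notation "r_b" => 19
notation "r_h" => 20
notation "r_m" => 21
notation "r_go" => 22
notation "r_l" => 23
notation "r_i" => 24
notation "r_ci" => 25
notation "r_x" => 26
notation "r_y" => 27
notation "r_z" => 28
notation "r_s0" => 29
notation "r_dl" => 30
notation "r_u" => 31
notation "r_cu" => 32
notation "r_v" => 33
notation "r_cv" => 34
notation "r_c" => 35
notation "r_cc" => 36
notation "r_tm" => 37
notation "r_bst" => 38

/-- The variable registers of the program. -/
structure Regs where
  start : ℤ := 0
  pos : ℤ := 0
  op : ℤ := 0
  j : ℤ := 0
  cj : ℤ := 0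
  best : ℤ := 0
  bj : ℤ := 0
  st : ℤ := 0
  b : ℤ := 0
  h : ℤ := 0
  m : ℤ := 0
  go : ℤ := 0
  l : ℤ := 0
  i : ℤ := 0
  ci : ℤ := 0
  x : ℤ := 0
  y : ℤ := 0
  z : ℤ := 0
  s0 : ℤ := 0
  dl : ℤ := 0
  u : ℤ := 0
  cu : ℤ := 0
  v : ℤ := 0
  cv : ℤ := 0
  c : ℤ := 0
  cc : ℤ := 0
  tm : ℤ := 0
  bst : ℤ := 0

/-- The memory of the program: the input and output cells, seven arrays and a table. -/
structure Mem where
  inp : ℕ → ℤ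
  P : ℕ → ℤ
  D : ℕ → ℤ
  I : ℕ → ℤ
  A : ℕ → ℤ
  L : ℕ → ℤ
  B : ℕ → ℤ
  X : ℕ → ℤ
  T : ℕ → ℕ → ℤ

/-- The address of the first cell of row `r`, as an integer. -/
def cellBase (n r : ℕ) : ℤ := 3 * n + r * (n + 1)

/-- The number of memory cells in use. -/
def memSize (n : ℕ) : ℕ := 3 * n + (n + 8) * (n + 1)

/-- The arrays and the lines of the table, as rows of length `n + 1`. -/
def Mem.row (M : Mem) : ℕ → ℕ → ℤ
  | 0 => M.P
  | 1 => M.D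
  | 2 => M.I
  | 3 => M.A
  | 4 => M.L
  | 5 => M.B
  | 6 => M.X
  | r + 7 => M.T r

def Mem.toFun (n : ℕ) (M : Mem) (a : ℕ) : ℤ :=
  if a < 3 * n then M.inp a
  else if (a - 3 * n) / (n + 1) < n + 8 then
    M.row ((a - 3 * n) / (n + 1)) ((a - 3 * n) % (n + 1))
  else 0

/-- The contents of the registers: constants, then the variables. -/
def Regs.toList (n : ℕ) (R : Regs) : List ℤ :=
  [(n : ℤ), 1, 0, cellBase n 0, cellBase n 1, cellBase n 2, cellBase n 3,
    cellBase n 4, cellBase n 5, cellBase n 6, (n : ℤ) + 1,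
    R.start, R.pos, R.op, R.j, R.cj, R.best, R.bj, R.st, R.b, R.h, R.m, R.go, R.l, R.i,
    R.ci, R.x, R.y, R.z, R.s0, R.dl, R.u, R.cu, R.v, R.cv, R.c, R.cc, R.tm, R.bst]

/-- The machine state given by registers and memory. -/
def mkState (n : ℕ) (R : Regs) (M : Mem) : RamState where
  reg r := (R.toList n).getD r 0
  mem := M.toFun n

theorem update_getD (l : List ℤ) (r : ℕ) (v : ℤ) (hr : r < l.length) :
    Function.update (fun r => l.getD r 0) r v = fun q => (l.set r v).getD q 0 := by
  funext q
  by_cases h : q = r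
  · subst h
    simp [List.getD, hr]
  · simp [h, List.getD, Ne.symm h]

/-- Turns a register write into a record update; for a concrete register the list equation holds by
`rfl`, so the `simp` lemmas below are uniform. -/
theorem mkState_setReg (n : ℕ) (R R' : Regs) (M : Mem) (r : ℕ) (v : ℤ)
    (hr : r < (R.toList n).length) (h : (R.toList n).set r v = R'.toList n) :
    (mkState n R M).setReg r v = mkState n R' M := by
  simp only [mkState, RamState.setReg, update_getD _ _ _ hr, h]

section RegisterLemmas

variable (n : ℕ) (R : Regs) (M : Mem) (w : ℤ)

@[simp] theorem reg_rn : (mkState n R M).reg 0 = (n : ℤ) := rfl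
@[simp] theorem reg_rOne : (mkState n R M).reg 1 = 1 := rfl
@[simp] theorem reg_rZero : (mkState n R M).reg 2 = 0 := rfl
@[simp] theorem reg_rP : (mkState n R M).reg 3 = cellBase n 0 := rfl
@[simp] theorem reg_rD : (mkState n R M).reg 4 = cellBase n 1 := rfl
@[simp] theorem reg_rI : (mkState n R M).reg 5 = cellBase n 2 := rfl
@[simp] theorem reg_rA : (mkState n R M).reg 6 = cellBase n 3 := rfl
@[simp] theorem reg_rL : (mkState n R M).reg 7 = cellBase n 4 := rfl
@[simp] theorem reg_rB : (mkState n R M).reg 8 = cellBase n 5 := rfl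
@[simp] theorem reg_rX : (mkState n R M).reg 9 = cellBase n 6 := rfl
@[simp] theorem reg_rw : (mkState n R M).reg 10 = (n : ℤ) + 1 := rfl
@[simp] theorem reg_start : (mkState n R M).reg 11 = R.start := rfl
@[simp] theorem reg_pos : (mkState n R M).reg 12 = R.pos := rfl
@[simp] theorem reg_op : (mkState n R M).reg 13 = R.op := rfl
@[simp] theorem reg_j : (mkState n R M).reg 14 = R.j := rfl
@[simp] theorem reg_cj : (mkState n R M).reg 15 = R.cj := rfl
@[simp] theorem reg_best : (mkState n R M).reg 16 = R.best := rfl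
@[simp] theorem reg_bj : (mkState n R M).reg 17 = R.bj := rfl
@[simp] theorem reg_st : (mkState n R M).reg 18 = R.st := rfl
@[simp] theorem reg_b : (mkState n R M).reg 19 = R.b := rfl
@[simp] theorem reg_h : (mkState n R M).reg 20 = R.h := rfl
@[simp] theorem reg_m : (mkState n R M).reg 21 = R.m := rfl
@[simp] theorem reg_go : (mkState n R M).reg 22 = R.go := rfl
@[simp] theorem reg_l : (mkState n R M).reg 23 = R.l := rfl
@[simp] theorem reg_i : (mkState n R M).reg 24 = R.i := rfl
@[simp] theorem reg_ci : (mkState n R M).reg 25 = R.ci := rfl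
@[simp] theorem reg_x : (mkState n R M).reg 26 = R.x := rfl
@[simp] theorem reg_y : (mkState n R M).reg 27 = R.y := rfl
@[simp] theorem reg_z : (mkState n R M).reg 28 = R.z := rfl
@[simp] theorem reg_s0 : (mkState n R M).reg 29 = R.s0 := rfl
@[simp] theorem reg_dl : (mkState n R M).reg 30 = R.dl := rfl
@[simp] theorem reg_u : (mkState n R M).reg 31 = R.u := rfl
@[simp] theorem reg_cu : (mkState n R M).reg 32 = R.cu := rfl
@[simp] theorem reg_v : (mkState n R M).reg 33 = R.v := rfl
@[simp] theorem reg_cv : (mkState n R M).reg 34 = R.cv := rfl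
@[simp] theorem reg_c : (mkState n R M).reg 35 = R.c := rfl
@[simp] theorem reg_cc : (mkState n R M).reg 36 = R.cc := rfl
@[simp] theorem reg_tm : (mkState n R M).reg 37 = R.tm := rfl
@[simp] theorem reg_bst : (mkState n R M).reg 38 = R.bst := rfl

@[simp] theorem setReg_rZero : (mkState n R M).setReg 2 0 = mkState n R M :=
  mkState_setReg n R R M _ _ (by simp [Regs.toList]) rfl
@[simp] theorem setReg_start : (mkState n R M).setReg 11 w = mkState n { R with start := w } M :=
  mkState_setReg n R _ M _ _ (by simp [Regs.toList]) rfl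
@[simp] theorem setReg_pos : (mkState n R M).setReg 12 w = mkState n { R with pos := w } M :=
  mkState_setReg n R _ M _ _ (by simp [Regs.toList]) rfl
@[simp] theorem setReg_op : (mkState n R M).setReg 13 w = mkState n { R with op := w } M :=
  mkState_setReg n R _ M _ _ (by simp [Regs.toList]) rfl
@[simp] theorem setReg_j : (mkState n R M).setReg 14 w = mkState n { R with j := w } M :=
  mkState_setReg n R _ M _ _ (by simp [Regs.toList]) rfl
@[simp] theorem setReg_cj : (mkState n R M).setReg 15 w = mkState n { R with cj := w } M :=
  mkState_setReg n R _ M _ _ (by simp [Regs.toList]) rfl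
@[simp] theorem setReg_best : (mkState n R M).setReg 16 w = mkState n { R with best := w } M :=
  mkState_setReg n R _ M _ _ (by simp [Regs.toList]) rfl
@[simp] theorem setReg_bj : (mkState n R M).setReg 17 w = mkState n { R with bj := w } M :=
  mkState_setReg n R _ M _ _ (by simp [Regs.toList]) rfl
@[simp] theorem setReg_st : (mkState n R M).setReg 18 w = mkState n { R with st := w } M :=
  mkState_setReg n R _ M _ _ (by simp [Regs.toList]) rfl
@[simp] theorem setReg_b : (mkState n R M).setReg 19 w = mkState n { R with b := w } M :=
  mkState_setReg n R _ M _ _ (by simp [Regs.toList]) rfl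
@[simp] theorem setReg_h : (mkState n R M).setReg 20 w = mkState n { R with h := w } M :=
  mkState_setReg n R _ M _ _ (by simp [Regs.toList]) rfl
@[simp] theorem setReg_m : (mkState n R M).setReg 21 w = mkState n { R with m := w } M :=
  mkState_setReg n R _ M _ _ (by simp [Regs.toList]) rfl
@[simp] theorem setReg_go : (mkState n R M).setReg 22 w = mkState n { R with go := w } M :=
  mkState_setReg n R _ M _ _ (by simp [Regs.toList]) rfl
@[simp] theorem setReg_l : (mkState n R M).setReg 23 w = mkState n { R with l := w } M :=
  mkState_setReg n R _ M _ _ (by simp [Regs.toList]) rfl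
@[simp] theorem setReg_i : (mkState n R M).setReg 24 w = mkState n { R with i := w } M :=
  mkState_setReg n R _ M _ _ (by simp [Regs.toList]) rfl
@[simp] theorem setReg_ci : (mkState n R M).setReg 25 w = mkState n { R with ci := w } M :=
  mkState_setReg n R _ M _ _ (by simp [Regs.toList]) rfl
@[simp] theorem setReg_x : (mkState n R M).setReg 26 w = mkState n { R with x := w } M :=
  mkState_setReg n R _ M _ _ (by simp [Regs.toList]) rfl
@[simp] theorem setReg_y : (mkState n R M).setReg 27 w = mkState n { R with y := w } M :=
  mkState_setReg n R _ M _ _ (by simp [Regs.toList]) rfl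
@[simp] theorem setReg_z : (mkState n R M).setReg 28 w = mkState n { R with z := w } M :=
  mkState_setReg n R _ M _ _ (by simp [Regs.toList]) rfl
@[simp] theorem setReg_s0 : (mkState n R M).setReg 29 w = mkState n { R with s0 := w } M :=
  mkState_setReg n R _ M _ _ (by simp [Regs.toList]) rfl
@[simp] theorem setReg_dl : (mkState n R M).setReg 30 w = mkState n { R with dl := w } M :=
  mkState_setReg n R _ M _ _ (by simp [Regs.toList]) rfl
@[simp] theorem setReg_u : (mkState n R M).setReg 31 w = mkState n { R with u := w } M :=
  mkState_setReg n R _ M _ _ (by simp [Regs.toList]) rfl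
@[simp] theorem setReg_cu : (mkState n R M).setReg 32 w = mkState n { R with cu := w } M :=
  mkState_setReg n R _ M _ _ (by simp [Regs.toList]) rfl
@[simp] theorem setReg_v : (mkState n R M).setReg 33 w = mkState n { R with v := w } M :=
  mkState_setReg n R _ M _ _ (by simp [Regs.toList]) rfl
@[simp] theorem setReg_cv : (mkState n R M).setReg 34 w = mkState n { R with cv := w } M :=
  mkState_setReg n R _ M _ _ (by simp [Regs.toList]) rfl
@[simp] theorem setReg_c : (mkState n R M).setReg 35 w = mkState n { R with c := w } M :=
  mkState_setReg n R _ M _ _ (by simp [Regs.toList]) rfl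
@[simp] theorem setReg_cc : (mkState n R M).setReg 36 w = mkState n { R with cc := w } M :=
  mkState_setReg n R _ M _ _ (by simp [Regs.toList]) rfl
@[simp] theorem setReg_tm : (mkState n R M).setReg 37 w = mkState n { R with tm := w } M :=
  mkState_setReg n R _ M _ _ (by simp [Regs.toList]) rfl
@[simp] theorem setReg_bst : (mkState n R M).setReg 38 w = mkState n { R with bst := w } M :=
  mkState_setReg n R _ M _ _ (by simp [Regs.toList]) rfl

end RegisterLemmas

/-! ### Addresses of cells -/

theorem toNat_cellBase_add (n r i : ℕ) :
    (cellBase n r + (i : ℤ)).toNat = 3 * n + (r * (n + 1) + i) := by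
  rw [cellBase]
  have : (3 * (n : ℤ) + r * (n + 1) + i) = ((3 * n + (r * (n + 1) + i) : ℕ) : ℤ) := by
    push_cast; ring
  rw [this, Int.toNat_natCast]

theorem cellBase_add_lt (n r i : ℕ) (hr : r < n + 8) (hi : i ≤ n) :
    (cellBase n r + (i : ℤ)).toNat < memSize n := by
  rw [toNat_cellBase_add, memSize]
  have : (r + 1) * (n + 1) ≤ (n + 8) * (n + 1) := Nat.mul_le_mul_right _ hr
  linarith

theorem Mem.toFun_cellBase (n : ℕ) (M : Mem) {r i : ℕ} (hr : r < n + 8) (hi : i ≤ n) :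
    M.toFun n (cellBase n r + (i : ℤ)).toNat = M.row r i := by
  have h1 : (r * (n + 1) + i) / (n + 1) = r := by
    rw [mul_comm, Nat.mul_add_div (by omega), Nat.div_eq_of_lt (by omega), add_zero]
  have h2 : (r * (n + 1) + i) % (n + 1) = i := by
    rw [mul_comm, Nat.mul_add_mod, Nat.mod_eq_of_lt (by omega)]
  rw [toNat_cellBase_add, Mem.toFun, if_neg (by omega)]
  simp only [Nat.add_sub_cancel_left, h1, h2, hr, if_true]

/-- Quotient and remainder by `n + 1` recover row and column from an address, so a write to one cell
leaves all the others alone. -/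
theorem Mem.update_toFun (n : ℕ) (M M' : Mem) {r i : ℕ} (w : ℤ) (hr : r < n + 8) (hi : i ≤ n)
    (hinp : M'.inp = M.inp) (hrow : M'.row = Function.update M.row r (Function.update (M.row r) i w)) :
    Function.update (M.toFun n) (cellBase n r + (i : ℤ)).toNat w = M'.toFun n := by
  funext a
  rw [toNat_cellBase_add]
  by_cases ha : a = 3 * n + (r * (n + 1) + i)
  · subst ha
    rw [← toNat_cellBase_add, Mem.toFun_cellBase n M' hr hi, hrow]
    simp
  · rw [Function.update_of_ne ha, Mem.toFun, Mem.toFun, hinp, hrow]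
    by_cases h : a < 3 * n
    · simp [h]
    · simp only [h, if_false]
      by_cases hq : (a - 3 * n) / (n + 1) = r
      · have hi' : (a - 3 * n) % (n + 1) ≠ i := by
          intro hi'
          have := Nat.div_add_mod (a - 3 * n) (n + 1)
          rw [hq, hi', mul_comm] at this
          omega
        rw [hq, Function.update_self, Function.update_of_ne hi']
      · rw [Function.update_of_ne hq]

section MemoryLemmas

variable (n : ℕ) (R : Regs) (M : Mem) (w : ℤ) {i : ℕ}

@[simp] theorem mem_P (hi : i ≤ n) : (mkState n R M).mem (cellBase n 0 + (i : ℤ)).toNat = M.P i :=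
  Mem.toFun_cellBase n M (by omega) hi
@[simp] theorem mem_D (hi : i ≤ n) : (mkState n R M).mem (cellBase n 1 + (i : ℤ)).toNat = M.D i :=
  Mem.toFun_cellBase n M (by omega) hi
@[simp] theorem mem_I (hi : i ≤ n) : (mkState n R M).mem (cellBase n 2 + (i : ℤ)).toNat = M.I i :=
  Mem.toFun_cellBase n M (by omega) hi
@[simp] theorem mem_A (hi : i ≤ n) : (mkState n R M).mem (cellBase n 3 + (i : ℤ)).toNat = M.A i :=
  Mem.toFun_cellBase n M (by omega) hi
@[simp] theorem mem_L (hi : i ≤ n) : (mkState n R M).mem (cellBase n 4 + (i : ℤ)).toNat = M.L i :=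
  Mem.toFun_cellBase n M (by omega) hi
@[simp] theorem mem_B (hi : i ≤ n) : (mkState n R M).mem (cellBase n 5 + (i : ℤ)).toNat = M.B i :=
  Mem.toFun_cellBase n M (by omega) hi
@[simp] theorem mem_X (hi : i ≤ n) : (mkState n R M).mem (cellBase n 6 + (i : ℤ)).toNat = M.X i :=
  Mem.toFun_cellBase n M (by omega) hi
@[simp] theorem mem_X_zero : (mkState n R M).mem (cellBase n 6).toNat = M.X 0 := by
  simpa using mem_X n R M (Nat.zero_le n)
@[simp] theorem mem_T {u : ℕ} (hu : u ≤ n) (hi : i ≤ n) :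
    (mkState n R M).mem (cellBase n (u + 7) + (i : ℤ)).toNat = M.T u i :=
  Mem.toFun_cellBase n M (by omega) hi
@[simp] theorem mem_inp (hi : i < 3 * n) : (mkState n R M).mem i = M.inp i := by
  simp [mkState, Mem.toFun, hi]

theorem mkState_setMem {r : ℕ} (M' : Mem) (hr : r < n + 8) (hi : i ≤ n) (hinp : M'.inp = M.inp)
    (hrow : M'.row = Function.update M.row r (Function.update (M.row r) i w)) :
    (mkState n R M).setMem (cellBase n r + (i : ℤ)).toNat w = mkState n R M' := by
  simp only [mkState, RamState.setMem, Mem.update_toFun n M M' w hr hi hinp hrow]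

theorem Mem.row_update {M M' : Mem} {r : ℕ} (hr : M'.row r = Function.update (M.row r) i w)
    (h : ∀ q, q ≠ r → M'.row q = M.row q) :
    M'.row = Function.update M.row r (Function.update (M.row r) i w) := by
  funext q
  by_cases hq : q = r
  · subst hq
    rw [hr, Function.update_self]
  · rw [h q hq, Function.update_of_ne hq]

@[simp] theorem setMem_P (hi : i ≤ n) : (mkState n R M).setMem (cellBase n 0 + (i : ℤ)).toNat w =
    mkState n R { M with P := Function.update M.P i w } := by
  refine mkState_setMem n R M w _ (by omega) hi rfl (Mem.row_update w rfl fun q hq => ?_)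
  unfold Mem.row
  split <;> first | rfl | omega

@[simp] theorem setMem_D (hi : i ≤ n) : (mkState n R M).setMem (cellBase n 1 + (i : ℤ)).toNat w =
    mkState n R { M with D := Function.update M.D i w } := by
  refine mkState_setMem n R M w _ (by omega) hi rfl (Mem.row_update w rfl fun q hq => ?_)
  unfold Mem.row
  split <;> first | rfl | omega

@[simp] theorem setMem_I (hi : i ≤ n) : (mkState n R M).setMem (cellBase n 2 + (i : ℤ)).toNat w =
    mkState n R { M with I := Function.update M.I i w } := by
  refine mkState_setMem n R M w _ (by omega) hi rfl (Mem.row_update w rfl fun q hq => ?_)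
  unfold Mem.row
  split <;> first | rfl | omega

@[simp] theorem setMem_A (hi : i ≤ n) : (mkState n R M).setMem (cellBase n 3 + (i : ℤ)).toNat w =
    mkState n R { M with A := Function.update M.A i w } := by
  refine mkState_setMem n R M w _ (by omega) hi rfl (Mem.row_update w rfl fun q hq => ?_)
  unfold Mem.row
  split <;> first | rfl | omega

@[simp] theorem setMem_L (hi : i ≤ n) : (mkState n R M).setMem (cellBase n 4 + (i : ℤ)).toNat w =
    mkState n R { M with L := Function.update M.L i w } := by
  refine mkState_setMem n R M w _ (by omega) hi rfl (Mem.row_update w rfl fun q hq => ?_)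
  unfold Mem.row
  split <;> first | rfl | omega

@[simp] theorem setMem_B (hi : i ≤ n) : (mkState n R M).setMem (cellBase n 5 + (i : ℤ)).toNat w =
    mkState n R { M with B := Function.update M.B i w } := by
  refine mkState_setMem n R M w _ (by omega) hi rfl (Mem.row_update w rfl fun q hq => ?_)
  unfold Mem.row
  split <;> first | rfl | omega

@[simp] theorem setMem_X (hi : i ≤ n) : (mkState n R M).setMem (cellBase n 6 + (i : ℤ)).toNat w =
    mkState n R { M with X := Function.update M.X i w } := by
  refine mkState_setMem n R M w _ (by omega) hi rfl (Mem.row_update w rfl fun q hq => ?_)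
  unfold Mem.row
  split <;> first | rfl | omega

@[simp] theorem setMem_T {u : ℕ} (hu : u ≤ n) (hi : i ≤ n) :
    (mkState n R M).setMem (cellBase n (u + 7) + (i : ℤ)).toNat w =
      mkState n R { M with T := Function.update M.T u (Function.update (M.T u) i w) } := by
  refine mkState_setMem n R M w _ (by omega) hi rfl (Mem.row_update w ?_ fun q hq => ?_)
  · simp [Mem.row]
  · unfold Mem.row
    split <;> try rfl
    exact Function.update_of_ne (by omega) _ _

@[simp] theorem setMem_inp (hi : i < 3 * n) : (mkState n R M).setMem i w =
    mkState n R { M with inp := Function.update M.inp i w } := by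
  simp only [mkState, RamState.setMem, RamState.mk.injEq, true_and]
  funext a
  by_cases ha : a = i
  · subst ha
    simp [Mem.toFun, hi]
  · rw [Function.update_of_ne ha]
    simp only [Mem.toFun, Function.update_of_ne ha]
    rfl

end MemoryLemmas

/-! ### The program -/

namespace Tardiness

open RamProg

/-- A no-op wherever `r_zero` holds `0`, as it does in every `mkState`. -/
def skip : RamProg := .const r_zero 0

/-- Finds the first of the longest alive jobs from `b` on. -/
def scanBody : RamProg :=
  block [.plus r_y r_A r_i, .load r_y r_y,
    .cond r_y (block [.plus r_y r_P r_i, .load r_y r_y, .minus r_z r_y r_x,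
      .cond r_z (block [.plus r_x r_y r_zero, .plus r_l r_i r_zero]) skip]) skip,
    .plus r_i r_i r_one, .minus r_ci r_ci r_one, .const r_y 0, .const r_z 0]

def scan : RamProg :=
  .seq (block [.const r_x (-1), .const r_l 0, .plus r_i r_b r_zero, .minus r_ci r_n r_b])
    (.seq (.loop r_ci scanBody) (block [.const r_i 0, .plus r_y r_x r_one]))

/-- Pushes the job `l` and the bound `b` on the stack and removes `l`. -/
def push : RamProg :=
  block [.plus r_y r_L r_h, .store r_y r_l, .plus r_y r_B r_h, .store r_y r_b,
    .plus r_h r_h r_one, .plus r_y r_A r_l, .store r_y r_zero,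
    .const r_x 0, .const r_y 0, .const r_l 0]

def clearCell : RamProg :=
  block [.store r_v r_zero, .plus r_v r_v r_one, .minus r_cv r_cv r_one]

def clearLine : RamProg :=
  .seq (block [.plus r_y r_X r_u, .load r_y r_y, .plus r_v r_y r_zero, .plus r_cv r_w r_zero])
    (.seq (.loop r_cv clearCell)
      (block [.plus r_u r_u r_one, .minus r_cu r_cu r_one, .const r_v 0, .const r_y 0]))

/-- Clears the lines of the table from `b` on. -/
def clear : RamProg :=
  .seq (block [.plus r_u r_b r_zero, .minus r_cu r_w r_b])
    (.seq (.loop r_cu clearLine)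
      (block [.const r_u 0, .const r_m 0, .const r_x 0, .const r_y 0, .const r_l 0]))

/-- Restores the job `l` on top of the stack and goes on with the jobs after it. -/
def restore : RamProg :=
  block [.plus r_y r_A r_l, .store r_y r_one, .plus r_h r_h r_one, .plus r_b r_l r_one,
    .const r_m 1, .const r_y 0, .const r_l 0]

def prefixSumBody : RamProg :=
  block [.plus r_y r_A r_i, .load r_y r_y,
    .cond r_y (block [.plus r_y r_P r_i, .load r_y r_y, .plus r_s0 r_s0 r_y]) skip,
    .plus r_i r_i r_one, .minus r_ci r_ci r_one, .const r_y 0]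

/-- Evaluates the cut `c` for the entry `(u, v)` of the table. -/
def cutBody : RamProg :=
  block [.plus r_y r_X r_u, .load r_y r_y, .plus r_y r_y r_c, .load r_x r_y,
    .plus r_y r_X r_c, .load r_y r_y, .plus r_y r_y r_v, .load r_y r_y, .plus r_x r_x r_y,
    .minus r_y r_tm r_dl, .cond r_y (.plus r_x r_x r_y) skip,
    .minus r_y r_zero r_bst,
    .cond r_y (.plus r_bst r_x r_zero)
      (block [.minus r_y r_bst r_x, .cond r_y (.plus r_bst r_x r_zero) skip]),
    .plus r_y r_A r_c, .load r_y r_y,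
    .cond r_y (block [.plus r_y r_P r_c, .load r_y r_y, .plus r_tm r_tm r_y]) skip,
    .plus r_c r_c r_one, .minus r_cc r_cc r_one, .const r_x 0, .const r_y 0]

/-- The column is `l + cv` with `cv` counting down, so columns are treated from `n` to `l + 1`. This
order allows the line to be updated in place. The value `-1` in `r_bst` means that no cut has been
evaluated yet. -/
def entryBody : RamProg :=
  .seq (block [.plus r_v r_l r_cv, .plus r_cc r_cv r_zero, .plus r_c r_l r_one,
      .plus r_tm r_s0 r_zero, .const r_bst (-1)])
    (.seq (.loop r_cc cutBody)
      (block [.plus r_y r_X r_u, .load r_y r_y, .plus r_y r_y r_v, .store r_y r_bst,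
        .minus r_cv r_cv r_one, .const r_v 0, .const r_c 0, .const r_tm 0, .const r_bst 0,
        .const r_y 0]))

def lineBody : RamProg :=
  .seq (.minus r_cv r_n r_l)
    (.seq (.loop r_cv entryBody) (block [.plus r_u r_u r_one, .minus r_cu r_cu r_one]))

/-- Computes the lines `b, …, l` of the table. -/
def combine : RamProg :=
  .seq (block [.plus r_y r_B r_h, .load r_b r_y, .plus r_y r_D r_l, .load r_dl r_y, .const r_y 0,
      .plus r_s0 r_st r_zero, .plus r_ci r_l r_one])
    (.seq (.loop r_ci prefixSumBody)
      (.seq (block [.const r_i 0, .plus r_u r_b r_zero, .plus r_cu r_l r_one,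
          .minus r_cu r_cu r_b])
        (.seq (.loop r_cu lineBody)
          (block [.const r_u 0, .const r_s0 0, .const r_dl 0, .const r_l 0]))))

/-- The scan leaves in `r_y` the largest length plus one, which is positive exactly if there is an
alive job from `b` on: zero lengths count, and the sentinel is `-1`. -/
def descend : RamProg := .seq scan (.cond r_y push clear)

/-- The alive flag of the job on top of the stack serves as the return address. If the job is still
removed, its first subproblem has just been finished and the second one begins; if it is alive
again, both are finished and can be combined. -/
def ascend : RamProg :=
  .cond r_h
    (.seq (block [.minus r_h r_h r_one, .plus r_y r_L r_h, .load r_l r_y, .plus r_y r_A r_l,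
        .load r_y r_y])
      (.cond r_y combine restore))
    (.const r_go 0)

/-- Recursion by explicit stack: `r_m` is `1` when a subproblem is to be entered and `0` when one
has just been finished. -/
def solveBody : RamProg := .cond r_m descend ascend

/-- Fills the table for the alive jobs, started at time `st`. -/
def solve : RamProg :=
  .seq (block [.const r_b 0, .const r_h 0, .const r_m 1, .const r_go 1]) (.loop r_go solveBody)

def tryBegin : RamProg :=
  block [.plus r_y r_A r_j, .store r_y r_zero, .plus r_y r_P r_j, .load r_y r_y,
    .plus r_st r_start r_y, .const r_y 0]

def tryEnd : RamProg :=
  block [.plus r_y r_X r_zero, .load r_y r_y, .plus r_y r_y r_n, .load r_x r_y,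
    .plus r_y r_D r_j, .load r_y r_y, .minus r_y r_st r_y, .cond r_y (.plus r_x r_x r_y) skip,
    .minus r_y r_zero r_best,
    .cond r_y (block [.plus r_best r_x r_zero, .plus r_bj r_j r_zero])
      (block [.minus r_y r_best r_x,
        .cond r_y (block [.plus r_best r_x r_zero, .plus r_bj r_j r_zero]) skip]),
    .plus r_y r_A r_j, .store r_y r_one, .const r_x 0, .const r_y 0, .const r_st 0]

/-- Tries the job `j`, if it is alive, at the next position. -/
def tryBody : RamProg :=
  .seq (block [.plus r_y r_A r_j, .load r_y r_y])
    (.seq (.cond r_y (.seq tryBegin (.seq solve tryEnd)) skip)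
      (block [.plus r_j r_j r_one, .minus r_cj r_cj r_one, .const r_y 0]))

def positionEnd : RamProg :=
  block [.plus r_y r_A r_bj, .store r_y r_zero, .plus r_y r_P r_bj, .load r_y r_y,
    .plus r_start r_start r_y, .plus r_y r_I r_bj, .load r_y r_y, .store r_op r_y,
    .plus r_op r_op r_one, .minus r_pos r_pos r_one, .const r_y 0, .const r_j 0,
    .const r_best 0, .const r_bj 0]

/-- Determines the job in the next position. -/
def positionBody : RamProg :=
  .seq (block [.const r_best (-1), .const r_bj 0, .const r_j 0, .plus r_cj r_n r_zero])
    (.seq (.loop r_cj tryBody) positionEnd)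

def initConstants : RamProg :=
  block [.const r_one 1, .plus r_w r_n r_one, .plus r_P r_n r_n, .plus r_P r_P r_n,
    .plus r_D r_P r_w, .plus r_I r_D r_w, .plus r_A r_I r_w, .plus r_L r_A r_w,
    .plus r_B r_L r_w, .plus r_X r_B r_w]

/-- Since due dates are integers, adding `1` for `c < i` relaxes the strict comparison to a weak
one, so ties are broken by job number. -/
def rankBody : RamProg :=
  block [.plus r_y r_n r_c, .load r_y r_y, .minus r_y r_dl r_y, .minus r_z r_i r_c,
    .cond r_z (.plus r_y r_y r_one) skip, .cond r_y (.plus r_x r_x r_one) skip,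
    .plus r_c r_c r_one, .minus r_cc r_cc r_one, .const r_y 0, .const r_z 0]

/-- Computes the rank of job `i` in the due date order and copies the job there. -/
def placeBody : RamProg :=
  .seq (block [.plus r_y r_n r_i, .load r_dl r_y, .plus r_cc r_n r_zero, .const r_y 0])
    (.seq (.loop r_cc rankBody)
      (block [.load r_y r_i, .plus r_z r_P r_x, .store r_z r_y, .plus r_z r_D r_x,
        .store r_z r_dl, .plus r_z r_I r_x, .store r_z r_i, .plus r_z r_A r_i, .store r_z r_one,
        .plus r_i r_i r_one, .minus r_ci r_ci r_one, .const r_x 0, .const r_y 0, .const r_z 0,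
        .const r_c 0, .const r_dl 0]))

/-- The machine cannot multiply, so the addresses of the table lines are produced once by repeated
addition and stored. -/
def linePointerBody : RamProg :=
  block [.plus r_z r_X r_i, .store r_z r_y, .plus r_y r_y r_w, .plus r_i r_i r_one,
    .minus r_ci r_ci r_one, .const r_z 0]

def prepare : RamProg :=
  .seq (.plus r_ci r_n r_zero) (.seq (.loop r_ci placeBody)
    (.seq (block [.const r_i 0, .plus r_ci r_w r_zero, .plus r_y r_X r_w])
      (.seq (.loop r_ci linePointerBody)
        (block [.const r_i 0, .const r_y 0, .plus r_pos r_n r_zero, .plus r_op r_n r_n]))))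

/-- The program: it sorts the jobs by due date and then determines, position by position, a job
whose choice for this position is optimal. -/
def program : RamProg :=
  .seq initConstants (.seq prepare (.loop r_pos positionBody))

/-! ### The blocks without loops -/

/-- The indicator function of a set. -/
def ind (A : Finset ℕ) (i : ℕ) : ℤ := if i ∈ A then 1 else 0

theorem ind_mem {A : Finset ℕ} {i : ℕ} (h : i ∈ A) : ind A i = 1 := if_pos h

theorem ind_not_mem {A : Finset ℕ} {i : ℕ} (h : i ∉ A) : ind A i = 0 := if_neg h

theorem update_ind_zero (A : Finset ℕ) (i : ℕ) : Function.update (ind A) i 0 = ind (A.erase i) := by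
  funext j
  by_cases h : j = i
  · subst h; simp [ind]
  · simp [ind, h]

theorem update_ind_one (A : Finset ℕ) (i : ℕ) : Function.update (ind A) i 1 = ind (insert i A) := by
  funext j
  by_cases h : j = i
  · subst h; simp [ind]
  · simp [ind, h]

/-- The length and the index of the longest alive job among the first `j` jobs from `b` on. -/
def scanState (p : ℕ → ℤ) (A : Finset ℕ) (b : ℕ) : ℕ → ℤ × ℕ
  | 0 => (-1, 0)
  | j + 1 =>
    if b + j ∈ A ∧ (scanState p A b j).1 < p (b + j) then (p (b + j), b + j) else scanState p A b j

/-- The registers of the outer loops; all others are zero. -/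
def outer (R : Regs) : Regs where
  start := R.start
  pos := R.pos
  op := R.op
  j := R.j
  cj := R.cj
  best := R.best
  bj := R.bj
  st := R.st

set_option linter.unusedSimpArgs false

theorem localExec_scanBody (n : ℕ) (R : Regs) {M : Mem} {A : Finset ℕ} {i : ℕ} (k x l : ℤ)
    (hA : M.A = ind A) (hi : i ≤ n) :
    LocalExec (memSize n) scanBody
      (mkState n { R with i := i, ci := k, x := x, l := l, y := 0, z := 0 } M)
      (mkState n { R with i := i + 1, ci := k - 1, x := if i ∈ A ∧ x < M.P i then M.P i else x,
                          l := if i ∈ A ∧ x < M.P i then i else l, y := 0, z := 0 } M) 40 := by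
  refine LocalExec.mono (LocalExec.of_effect ?_ ?_) (show scanBody.nodes ≤ 40 by decide)
  · simp [scanBody, block, Straight, skip]
  · by_cases hm : i ∈ A
    · by_cases hx : x < M.P i <;>
      simp [scanBody, block, effect, skip, hi, hA, ind, hm, hx]
    · simp [scanBody, block, effect, skip, hi, hA, ind, hm]

theorem localExec_scan (n : ℕ) (R : Regs) {M : Mem} {A : Finset ℕ} {b : ℕ} (h m g : ℤ)
    (hA : M.A = ind A) (hb : b ≤ n) :
    LocalExec (memSize n) scan
      (mkState n { outer R with b := b, h := h, m := m, go := g } M)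
      (mkState n { outer R with
        b := b, h := h, m := m, go := g, x := (scanState M.P A b (n - b)).1,
        l := (scanState M.P A b (n - b)).2, y := (scanState M.P A b (n - b)).1 + 1 } M)
      (100 * (n + 1)) := by
  have hloop := LocalExec.loop (m := memSize n) (x := r_ci) (a := scanBody) (N := n - b) (T := 40)
    (fun j => mkState n { outer R with
      b := b, h := h, m := m, go := g, i := ((b + j : ℕ) : ℤ), ci := ((n - b : ℕ) : ℤ) - (j : ℕ),
      x := (scanState M.P A b j).1, l := (scanState M.P A b j).2 } M)
    (fun j hj => by simp; omega)
    (fun j hj => by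
      have := localExec_scanBody n { outer R with b := b, h := h, m := m, go := g } (i := b + j)
        (((n - b : ℕ) : ℤ) - (j : ℕ)) (scanState M.P A b j).1 (scanState M.P A b j).2 hA (by omega)
      refine this.congr rfl ?_
      by_cases hc : b + j ∈ A ∧ (scanState M.P A b j).1 < M.P (b + j) <;>
      simp [scanState, hc, outer, add_assoc, sub_sub])
    (by simp)
  refine ((LocalExec.of_effect ?_ ?_).seq (hloop.seq (LocalExec.of_effect ?_ ?_))).mono ?_
  · simp [block, Straight]
  · simp [block, effect, scanState, outer, hb, Nat.cast_sub]
  · simp [block, Straight]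
  · simp [block, effect, outer]
  · simp only [nodes, block]
    have : n - b ≤ n := Nat.sub_le _ _
    nlinarith

theorem localExec_push (n : ℕ) (R : Regs) {M : Mem} {A : Finset ℕ} {l h : ℕ} (b m g x y : ℤ)
    (hA : M.A = ind A) (hl : l ≤ n) (hh : h ≤ n) :
    LocalExec (memSize n) push
      (mkState n { outer R with b := b, h := h, m := m, go := g, x := x, l := l, y := y } M)
      (mkState n { outer R with b := b, h := h + 1, m := m, go := g }
        { M with A := ind (A.erase l), L := Function.update M.L h l, B := Function.update M.B h b })
      30 := by
  refine LocalExec.mono (LocalExec.of_effect ?_ ?_) (show push.nodes ≤ 30 by decide)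
  · simp [push, block, Straight, effect, hl, hh, cellBase_add_lt]
  · simp [push, block, effect, outer, hl, hh, hA, update_ind_zero]

theorem localExec_clearCell (n : ℕ) (R : Regs) {M : Mem} {u i : ℕ} (k : ℤ)
    (hu : u ≤ n) (hi : i ≤ n) :
    LocalExec (memSize n) clearCell
      (mkState n { R with v := cellBase n (u + 7) + i, cv := k } M)
      (mkState n { R with v := cellBase n (u + 7) + i + 1, cv := k - 1 }
        { M with T := Function.update M.T u (Function.update (M.T u) i 0) }) 10 := by
  refine LocalExec.mono (LocalExec.of_effect ?_ ?_) (show clearCell.nodes ≤ 10 by decide)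
  · simp [clearCell, block, Straight, effect, hu, hi, cellBase_add_lt]
  · simp [clearCell, block, effect, hu, hi]

theorem localExec_clearLine (n : ℕ) (R : Regs) {M : Mem} {u : ℕ} (b h m g x l k : ℤ)
    (hX : ∀ u ≤ n, M.X u = cellBase n (u + 7)) (hu : u ≤ n) :
    LocalExec (memSize n) clearLine
      (mkState n { outer R with b := b, h := h, m := m, go := g, x := x, l := l, u := u, cu := k } M)
      (mkState n { outer R with
        b := b, h := h, m := m, go := g, x := x, l := l, u := u + 1, cu := k - 1 }
        { M with T := Function.update M.T u (fun v => if v < n + 1 then 0 else M.T u v) })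
      (50 * (n + 1)) := by
  have hloop := LocalExec.loop (m := memSize n) (x := r_cv) (a := clearCell) (N := n + 1) (T := 10)
    (fun j => mkState n { outer R with
      b := b, h := h, m := m, go := g, x := x, l := l, u := u, cu := k, y := cellBase n (u + 7),
      v := cellBase n (u + 7) + (j : ℕ), cv := (n : ℤ) + 1 - (j : ℕ) }
      { M with T := Function.update M.T u (fun v => if v < j then 0 else M.T u v) })
    (fun j hj => by simp; omega)
    (fun j hj => by
      have := localExec_clearCell n { outer R with
        b := b, h := h, m := m, go := g, x := x, l := l, u := u, cu := k, y := cellBase n (u + 7) }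
        (M := { M with T := Function.update M.T u (fun v => if v < j then 0 else M.T u v) })
        (i := j) ((n : ℤ) + 1 - (j : ℕ)) hu (by omega)
      refine this.congr rfl ?_
      congr 1
      · simp [outer, add_assoc, sub_sub]
      · simp only [Function.update_self, Function.update_idem]
        congr 2
        funext v
        by_cases hv : v = j
        · simp [hv]
        · simp only [Function.update_of_ne hv]
          exact if_congr (by omega) rfl rfl)
    (by simp)
  refine ((LocalExec.of_effect ?_ ?_).seq (hloop.seq (LocalExec.of_effect ?_ ?_))).mono ?_
  · simp [block, Straight]
  · simp [block, effect, outer, hu, hX]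
  · simp [block, Straight]
  · simp [block, effect, outer]
  · simp only [nodes, block]
    nlinarith

theorem localExec_clear (n : ℕ) (R : Regs) {M : Mem} {b : ℕ} (h m g x l : ℤ)
    (hX : ∀ u ≤ n, M.X u = cellBase n (u + 7)) (hb : b ≤ n) :
    LocalExec (memSize n) clear
      (mkState n { outer R with b := b, h := h, m := m, go := g, x := x, l := l } M)
      (mkState n { outer R with b := b, h := h, go := g }
        { M with T := fun u v => if b ≤ u ∧ u ≤ n ∧ v ≤ n then 0 else M.T u v })
      (100 * (n + 1) ^ 2) := by
  have hloop := LocalExec.loop (m := memSize n) (x := r_cu) (a := clearLine) (N := n + 1 - b)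
    (T := 50 * (n + 1))
    (fun j => mkState n { outer R with
      b := b, h := h, m := m, go := g, x := x, l := l, u := ((b + j : ℕ) : ℤ),
      cu := (n : ℤ) + 1 - b - (j : ℕ) }
      { M with T := fun u v => if b ≤ u ∧ u < b + j ∧ v ≤ n then 0 else M.T u v })
    (fun j hj => by simp; omega)
    (fun j hj => by
      have := localExec_clearLine n R
        (M := { M with T := fun u v => if b ≤ u ∧ u < b + j ∧ v ≤ n then 0 else M.T u v })
        (u := b + j) b h m g x l ((n : ℤ) + 1 - b - (j : ℕ)) hX (by omega)
      refine this.congr rfl ?_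
      congr 1
      · simp [outer, add_assoc, sub_sub]
      · congr 1
        funext u v
        by_cases hu : u = b + j
        · subst hu
          simp only [Function.update_self]
          split_ifs <;> first | rfl | omega
        · simp only [Function.update_of_ne hu]
          exact if_congr (by omega) rfl rfl)
    (by simp; omega)
  refine ((LocalExec.of_effect ?_ ?_).seq (hloop.seq (LocalExec.of_effect ?_ ?_))).mono ?_
  · simp [block, Straight]
  · have h0 : (fun u v => if b ≤ u ∧ u < b ∧ v ≤ n then 0 else M.T u v) = M.T := by
      funext u v
      rw [if_neg (by omega)]
    simp [block, effect, outer, h0]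
  · simp [block, Straight]
  · simp only [block, effect, setReg_u, setReg_m, setReg_x, setReg_y, setReg_l, setReg_rZero]
    congr 1
    · simp [outer]
      omega
    congr 1
    funext u v
    exact if_congr (by omega) rfl rfl
  · simp only [nodes, block]
    have : n + 1 - b ≤ n + 1 := Nat.sub_le _ _
    nlinarith [Nat.mul_le_mul_right (50 * (n + 1) + 1) this]

theorem localExec_restore (n : ℕ) (R : Regs) {M : Mem} {A : Finset ℕ} {l : ℕ} (b h m g y : ℤ)
    (hA : M.A = ind A) (hl : l ≤ n) :
    LocalExec (memSize n) restore
      (mkState n { outer R with b := b, h := h, m := m, go := g, l := l, y := y } M)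
      (mkState n { outer R with b := l + 1, h := h + 1, m := 1, go := g }
        { M with A := ind (insert l A) })
      30 := by
  refine LocalExec.mono (LocalExec.of_effect ?_ ?_) (show restore.nodes ≤ 30 by decide)
  · simp [restore, block, Straight, effect, hl, cellBase_add_lt]
  · simp [restore, block, effect, outer, hl, hA, update_ind_one]

theorem localExec_prefixSumBody (n : ℕ) (R : Regs) {M : Mem} {A : Finset ℕ} {i : ℕ} (k s : ℤ)
    (hA : M.A = ind A) (hi : i ≤ n) :
    LocalExec (memSize n) prefixSumBody
      (mkState n { R with i := i, ci := k, s0 := s, y := 0 } M)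
      (mkState n { R with i := i + 1, ci := k - 1, s0 := s + if i ∈ A then M.P i else 0, y := 0 } M)
      40 := by
  refine LocalExec.mono (LocalExec.of_effect ?_ ?_) (show prefixSumBody.nodes ≤ 40 by decide)
  · simp [prefixSumBody, block, Straight, skip]
  · by_cases hm : i ∈ A <;> simp [prefixSumBody, block, effect, skip, hi, hA, ind, hm]

/-- The total processing time of the jobs of `A` before `c`. -/
def prefixSum (p : ℕ → ℤ) (A : Finset ℕ) (c : ℕ) : ℤ := ∑ i ∈ A.filter (· < c), p i

theorem prefixSum_zero (p : ℕ → ℤ) (A : Finset ℕ) : prefixSum p A 0 = 0 := by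
  simp [prefixSum]

theorem prefixSum_succ (p : ℕ → ℤ) (A : Finset ℕ) (c : ℕ) :
    prefixSum p A (c + 1) = prefixSum p A c + if c ∈ A then p c else 0 := by
  have h : ∀ c, prefixSum p A c = ∑ i ∈ Finset.range c, if i ∈ A then p i else 0 := by
    intro c
    rw [prefixSum, ← Finset.sum_filter]
    refine Finset.sum_congr ?_ fun _ _ => rfl
    ext i
    simp [and_comm]
  rw [h, h, Finset.sum_range_succ]

theorem localExec_cutBody (n : ℕ) (R : Regs) {M : Mem} {A : Finset ℕ} {u v c : ℕ} (k t w d : ℤ)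
    (hA : M.A = ind A) (hX : ∀ u ≤ n, M.X u = cellBase n (u + 7))
    (hu : u ≤ n) (hv : v ≤ n) (hc : c ≤ n) :
    LocalExec (memSize n) cutBody
      (mkState n { R with u := u, v := v, c := c, cc := k, dl := d, tm := t, bst := w,
                          x := 0, y := 0 } M)
      (mkState n { R with u := u, v := v, c := c + 1, cc := k - 1, dl := d,
                          tm := t + if c ∈ A then M.P c else 0,
                          bst := if w < 0 ∨ M.T u c + M.T c v + max (t - d) 0 < w then
                            M.T u c + M.T c v + max (t - d) 0 else w, x := 0, y := 0 } M)
      80 := by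
  refine LocalExec.mono (LocalExec.of_effect ?_ ?_) (show cutBody.nodes ≤ 80 by decide)
  · simp [cutBody, block, Straight, skip]
  · by_cases hd : d < t
    · rw [max_eq_left (by linarith : 0 ≤ t - d)]
      by_cases hw : w < 0
      · by_cases hm : c ∈ A <;>
        simp [cutBody, block, effect, skip, hu, hv, hc, hX, hA, ind, hd, hw, hm]
      · by_cases hw' : M.T u c + M.T c v + (t - d) < w <;> by_cases hm : c ∈ A <;>
        simp [cutBody, block, effect, skip, hu, hv, hc, hX, hA, ind, hd, hw, hw', hm]
    · rw [max_eq_right (by linarith : t - d ≤ 0)]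
      by_cases hw : w < 0
      · by_cases hm : c ∈ A <;>
        simp [cutBody, block, effect, skip, hu, hv, hc, hX, hA, ind, hd, hw, hm]
      · by_cases hw' : M.T u c + M.T c v < w <;> by_cases hm : c ∈ A <;>
        simp [cutBody, block, effect, skip, hu, hv, hc, hX, hA, ind, hd, hw, hw', hm]

/-- The minimum of the first `k` values of a nonnegative function, `-1` for `k = 0`. -/
def minUpTo (g : ℕ → ℤ) : ℕ → ℤ
  | 0 => -1
  | k + 1 => if minUpTo g k < 0 ∨ g k < minUpTo g k then g k else minUpTo g k

theorem minUpTo_congr {g g' : ℕ → ℤ} {k : ℕ} (h : ∀ i < k, g i = g' i) :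
    minUpTo g k = minUpTo g' k := by
  induction k with
  | zero => rfl
  | succ k ih =>
    simp only [minUpTo, h k (by omega), ih fun i hi => h i (by omega)]

/-- Nonnegativity is what separates genuine minima from the sentinel `-1`. -/
theorem minUpTo_spec {g : ℕ → ℤ} (hg : ∀ i, 0 ≤ g i) (k : ℕ) :
    (∃ i ≤ k, minUpTo g (k + 1) = g i) ∧ ∀ i ≤ k, minUpTo g (k + 1) ≤ g i := by
  induction k with
  | zero => simp [minUpTo]
  | succ k ih =>
    obtain ⟨⟨i, hi, h1⟩, h2⟩ := ih
    have h0 : 0 ≤ minUpTo g (k + 1) := h1 ▸ hg i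
    rw [minUpTo]
    by_cases h : g (k + 1) < minUpTo g (k + 1)
    · rw [if_pos (Or.inr h)]
      refine ⟨⟨k + 1, le_rfl, rfl⟩, fun j hj => ?_⟩
      rcases Nat.le_succ_iff.1 hj with hj | rfl
      · exact h.le.trans (h2 j hj)
      · exact le_rfl
    · rw [if_neg (by omega)]
      refine ⟨⟨i, by omega, h1⟩, fun j hj => ?_⟩
      rcases Nat.le_succ_iff.1 hj with hj | rfl
      · exact h2 j hj
      · exact not_lt.1 h

/-- The cost of the entry `(u, v)` of the table when the longest job `l` is processed directly
before the jobs from `l + 1 + k` on. -/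
def cutCost (M : Mem) (A : Finset ℕ) (st : ℤ) (l u v k : ℕ) : ℤ :=
  M.T u (l + 1 + k) + M.T (l + 1 + k) v + max (st + prefixSum M.P A (l + 1 + k) - M.D l) 0

/-- The entry `(u, v)` of the table, computed from the entries without the longest job `l`. -/
def newEntry (M : Mem) (A : Finset ℕ) (st : ℤ) (l u v : ℕ) : ℤ :=
  minUpTo (cutCost M A st l u v) (v - l)

theorem localExec_entryBody (n : ℕ) (R : Regs) {M : Mem} {A : Finset ℕ} {u l k : ℕ}
    (b h g : ℤ) (cu : ℤ) (hA : M.A = ind A) (hX : ∀ u ≤ n, M.X u = cellBase n (u + 7))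
    (hu : u ≤ n) (hv : l + k ≤ n) :
    LocalExec (memSize n) entryBody
      (mkState n { outer R with
        b := b, h := h, go := g, l := l, s0 := R.st + prefixSum M.P A (l + 1),
        dl := M.D l, u := u, cu := cu, cv := k } M)
      (mkState n { outer R with
        b := b, h := h, go := g, l := l, s0 := R.st + prefixSum M.P A (l + 1),
        dl := M.D l, u := u, cu := cu, cv := k - 1 }
        { M with
          T := Function.update M.T u
            (Function.update (M.T u) (l + k) (newEntry M A R.st l u (l + k))) })
      (200 * (n + 1)) := by
  have hloop := LocalExec.loop (m := memSize n) (x := r_cc) (a := cutBody) (N := k) (T := 80)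
    (fun j => mkState n { outer R with
      b := b, h := h, go := g, l := l, s0 := R.st + prefixSum M.P A (l + 1), dl := M.D l, u := u,
      cu := cu, cv := k, v := ((l + k : ℕ) : ℤ), c := ((l + 1 + j : ℕ) : ℤ), cc := (k : ℤ) - (j : ℕ),
      tm := R.st + prefixSum M.P A (l + 1 + j),
      bst := minUpTo (cutCost M A R.st l u (l + k)) j } M)
    (fun j hj => by simp; omega)
    (fun j hj => by
      refine (localExec_cutBody n { outer R with
        b := b, h := h, go := g, l := l, s0 := R.st + prefixSum M.P A (l + 1), cu := cu, cv := k }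
        (u := u) (v := l + k) (c := l + 1 + j) ((k : ℤ) - (j : ℕ))
        (R.st + prefixSum M.P A (l + 1 + j)) (minUpTo (cutCost M A R.st l u (l + k)) j) (M.D l)
        hA hX hu hv (by omega)).congr rfl ?_
      congr 1
      simp only [minUpTo, cutCost, Regs.mk.injEq, true_and, and_true]
      rw [← add_assoc (l + 1) j 1, prefixSum_succ]
      simp [outer, add_assoc, sub_sub])
    (by simp)
  refine ((LocalExec.of_effect ?_ ?_).seq (hloop.seq (LocalExec.of_effect ?_ ?_))).mono ?_
  · simp [block, Straight]
  · simp [block, effect, outer, minUpTo]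
  · have hlt := cellBase_add_lt n (u + 7) (l + k) (by omega) hv
    simp only [Nat.cast_add] at hlt
    simpa [block, Straight, effect, outer, hu, hX] using hlt
  · have hset := fun R M w => setMem_T n R M w hu hv
    simp only [Nat.cast_add] at hset
    simp [block, effect, outer, hu, hX, hset, newEntry]
  · have : k ≤ n := by omega
    have h1 := Nat.mul_le_mul_right (80 + 1) this
    simp only [nodes, block]
    omega

theorem localExec_lineBody (n : ℕ) (R : Regs) {M : Mem} {A : Finset ℕ} {u l : ℕ}
    (b h g : ℤ) (cu : ℤ) (hA : M.A = ind A) (hX : ∀ u ≤ n, M.X u = cellBase n (u + 7))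
    (hul : u ≤ l) (hl : l < n) :
    LocalExec (memSize n) lineBody
      (mkState n { outer R with
        b := b, h := h, go := g, l := l, s0 := R.st + prefixSum M.P A (l + 1),
        dl := M.D l, u := u, cu := cu } M)
      (mkState n { outer R with
        b := b, h := h, go := g, l := l, s0 := R.st + prefixSum M.P A (l + 1),
        dl := M.D l, u := u + 1, cu := cu - 1 }
        { M with
          T := Function.update M.T u
            (fun v => if l < v ∧ v ≤ n then newEntry M A R.st l u v else M.T u v) })
      (300 * (n + 1) ^ 2) := by
  have hloop := LocalExec.loop (m := memSize n) (x := r_cv) (a := entryBody) (N := n - l)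
    (T := 200 * (n + 1))
    (fun j => mkState n { outer R with
      b := b, h := h, go := g, l := l, s0 := R.st + prefixSum M.P A (l + 1), dl := M.D l, u := u,
      cu := cu, cv := ((n - l : ℕ) : ℤ) - (j : ℕ) }
      { M with
        T := Function.update M.T u
          (fun v => if n - j < v ∧ v ≤ n then newEntry M A R.st l u v else M.T u v) })
    (fun j hj => by simp; omega)
    (fun j hj => by
      have hk : ((n - l : ℕ) : ℤ) - (j : ℕ) = ((n - l - j : ℕ) : ℤ) := by omega
      have hk' : ((n - l : ℕ) : ℤ) - ((j + 1 : ℕ) : ℤ) = ((n - l - j : ℕ) : ℤ) - 1 := by omega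
      rw [hk, hk']
      refine (localExec_entryBody n R
        (M := { M with
          T := Function.update M.T u
            (fun v => if n - j < v ∧ v ≤ n then newEntry M A R.st l u v else M.T u v) })
        (k := n - l - j) (l := l) b h g cu hA hX (by omega) (by omega)).congr rfl ?_
      congr 2
      simp only [Function.update_self, Function.update_idem]
      congr 1
      funext v
      by_cases hv : v = l + (n - l - j)
      · subst hv
        rw [Function.update_self, if_pos (by omega)]
        -- Columns are processed downwards, so the entries of line `u` read here, in columns up to
        -- the current one, are still the old ones; the other entries read lie in lines beyond `l`,
        -- hence not in line `u`.
        refine minUpTo_congr fun i hi => ?_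
        simp only [cutCost, Function.update_self]
        rw [if_neg (by omega), Function.update_of_ne (by omega)]
      · rw [Function.update_of_ne hv]
        exact if_congr (by omega) rfl rfl)
    (by simp)
  refine ((LocalExec.of_effect (s' := mkState n { outer R with
      b := b, h := h, go := g, l := l, s0 := R.st + prefixSum M.P A (l + 1), dl := M.D l, u := u,
      cu := cu, cv := ((n - l : ℕ) : ℤ) - ((0 : ℕ) : ℤ) } M) ?_ ?_).seq
    ((hloop.congr ?_ rfl).seq (LocalExec.of_effect ?_ ?_))).mono ?_
  · simp [Straight]
  · simp [effect, outer, hl.le]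
  · congr 2
    rw [Function.update_eq_self_iff]
    funext v
    rw [if_neg (by omega)]
  · simp [block, Straight]
  · simp only [block, effect, setReg_u, setReg_cu, setReg_rZero]
    congr 1
    · simp [outer]
    · congr 2
      funext v
      exact if_congr (by omega) rfl rfl
  · simp only [nodes, block]
    have : n - l ≤ n := Nat.sub_le _ _
    have h1 := Nat.mul_le_mul_right (200 * (n + 1) + 1) this
    have h2 : 300 * (n + 1) ^ 2 = n * (200 * (n + 1) + 1) + (100 * n ^ 2 + 399 * n + 300) := by ring
    omega

theorem localExec_combine (n : ℕ) (R : Regs) {M : Mem} {A : Finset ℕ} {b l h : ℕ}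
    (b' g y : ℤ) (hA : M.A = ind A) (hX : ∀ u ≤ n, M.X u = cellBase n (u + 7))
    (hB : M.B h = b) (hh : h ≤ n) (hbl : b ≤ l) (hl : l < n) :
    LocalExec (memSize n) combine
      (mkState n { outer R with b := b', h := h, go := g, l := l, y := y } M)
      (mkState n { outer R with b := b, h := h, go := g }
        { M with T := fun u v => if b ≤ u ∧ u ≤ l ∧ l < v ∧ v ≤ n then newEntry M A R.st l u v
                                 else M.T u v })
      (500 * (n + 1) ^ 3) := by
  have hsum := LocalExec.loop (m := memSize n) (x := r_ci) (a := prefixSumBody) (N := l + 1)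
    (T := 40)
    (fun j => mkState n { outer R with
      b := b, h := h, go := g, l := l, s0 := R.st + prefixSum M.P A j, dl := M.D l,
      i := (j : ℕ), ci := (l : ℤ) + 1 - (j : ℕ) } M)
    (fun j hj => by simp; omega)
    (fun j hj => by
      refine (localExec_prefixSumBody n { outer R with b := b, h := h, go := g, l := l, dl := M.D l }
        (i := j) ((l : ℤ) + 1 - (j : ℕ)) (R.st + prefixSum M.P A j) hA (by omega)).congr rfl ?_
      congr 1
      rw [prefixSum_succ]
      simp [outer, add_assoc, sub_sub])
    (by simp)
  have hloop := LocalExec.loop (m := memSize n) (x := r_cu) (a := lineBody) (N := l + 1 - b)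
    (T := 300 * (n + 1) ^ 2)
    (fun j => mkState n { outer R with
      b := b, h := h, go := g, l := l, s0 := R.st + prefixSum M.P A (l + 1), dl := M.D l,
      u := ((b + j : ℕ) : ℤ), cu := (l : ℤ) + 1 - b - (j : ℕ) }
      { M with T := fun u v => if b ≤ u ∧ u < b + j ∧ l < v ∧ v ≤ n then newEntry M A R.st l u v
                               else M.T u v })
    (fun j hj => by simp; omega)
    (fun j hj => by
      refine (localExec_lineBody n R
        (M := { M with
          T := fun u v => if b ≤ u ∧ u < b + j ∧ l < v ∧ v ≤ n then newEntry M A R.st l u v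
                          else M.T u v })
        (u := b + j) (l := l) b h g ((l : ℤ) + 1 - b - (j : ℕ)) hA hX (by omega) hl).congr rfl ?_
      congr 1
      · simp [outer, add_assoc, sub_sub]
      · congr 1
        funext u v
        by_cases hu : u = b + j
        · subst hu
          rw [Function.update_self]
          by_cases hv : l < v ∧ v ≤ n
          · rw [if_pos hv, if_pos (by omega)]
            -- The lines already renewed lie below `b + j` and are at most `l`, while the cuts read
            -- only line `b + j` itself and lines beyond `l`.
            refine minUpTo_congr fun i hi => ?_
            simp only [cutCost]
            rw [if_neg (by omega), if_neg (by omega)]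
          · rw [if_neg hv, if_neg (by omega)]
            exact if_neg (by omega)
        · rw [Function.update_of_ne hu]
          exact if_congr (by omega) rfl rfl)
    (by simp; omega)
  refine ((LocalExec.of_effect ?_ ?_).seq (hsum.seq
    ((LocalExec.of_effect (s' := mkState n { outer R with
      b := b, h := h, go := g, l := l, s0 := R.st + prefixSum M.P A (l + 1), dl := M.D l,
      u := ((b + 0 : ℕ) : ℤ), cu := (l : ℤ) + 1 - b - ((0 : ℕ) : ℤ) } M) ?_ ?_).seq
    ((hloop.congr ?_ rfl).seq (LocalExec.of_effect ?_ ?_))))).mono ?_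
  · simp [block, Straight]
  · simp [block, effect, outer, hh, hB, hl.le, prefixSum_zero]
  · simp [block, Straight]
  · simp [block, effect, outer]
  · congr 2
    funext u v
    rw [if_neg (by omega)]
  · simp [block, Straight]
  · simp only [block, effect, setReg_u, setReg_s0, setReg_dl, setReg_l, setReg_rZero]
    congr 1
    · simp [outer]
      omega
    · congr 1
      funext u v
      exact if_congr (by omega) rfl rfl
  · simp only [nodes, block]
    have h1 : l + 1 - b ≤ n + 1 := by omega
    have h2 : l + 1 ≤ n + 1 := by omega
    have h3 := Nat.mul_le_mul_right (300 * (n + 1) ^ 2 + 1) h1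
    have h4 := Nat.mul_le_mul_right (40 + 1) h2
    have h5 : n + 1 ≤ (n + 1) ^ 3 := Nat.le_self_pow (by norm_num) _
    have h6 : 1 ≤ (n + 1) ^ 3 := Nat.one_le_pow _ _ (by omega)
    have h7 : (n + 1) * (300 * (n + 1) ^ 2 + 1) = 300 * (n + 1) ^ 3 + (n + 1) := by ring
    omega

/-! ### The rounds of the main loop -/

/-- The strict comparison in the scan selects the first among the longest jobs. Lawler's
decomposition only needs a longest one; that earlier jobs are strictly shorter is used for the lower
bound on the running time. -/
theorem scanState_spec (p : ℕ → ℤ) (hp : ∀ i, 0 ≤ p i) (A : Finset ℕ) (b j : ℕ) :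
    ((∀ i ∈ A, b ≤ i → ¬ i < b + j) ∧ scanState p A b j = (-1, 0)) ∨
    ∃ l ∈ A, b ≤ l ∧ l < b + j ∧ scanState p A b j = (p l, l) ∧
      (∀ i ∈ A, b ≤ i → i < b + j → p i ≤ p l) ∧ ∀ i ∈ A, b ≤ i → i < l → p i < p l := by
  induction j with
  | zero => exact Or.inl ⟨fun i _ _ => by omega, rfl⟩
  | succ j ih =>
    rw [scanState]
    have hcases : ∀ i, i < b + (j + 1) → i < b + j ∨ i = b + j := fun i hi => by omega
    rcases ih with ⟨h1, h2⟩ | ⟨l, hl, hbl, hlj, h2, h3, h4⟩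
    · rw [h2]
      by_cases hA : b + j ∈ A
      · have := hp (b + j)
        rw [if_pos ⟨hA, by simp only; omega⟩]
        refine Or.inr ⟨b + j, hA, by omega, by omega, rfl, fun i hi hbi hij => ?_,
          fun i hi hbi hij => absurd hij (h1 i hi hbi)⟩
        rcases hcases i hij with h | rfl
        · exact absurd h (h1 i hi hbi)
        · exact le_rfl
      · rw [if_neg fun h => hA h.1]
        refine Or.inl ⟨fun i hi hbi hij => ?_, rfl⟩
        rcases hcases i hij with h | rfl
        · exact h1 i hi hbi h
        · exact hA hi
    · rw [h2]
      refine Or.inr ?_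
      by_cases hA : b + j ∈ A ∧ p l < p (b + j)
      · rw [if_pos hA]
        refine ⟨b + j, hA.1, by omega, by omega, rfl, fun i hi hbi hij => ?_,
          fun i hi hbi hij => lt_of_le_of_lt (h3 i hi hbi hij) hA.2⟩
        rcases hcases i hij with h | rfl
        · exact (h3 i hi hbi h).trans hA.2.le
        · exact le_rfl
      · rw [if_neg hA]
        refine ⟨l, hl, hbl, by omega, rfl, fun i hi hbi hij => ?_, h4⟩
        rcases hcases i hij with h | rfl
        · exact h3 i hi hbi h
        · exact not_lt.1 fun h => hA ⟨hi, h⟩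

/-- A bound for the number of steps of one round. -/
def roundTime (n : ℕ) : ℕ := 1000 * (n + 1) ^ 3

/-- A common currency for the various polynomial costs: each kind of round is compared with a single
bound. -/
theorem le_roundTime {n a b c d : ℕ} (h : a + b + c + d ≤ 1000) :
    a + b * (n + 1) + c * (n + 1) ^ 2 + d * (n + 1) ^ 3 ≤ roundTime n := by
  have h1 : 1 ≤ (n + 1) ^ 3 := Nat.one_le_pow _ _ (by omega)
  have h2 : n + 1 ≤ (n + 1) ^ 3 := Nat.le_self_pow (by norm_num) _
  have h3 : (n + 1) ^ 2 ≤ (n + 1) ^ 3 := Nat.pow_le_pow_right (by omega) (by norm_num)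
  rw [roundTime]
  have h4 := Nat.mul_le_mul_left a h1
  have h5 := Nat.mul_le_mul_left b h2
  have h6 := Nat.mul_le_mul_left c h3
  have h7 := Nat.mul_le_mul_right ((n + 1) ^ 3) h
  simp only [add_mul, mul_one] at h4 h7
  omega

section Rounds

variable (n : ℕ) (R : Regs) {M : Mem} {A : Finset ℕ} {b l h : ℕ} (g : ℤ)

theorem localExec_round_push (hA : M.A = ind A) (hb : b ≤ n) (hl : l ≤ n) (hh : h ≤ n)
    (hp : 0 ≤ M.P l) (hscan : scanState M.P A b (n - b) = (M.P l, l)) :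
    LocalExec (memSize n) solveBody
      (mkState n { outer R with b := b, h := h, m := 1, go := g } M)
      (mkState n { outer R with b := b, h := (h + 1 : ℕ), m := 1, go := g }
        { M with A := ind (A.erase l), L := Function.update M.L h l, B := Function.update M.B h b })
      (roundTime n) := by
  have h1 := localExec_scan n R (M := M) h 1 g hA hb
  rw [hscan] at h1
  have h2 := localExec_push n R b 1 g (M.P l) (M.P l + 1) hA hl hh
  have h3 := (h1.seq (LocalExec.cond_pos (b := clear) (x := r_y) (by simp; omega) h2)).cond_pos
    (b := ascend) (x := r_m) (by simp)
  push_cast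
  refine h3.mono ?_
  have := le_roundTime (n := n) (a := 40) (b := 100) (c := 0) (d := 0) (by norm_num)
  omega

theorem localExec_round_clear (hA : M.A = ind A) (hX : ∀ u ≤ n, M.X u = cellBase n (u + 7))
    (hb : b ≤ n) (hscan : scanState M.P A b (n - b) = (-1, 0)) :
    LocalExec (memSize n) solveBody
      (mkState n { outer R with b := b, h := h, m := 1, go := g } M)
      (mkState n { outer R with b := b, h := h, go := g }
        { M with T := fun u v => if b ≤ u ∧ u ≤ n ∧ v ≤ n then 0 else M.T u v })
      (roundTime n) := by
  have h1 := localExec_scan n R (M := M) h 1 g hA hb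
  rw [hscan] at h1
  have h2 := localExec_clear n R (M := M) (b := b) h 1 g (-1) (0 : ℕ) hX hb
  have h3 := (h1.seq (LocalExec.cond_neg (a := push) (x := r_y) (by simp) h2)).cond_pos
    (b := ascend) (x := r_m) (by simp)
  refine h3.mono ?_
  have := le_roundTime (n := n) (a := 40) (b := 100) (c := 100) (d := 0) (by norm_num)
  omega

theorem localExec_ascend_pop (g' : ℤ) (hL : M.L h = l) (hl : l ≤ n) (hh : h ≤ n) (b : ℤ) :
    LocalExec (memSize n)
      (block [.minus r_h r_h r_one, .plus r_y r_L r_h, .load r_l r_y, .plus r_y r_A r_l,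
        .load r_y r_y])
      (mkState n { outer R with b := b, h := (h + 1 : ℕ), go := g' } M)
      (mkState n { outer R with b := b, h := h, go := g', l := l, y := M.A l } M) 20 := by
  refine LocalExec.mono (LocalExec.of_effect ?_ ?_) (show _ ≤ 20 by decide)
  · simp [block, Straight]
  · simp [block, effect, outer, hL, hl, hh]

theorem localExec_round_restore (hA : M.A = ind A) (hlA : l ∉ A) (hL : M.L h = l) (hl : l ≤ n)
    (hh : h ≤ n) (b : ℤ) :
    LocalExec (memSize n) solveBody
      (mkState n { outer R with b := b, h := (h + 1 : ℕ), go := g } M)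
      (mkState n { outer R with b := (l + 1 : ℕ), h := (h + 1 : ℕ), m := 1, go := g }
        { M with A := ind (insert l A) })
      (roundTime n) := by
  have h1 := localExec_ascend_pop n R g hL hl hh b
  rw [hA, ind_not_mem hlA] at h1
  have h2 := localExec_restore n R b h 0 g 0 hA hl
  have h3 := ((h1.seq (LocalExec.cond_neg (a := combine) (x := r_y) (by simp) h2)).cond_pos
    (b := .const r_go 0) (x := r_h) (by simp only [reg_h]; omega)).cond_neg (a := descend) (x := r_m)
    (by simp [outer])
  push_cast
  refine h3.mono ?_
  have := le_roundTime (n := n) (a := 60) (b := 0) (c := 0) (d := 0) (by norm_num)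
  omega

theorem localExec_round_combine (hA : M.A = ind A) (hX : ∀ u ≤ n, M.X u = cellBase n (u + 7))
    (hlA : l ∈ A) (hL : M.L h = l) (hB : M.B h = b) (hl : l < n) (hbl : b ≤ l) (hh : h ≤ n)
    (b' : ℤ) :
    LocalExec (memSize n) solveBody
      (mkState n { outer R with b := b', h := (h + 1 : ℕ), go := g } M)
      (mkState n { outer R with b := b, h := h, go := g }
        { M with T := fun u v => if b ≤ u ∧ u ≤ l ∧ l < v ∧ v ≤ n then newEntry M A R.st l u v
                                 else M.T u v })
      (roundTime n) := by
  have h1 := localExec_ascend_pop n R g hL hl.le hh b'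
  rw [hA, ind_mem hlA] at h1
  have h2 := localExec_combine n R b' g 1 hA hX hB hh hbl hl
  have h3 := ((h1.seq (LocalExec.cond_pos (b := restore) (x := r_y) (by simp) h2)).cond_pos
    (b := .const r_go 0) (x := r_h) (by simp only [reg_h]; omega)).cond_neg (a := descend) (x := r_m)
    (by simp [outer])
  refine h3.mono ?_
  have := le_roundTime (n := n) (a := 60) (b := 0) (c := 0) (d := 500) (by norm_num)
  omega

theorem localExec_round_stop (b : ℤ) :
    LocalExec (memSize n) solveBody (mkState n { outer R with b := b, go := g } M)
      (mkState n { outer R with b := b } M) (roundTime n) := by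
  have h1 : LocalExec (memSize n) (.const r_go 0) (mkState n { outer R with b := b, go := g } M)
      (mkState n { outer R with b := b } M) 1 :=
    LocalExec.of_effect (by simp [Straight]) (by simp [effect, outer])
  have h2 := (h1.cond_neg (a := .seq (block [.minus r_h r_h r_one, .plus r_y r_L r_h,
    .load r_l r_y, .plus r_y r_A r_l, .load r_y r_y]) (.cond r_y combine restore)) (x := r_h)
    (by simp [outer])).cond_neg (a := descend) (x := r_m)
    (by simp [outer])
  refine h2.mono ?_
  have := le_roundTime (n := n) (a := 60) (b := 0) (c := 0) (d := 0) (by norm_num)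
  omega

end Rounds

/-! ### Correctness of the table -/

/-- The jobs of `A` from `u` on and before `v`. -/
def seg (A : Finset ℕ) (u v : ℕ) : Finset ℕ := A.filter fun i => u ≤ i ∧ i < v

theorem mem_seg {A : Finset ℕ} {u v i : ℕ} : i ∈ seg A u v ↔ i ∈ A ∧ u ≤ i ∧ i < v :=
  Finset.mem_filter

/-- The optimal cost of the jobs of `A` in `[u, v)`, when all earlier jobs of `A` precede them. -/
noncomputable def segCost (p d : ℕ → ℤ) (st : ℤ) (A : Finset ℕ) (u v : ℕ) : ℤ :=
  optCost p d (st + prefixSum p A u) (seg A u v)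

theorem prefixSum_add_sum_seg (p : ℕ → ℤ) (A : Finset ℕ) {u c : ℕ} (h : u ≤ c) :
    prefixSum p A u + ∑ i ∈ seg A u c, p i = prefixSum p A c := by
  rw [prefixSum, prefixSum, ← Finset.sum_union]
  · refine Finset.sum_congr ?_ fun _ _ => rfl
    ext i
    simp only [Finset.mem_union, Finset.mem_filter, mem_seg, ← and_or_left]
    exact and_congr_right fun _ => by omega
  · rw [Finset.disjoint_left]
    intro i hi hi'
    rw [mem_seg] at hi'
    have := (Finset.mem_filter.1 hi).2
    omega

theorem prefixSum_erase (p : ℕ → ℤ) (A : Finset ℕ) {l u : ℕ} (h : u ≤ l) :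
    prefixSum p (A.erase l) u = prefixSum p A u := by
  refine Finset.sum_congr ?_ fun _ _ => rfl
  ext i
  simp only [Finset.mem_filter, Finset.mem_erase]
  exact ⟨fun h => ⟨h.1.2, h.2⟩, fun h => ⟨⟨by omega, h.1⟩, h.2⟩⟩

theorem seg_erase (A : Finset ℕ) (l u v : ℕ) : seg (A.erase l) u v = (seg A u v).erase l := by
  ext i
  simp only [mem_seg, Finset.mem_erase]
  tauto

/-- A segment ending by `l` does not contain `l`, and its start time does not depend on `l` either.
Hence such entries, computed while `l` was removed, stay valid when `l` returns. -/
theorem segCost_erase (p d : ℕ → ℤ) (st : ℤ) (A : Finset ℕ) {l u v : ℕ} (hu : u ≤ l) (hv : v ≤ l) :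
    segCost p d st (A.erase l) u v = segCost p d st A u v := by
  rw [segCost, segCost, prefixSum_erase p A hu, seg_erase, Finset.erase_eq_of_notMem]
  rw [mem_seg]
  omega

theorem segCost_of_seg_eq_empty (p d : ℕ → ℤ) (st : ℤ) {A : Finset ℕ} {u v : ℕ}
    (h : seg A u v = ∅) : segCost p d st A u v = 0 := by
  rw [segCost, h, optCost_empty]

theorem prefixSum_le_sum {p : ℕ → ℤ} (hp : ∀ i, 0 ≤ p i) (A : Finset ℕ) (c : ℕ) :
    prefixSum p A c ≤ ∑ i ∈ A, p i :=
  Finset.sum_le_sum_of_subset_of_nonneg (Finset.filter_subset _ _) fun i _ _ => hp i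

theorem segCost_le {p d : ℕ → ℤ} (hp : ∀ i, 0 ≤ p i) {st Δ : ℤ} {A : Finset ℕ} {n u v : ℕ}
    (hA : A ⊆ Finset.range n) (huv : u ≤ v) (hΔ0 : 0 ≤ Δ)
    (hΔ : ∀ i < n, st + ∑ i ∈ A, p i - d i ≤ Δ) : segCost p d st A u v ≤ n * Δ := by
  have h1 := optCost_le_card_mul d hp (st + prefixSum p A u) (st + ∑ i ∈ A, p i) Δ
    (S := seg A u v) (by
      rw [add_assoc, prefixSum_add_sum_seg p A huv]
      linarith [prefixSum_le_sum hp A v]) hΔ0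
    (fun i hi => hΔ i (Finset.mem_range.1 (hA (mem_seg.1 hi).1)))
  refine h1.trans (mul_le_mul_of_nonneg_right ?_ hΔ0)
  have h2 := Finset.card_le_card (show seg A u v ⊆ Finset.range n from
    fun i hi => hA (mem_seg.1 hi).1)
  rw [Finset.card_range] at h2
  exact_mod_cast h2

/-- Lawler's recursion for one entry. The part before `l` is read from the table without `l`, the
part after the cut from the table with `l`; the latter is needed since `l` contributes to the start
time of the segment. Both halves of the decomposition give the two inequalities. -/
theorem newEntry_eq {M : Mem} {A : Finset ℕ} {st : ℤ} {n l u v : ℕ}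
    (hA : A ⊆ Finset.range n) (hp : ∀ i, 0 ≤ M.P i)
    (hD : ∀ i j, i ≤ j → j < n → M.D i ≤ M.D j) (hT : ∀ u v, 0 ≤ M.T u v) (hlA : l ∈ A)
    (hul : u ≤ l) (hlv : l < v)
    (hmax : ∀ i ∈ A, u ≤ i → M.P i ≤ M.P l)
    (hleft : ∀ c, l < c → c ≤ v → M.T u c = segCost M.P M.D st (A.erase l) u c)
    (hright : ∀ c, l < c → c ≤ v → M.T c v = segCost M.P M.D st A c v) :
    newEntry M A st l u v = segCost M.P M.D st A u v := by
  have hS : l ∈ seg A u v := mem_seg.2 ⟨hlA, hul, hlv⟩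
  have hcost : ∀ c, l < c → c ≤ v →
      cutCost M A st l u v (c - (l + 1)) =
        optCost M.P M.D (st + prefixSum M.P A u) (((seg A u v).filter (· < c)).erase l) +
        max (st + prefixSum M.P A u + ∑ i ∈ (seg A u v).filter (· < c), M.P i - M.D l) 0 +
        optCost M.P M.D (st + prefixSum M.P A u + ∑ i ∈ (seg A u v).filter (· < c), M.P i)
          ((seg A u v).filter (c ≤ ·)) := by
    intro c hc hcv
    have h1 : (seg A u v).filter (· < c) = seg A u c := by
      ext i
      simp only [Finset.mem_filter, mem_seg, and_assoc]
      exact and_congr_right fun _ => by omega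
    have h2 : (seg A u v).filter (c ≤ ·) = seg A c v := by
      ext i
      simp only [Finset.mem_filter, mem_seg, and_assoc]
      exact and_congr_right fun _ => by omega
    rw [h1, h2, add_assoc st, prefixSum_add_sum_seg M.P A (by omega : u ≤ c), cutCost,
      show l + 1 + (c - (l + 1)) = c by omega, hleft c hc hcv, hright c hc hcv, segCost, segCost,
      prefixSum_erase _ _ hul, seg_erase]
    ring
  -- The cuts are `l + 1, …, v`, so there are `v - l` of them, at least one; the lemma is applied
  -- with one less.
  have hspec := minUpTo_spec (g := cutCost M A st l u v) (fun k => by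
    have h1 := hT u (l + 1 + k)
    have h2 := hT (l + 1 + k) v
    have h3 := le_max_right (st + prefixSum M.P A (l + 1 + k) - M.D l) 0
    simp only [cutCost]
    linarith) (v - l - 1)
  rw [show v - l - 1 + 1 = v - l by omega] at hspec
  obtain ⟨⟨k, hk, hmin⟩, hle⟩ := hspec
  rw [newEntry]
  apply le_antisymm
  · obtain ⟨c, hc, hcv, hopt⟩ := exists_optCost_split M.D hp (st + prefixSum M.P A u) hS
      (fun i hi => hmax i (mem_seg.1 hi).1 (mem_seg.1 hi).2.1)
      (fun i _ j hj hij => hD i j hij (Finset.mem_range.1 (hA (mem_seg.1 hj).1)))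
      (fun i hi => (mem_seg.1 hi).2.2)
    rw [segCost, hopt, ← hcost c hc hcv]
    exact hle _ (by omega)
  · have h1 := hcost (l + 1 + k) (by omega) (by omega)
    rw [Nat.add_sub_cancel_left] at h1
    rw [hmin, h1, segCost]
    exact optCost_split_le M.P M.D _ hS (by omega)

/-! ### The main loop -/

/-- All memory cells hold integers of absolute value at most `C`, and the table is nonnegative. -/
structure MemBounded (n : ℕ) (C : ℤ) (M : Mem) : Prop where
  inp : ∀ a < 3 * n, |M.inp a| ≤ C
  P : ∀ i ≤ n, |M.P i| ≤ C
  D : ∀ i ≤ n, |M.D i| ≤ C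
  I : ∀ i ≤ n, |M.I i| ≤ C
  A : ∀ i ≤ n, |M.A i| ≤ C
  L : ∀ i ≤ n, |M.L i| ≤ C
  B : ∀ i ≤ n, |M.B i| ≤ C
  X : ∀ i ≤ n, |M.X i| ≤ C
  T : ∀ u v, 0 ≤ M.T u v ∧ M.T u v ≤ C

theorem MemBounded.row {n : ℕ} {B : ℤ} {M : Mem} (h : MemBounded n B M) (r i : ℕ) (hi : i ≤ n) :
    |M.row r i| ≤ B := by
  unfold Mem.row
  split
  · exact h.P i hi
  · exact h.D i hi
  · exact h.I i hi
  · exact h.A i hi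
  · exact h.L i hi
  · exact h.B i hi
  · exact h.X i hi
  · rw [abs_of_nonneg (h.T _ _).1]
    exact (h.T _ _).2

theorem supportedBelow_mkState (n : ℕ) (R : Regs) (M : Mem) :
    SupportedBelow (memSize n) (mkState n R M) := by
  intro a ha
  rw [memSize] at ha
  have h : n + 8 ≤ (a - 3 * n) / (n + 1) := by
    rw [Nat.le_div_iff_mul_le (by omega)]
    omega
  simp only [mkState, Mem.toFun]
  rw [if_neg, if_neg]
  · omega
  · exact not_lt.2 ((Nat.le_add_right _ _).trans ha)

theorem withinBounds_mkState {n : ℕ} {R : Regs} {M : Mem} {B : ℤ} (hB : 0 ≤ B)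
    (hR : ∀ x ∈ R.toList n, |x| ≤ B) (hM : MemBounded n B M) :
    WithinBounds (memSize n) B (mkState n R M) := by
  refine ⟨supportedBelow_mkState n R M, fun r => ?_, fun a => ?_⟩
  · simp only [mkState, List.getD]
    by_cases hr : r < (R.toList n).length
    · rw [List.getElem?_eq_getElem hr]
      exact hR _ (List.getElem_mem hr)
    · rw [List.getElem?_eq_none (not_lt.1 hr)]
      simpa using hB
  · simp only [mkState, Mem.toFun]
    split_ifs with h1 h2
    · exact hM.inp a h1
    · exact hM.row _ _ (Nat.lt_succ_iff.1 (Nat.mod_lt _ (by omega)))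
    · simpa using hB

/-- The registers of the outer loops hold integers of absolute value at most `B`. -/
def OuterBounded (B : ℤ) (R : Regs) : Prop :=
  ∀ x ∈ [R.start, R.pos, R.op, R.j, R.cj, R.best, R.bj, R.st], |x| ≤ B

theorem abs_cellBase_le {n : ℕ} {B : ℤ} (hB : (memSize n : ℤ) ≤ B) {r : ℕ} (hr : r < n + 8) :
    |cellBase n r| ≤ B := by
  have h0 : 0 ≤ cellBase n r := by rw [cellBase]; positivity
  have h1 := cellBase_add_lt n r 0 hr (Nat.zero_le n)
  rw [abs_of_nonneg h0]
  simp only [Nat.cast_zero, add_zero] at h1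
  omega

theorem add_eight_le_memSize (n : ℕ) : n + 8 ≤ memSize n := by
  rw [memSize]
  nlinarith

theorem withinBounds_head {n : ℕ} {R : Regs} {M : Mem} {B b h m g l y : ℤ}
    (hB : (memSize n : ℤ) ≤ B) (hR : OuterBounded B R) (hM : MemBounded n B M) (hb : |b| ≤ B)
    (hh : |h| ≤ B) (hm : |m| ≤ B) (hg : |g| ≤ B) (hl : |l| ≤ B) (hy : |y| ≤ B) :
    WithinBounds (memSize n) B
      (mkState n { outer R with b := b, h := h, m := m, go := g, l := l, y := y } M) := by
  have h8 := add_eight_le_memSize n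
  have h0 : 0 ≤ B := by omega
  refine withinBounds_mkState h0 (fun x hx => ?_) hM
  simp only [OuterBounded, List.mem_cons, List.not_mem_nil, or_false, forall_eq_or_imp,
    forall_eq] at hR
  have hn : |(n : ℤ)| ≤ B := by rw [abs_of_nonneg (by omega)]; omega
  have hn1 : |(n : ℤ) + 1| ≤ B := by rw [abs_of_nonneg (by omega)]; omega
  have h1 : |(1 : ℤ)| ≤ B := by rw [abs_one]; omega
  have h00 : |(0 : ℤ)| ≤ B := by rw [abs_zero]; exact h0
  simp only [Regs.toList, outer, List.mem_cons, List.not_mem_nil, or_false] at hx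
  have hc : ∀ r < 7, |cellBase n r| ≤ B := fun r hr => abs_cellBase_le hB (by omega)
  have c0 := hc 0 (by omega)
  have c1 := hc 1 (by omega)
  have c2 := hc 2 (by omega)
  have c3 := hc 3 (by omega)
  have c4 := hc 4 (by omega)
  have c5 := hc 5 (by omega)
  have c6 := hc 6 (by omega)
  obtain ⟨r1, r2, r3, r4, r5, r6, r7, r8⟩ := hR
  rcases hx with rfl | rfl | rfl | rfl | rfl | rfl | rfl | rfl | rfl | rfl | rfl | rfl | rfl | rfl |
    rfl | rfl | rfl | rfl | rfl | rfl | rfl | rfl | rfl | rfl | rfl | rfl | rfl | rfl | rfl | rfl |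
    rfl | rfl | rfl | rfl | rfl | rfl | rfl | rfl | rfl <;> assumption

/-- The alive jobs are those in `A`, and the memory is as the main loop expects it. -/
structure SolveInv (n : ℕ) (B : ℤ) (M : Mem) (A : Finset ℕ) : Prop where
  alive : M.A = ind A
  subset : A ⊆ Finset.range n
  lines : ∀ u ≤ n, M.X u = cellBase n (u + 7)
  nonneg : ∀ i, 0 ≤ M.P i
  mono : ∀ i j, i ≤ j → j < n → M.D i ≤ M.D j
  bounded : MemBounded n B M

theorem abs_ind_le_one (A : Finset ℕ) (i : ℕ) : |ind A i| ≤ 1 := by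
  rw [ind]
  split_ifs <;> simp

theorem SolveInv.withAlive {n : ℕ} {B : ℤ} {M : Mem} {A A' : Finset ℕ} (h : SolveInv n B M A)
    (hB : 1 ≤ B) (hA' : A' ⊆ Finset.range n) : SolveInv n B { M with A := ind A' } A' :=
  ⟨rfl, hA', h.lines, h.nonneg, h.mono,
    ⟨h.bounded.inp, h.bounded.P, h.bounded.D, h.bounded.I,
      fun i _ => (abs_ind_le_one A' i).trans hB, h.bounded.L, h.bounded.B, h.bounded.X,
      h.bounded.T⟩⟩

theorem SolveInv.withTable {n : ℕ} {B : ℤ} {M : Mem} {A : Finset ℕ} (h : SolveInv n B M A)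
    {T : ℕ → ℕ → ℤ} (hT : ∀ u v, 0 ≤ T u v ∧ T u v ≤ B) : SolveInv n B { M with T := T } A :=
  ⟨h.alive, h.subset, h.lines, h.nonneg, h.mono,
    ⟨h.bounded.inp, h.bounded.P, h.bounded.D, h.bounded.I, h.bounded.A, h.bounded.L, h.bounded.B,
      h.bounded.X, hT⟩⟩

theorem abs_update_le {B : ℤ} {n h : ℕ} {f : ℕ → ℤ} {w : ℤ} (hf : ∀ i ≤ n, |f i| ≤ B)
    (hw : |w| ≤ B) : ∀ i ≤ n, |Function.update f h w i| ≤ B := by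
  intro i hi
  rw [Function.update_apply]
  split_ifs
  · exact hw
  · exact hf i hi

theorem SolveInv.withStack {n : ℕ} {B : ℤ} {M : Mem} {A : Finset ℕ} (h : SolveInv n B M A)
    (k : ℕ) {l b : ℤ} (hl : |l| ≤ B) (hb : |b| ≤ B) :
    SolveInv n B { M with L := Function.update M.L k l, B := Function.update M.B k b } A :=
  ⟨h.alive, h.subset, h.lines, h.nonneg, h.mono,
    ⟨h.bounded.inp, h.bounded.P, h.bounded.D, h.bounded.I, h.bounded.A,
      abs_update_le h.bounded.L hl, abs_update_le h.bounded.B hb,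
      h.bounded.X, h.bounded.T⟩⟩

/-- The effect of processing the jobs of `A` from `b` on in the main loop with `h` stack entries:
the lines of the table from `b` on are correct, and the rest is preserved. -/
structure SolvePost (n : ℕ) (B st : ℤ) (A : Finset ℕ) (b h : ℕ) (M M' : Mem) : Prop where
  inv : SolveInv n B M' A
  frame : M' = { M with L := M'.L, B := M'.B, T := M'.T }
  stack : ∀ i < h, M'.L i = M.L i ∧ M'.B i = M.B i
  before : ∀ u < b, M'.T u = M.T u
  correct : ∀ u v, b ≤ u → u ≤ v → v ≤ n → M'.T u v = segCost M.P M.D st A u v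

/-- A round of the main loop, started in a state within the bounds. -/
theorem guarded_round {n : ℕ} {B : ℤ} {R R' : Regs} {M M' : Mem} (hB : (memSize n : ℤ) ≤ B)
    (hgo : R.go = 1)
    (h : LocalExec (memSize n) solveBody (mkState n R M) (mkState n R' M') (roundTime n))
    (hs : WithinBounds (memSize n) B (mkState n R M)) :
    ∃ t, 1 ≤ t ∧ t ≤ roundTime n + 1 ∧
      GuardedRun (WithinBounds (memSize n) (2 ^ roundTime n * B)) [.loop r_go solveBody]
        [.loop r_go solveBody] (mkState n R M) (mkState n R' M') t := by
  have h8 := add_eight_le_memSize n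
  have hB1 : 1 ≤ B := by omega
  obtain ⟨t, ht, hrun⟩ := h.guarded le_rfl hB1 hs
  refine ⟨1 + t, by omega, by omega, GuardedRun.loop_round (by simp [hgo]) hrun ⟨hs.1, ?_⟩⟩
  exact hs.2.mono (le_mul_of_one_le_left (by omega) (one_le_pow₀ (by norm_num)))

/-- The recursive procedure, seen as a stretch of the single loop that starts and ends at the loop
head with the same stack height. The induction is on the number `s` of alive jobs from `b` on; `h +
s ≤ n` keeps the stack inside its arrays. Push, restore and combine are three rounds around two
calls, so the number `r s` of rounds obeys `r 0 = 1` and `r s ≤ 3 + 2 * r (s - 1)`, which gives `4 *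
2 ^ s - 3`. The last conjunct is the matching lower bound when processing times decrease along the
due date order. -/
theorem guardedRun_solve {n : ℕ} {R : Regs} {B Δ : ℤ} (hB : (memSize n : ℤ) ≤ B)
    (hR : OuterBounded B R) (hΔ0 : 0 ≤ Δ) (hΔB : n * Δ ≤ B) (s : ℕ) {M : Mem} {A : Finset ℕ}
    {b h : ℕ} (hs : (seg A b n).card = s) (hb : b ≤ n) (hh : h + s ≤ n) (hM : SolveInv n B M A)
    (hΔ : ∀ i < n, R.st + ∑ i ∈ A, M.P i - M.D i ≤ Δ) :
    ∃ M' t, GuardedRun (WithinBounds (memSize n) (2 ^ roundTime n * B)) [.loop r_go solveBody]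
        [.loop r_go solveBody] (mkState n { outer R with b := b, h := h, m := 1, go := 1 } M)
        (mkState n { outer R with b := b, h := h, go := 1 } M') t ∧
      SolvePost n B R.st A b h M M' ∧
      t + 3 * (roundTime n + 1) ≤ 4 * 2 ^ s * (roundTime n + 1) ∧
      ((∀ i j, i < j → j < n → M.P j < M.P i) → 2 ^ s ≤ t) := by
  have h8 := add_eight_le_memSize n
  have hB1 : 1 ≤ B := by omega
  have habs : ∀ i : ℕ, i ≤ n → |(i : ℤ)| ≤ B := fun i hi => by
    rw [abs_of_nonneg (by omega)]; omega
  have h1B : |(1 : ℤ)| ≤ B := by simpa using hB1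
  have h0B : |(0 : ℤ)| ≤ B := by simpa using hB1.trans' zero_le_one
  induction s using Nat.strong_induction_on generalizing M A b h with
  | _ s ih =>
  have hhead : ∀ (b' h' : ℕ) (m : ℤ) (M' : Mem), b' ≤ n → h' ≤ n → |m| ≤ B → MemBounded n B M' →
      WithinBounds (memSize n) B (mkState n { outer R with b := b', h := h', m := m, go := 1 } M') :=
    fun b' h' m M' hb' hh' hm hM' =>
      withinBounds_head hB hR hM' (habs b' hb') (habs h' hh') hm h1B h0B h0B
  rcases scanState_spec M.P hM.nonneg A b (n - b) with ⟨hnone, hscan⟩ |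
    ⟨l, hlA, hbl, hln, hscan, hmax, hfirst⟩
  · have hempty : seg A b n = ∅ := by
      rw [Finset.eq_empty_iff_forall_notMem]
      intro i hi
      rw [mem_seg] at hi
      exact hnone i hi.1 hi.2.1 (by omega)
    have hs0 : s = 0 := by rw [← hs, hempty, Finset.card_empty]
    subst hs0
    obtain ⟨t, ht1, ht, hrun⟩ := guarded_round hB rfl
      (localExec_round_clear n R (M := M) (h := h) 1 hM.alive hM.lines hb hscan)
      (hhead b h 1 M hb (by omega) h1B hM.bounded)
    refine ⟨_, t, hrun, ⟨hM.withTable fun u v => ?_, rfl, fun i _ => ⟨rfl, rfl⟩, fun u hu => ?_,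
      fun u v hu huv hv => ?_⟩, by omega, fun _ => by simpa using ht1⟩
    · split_ifs
      · exact ⟨le_rfl, by omega⟩
      · exact hM.bounded.T u v
    · funext v
      exact if_neg (by omega)
    · refine (if_pos ⟨hu, by omega, hv⟩).trans (segCost_of_seg_eq_empty _ _ _ ?_).symm
      rw [Finset.eq_empty_iff_forall_notMem] at hempty ⊢
      intro i hi
      refine hempty i ?_
      rw [mem_seg] at hi ⊢
      exact ⟨hi.1, by omega, by omega⟩
  · have hl : l < n := by omega
    have hlseg : l ∈ seg A b n := mem_seg.2 ⟨hlA, hbl, hl⟩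
    have hs1 : (seg (A.erase l) b n).card = s - 1 := by
      rw [seg_erase, Finset.card_erase_of_mem hlseg, hs]
    have hspos : 0 < s := hs ▸ Finset.card_pos.2 ⟨l, hlseg⟩
    -- The second call, on the jobs after `l`, also has at least one job fewer, even though `l` is
    -- alive again.
    have hsub : seg A (l + 1) n ⊆ (seg A b n).erase l := by
      intro i hi
      rw [Finset.mem_erase, mem_seg]
      rw [mem_seg] at hi
      exact ⟨by omega, hi.1, by omega, hi.2.2⟩
    have hs2 : (seg A (l + 1) n).card ≤ s - 1 := by
      rw [← hs, ← Finset.card_erase_of_mem hlseg]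
      exact Finset.card_le_card hsub
    -- remove the job `l` and process the remaining jobs from `b` on
    obtain ⟨t₁, ht₁, ht₁', hrun₁⟩ := guarded_round hB rfl
      (localExec_round_push n R (M := M) (h := h) 1 hM.alive hb hl.le (by omega) (hM.nonneg l) hscan)
      (hhead b h 1 M hb (by omega) h1B hM.bounded)
    have hinv₁ := (hM.withStack h (habs l hl.le) (habs b hb)).withAlive hB1
      ((Finset.erase_subset l A).trans hM.subset)
    obtain ⟨M₂, t₂, hrun₂, hpost₂, ht₂, ht₂'⟩ := ih (s - 1) (by omega) (h := h + 1) hs1 hb (by omega)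
      hinv₁ (fun i hi => (hΔ i hi).trans' (by
        have := Finset.sum_le_sum_of_subset_of_nonneg (f := M.P) (Finset.erase_subset l A)
          fun i _ _ => hM.nonneg i
        simp only
        linarith))
    have hP₂ : M₂.P = M.P := by rw [hpost₂.frame]
    have hD₂ : M₂.D = M.D := by rw [hpost₂.frame]
    have hstack₂ := hpost₂.stack h (by omega)
    simp only [Function.update_self] at hstack₂
    -- restore the job `l` and process the jobs after it
    obtain ⟨t₃, ht₃, ht₃', hrun₃⟩ := guarded_round hB rfl
      (localExec_round_restore n R (M := M₂) (h := h) 1 hpost₂.inv.alive (by simp) hstack₂.1 hl.le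
        (by omega) b) (hhead b (h + 1) 0 M₂ hb (by omega) h0B hpost₂.inv.bounded)
    rw [Finset.insert_erase hlA] at hrun₃
    obtain ⟨M₄, t₄, hrun₄, hpost₄, ht₄, ht₄'⟩ := ih _ (by omega) (h := h + 1) (A := A) (b := l + 1)
      (M := { M₂ with A := ind A }) rfl (by omega) (by omega) (hpost₂.inv.withAlive hB1 hM.subset)
      (by simpa only [hP₂, hD₂] using hΔ)
    have hP₄ : M₄.P = M.P := by rw [hpost₄.frame]; exact hP₂
    have hD₄ : M₄.D = M.D := by rw [hpost₄.frame]; exact hD₂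
    have hstack₄ := hpost₄.stack h (by omega)
    simp only [hstack₂.1, hstack₂.2] at hstack₄
    -- combine the results
    obtain ⟨t₅, ht₅, ht₅', hrun₅⟩ := guarded_round hB rfl
      (localExec_round_combine n R (M := M₄) (h := h) 1 hpost₄.inv.alive hpost₄.inv.lines hlA
        hstack₄.1 hstack₄.2 hl hbl (by omega) (l + 1 : ℕ))
      (hhead (l + 1) (h + 1) 0 M₄ (by omega) (by omega) h0B hpost₄.inv.bounded)
    -- Lines up to `l` still hold the results of the first call, because the second one writes only
    -- from line `l + 1` on; those later lines now hold the results with `l` alive.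
    have hentry : ∀ u v, b ≤ u → u ≤ l → l < v → v ≤ n →
        newEntry M₄ A R.st l u v = segCost M.P M.D R.st A u v := by
      intro u v hbu hul hlv hvn
      rw [← hP₄, ← hD₄]
      refine newEntry_eq hM.subset hpost₄.inv.nonneg hpost₄.inv.mono
        (fun u v => (hpost₄.inv.bounded.T u v).1) hlA hul hlv ?_ ?_ ?_
      · intro i hi hui
        rw [hP₄]
        exact hmax i hi (by omega) (by have := Finset.mem_range.1 (hM.subset hi); omega)
      · intro c hlc hcv
        rw [hpost₄.before u (by omega), hP₄, hD₄]
        exact hpost₂.correct u c hbu (by omega) (by omega)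
      · intro c hlc hcv
        rw [hpost₄.correct c v hlc hcv hvn, hP₄, hD₄]
        simp only [hP₂, hD₂]
    refine ⟨_, _, hrun₁.trans (hrun₂.trans (hrun₃.trans (hrun₄.trans hrun₅))),
      ⟨hpost₄.inv.withTable fun u v => ?_, ?_, fun i hi => ?_, fun u hu => ?_,
        fun u v hu huv hv => ?_⟩, ?_, fun hanti => ?_⟩
    · split_ifs with hc
      · rw [hentry u v hc.1 hc.2.1 hc.2.2.1 hc.2.2.2]
        exact ⟨optCost_nonneg _ _ _ _,
          (segCost_le hM.nonneg hM.subset (by omega) hΔ0 hΔ).trans hΔB⟩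
      · exact hpost₄.inv.bounded.T u v
    · have e4 := hpost₄.frame
      have e2 := hpost₂.frame
      rw [e4, e2]
      simp only [← hM.alive]
    · have e4 := hpost₄.stack i (by omega)
      have e2 := hpost₂.stack i (by omega)
      simp only [Function.update_of_ne (show i ≠ h by omega)] at e2
      exact ⟨e4.1.trans e2.1, e4.2.trans e2.2⟩
    · funext v
      refine (if_neg (by omega)).trans ?_
      rw [hpost₄.before u (by omega)]
      exact congrFun (hpost₂.before u hu) v
    · simp only
      -- Three regions: entries with `u ≤ l < v` are the combined ones, those with `v ≤ l` come from
      -- the first call and are insensitive to `l`, and those with `u > l` come from the second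
      -- call.
      by_cases hul : u ≤ l
      · by_cases hlv : l < v
        · rw [if_pos ⟨hu, hul, hlv, hv⟩]
          exact hentry u v hu hul hlv hv
        · rw [if_neg (by omega), hpost₄.before u (by omega)]
          refine (hpost₂.correct u v hu huv hv).trans ?_
          exact segCost_erase _ _ _ _ hul (by omega)
      · rw [if_neg (by omega), hpost₄.correct u v (by omega) huv hv]
        simp only [hP₂, hD₂]
    · have e1 : 2 ^ (seg A (l + 1) n).card ≤ 2 ^ (s - 1) := Nat.pow_le_pow_right (by norm_num) hs2
      have e2 : 2 ^ s = 2 * 2 ^ (s - 1) := by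
        rw [← pow_succ', Nat.sub_add_cancel hspos]
      have e3 := Nat.mul_le_mul_right (roundTime n + 1) (Nat.mul_le_mul_left 4 e1)
      rw [e2, show 4 * (2 * 2 ^ (s - 1)) * (roundTime n + 1) =
        2 * (4 * 2 ^ (s - 1) * (roundTime n + 1)) by ring]
      omega
    -- For decreasing processing times no alive job from `b` on precedes the longest one, so the
    -- second call loses only `l` and has exactly `s - 1` jobs.
    · have e0 : seg A (l + 1) n = (seg A b n).erase l := by
        refine Finset.Subset.antisymm hsub fun i hi => ?_
        rw [Finset.mem_erase, mem_seg] at hi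
        rw [mem_seg]
        refine ⟨hi.2.1, ?_, hi.2.2.2⟩
        rcases lt_or_gt_of_ne hi.1 with h | h
        · exact absurd (hfirst i hi.2.1 hi.2.2.1 h) (not_lt.2 (hanti i l h hl).le)
        · exact h
      have e1 := ht₂' hanti
      have e2 := ht₄' (by simpa only [hP₂] using hanti)
      rw [e0, Finset.card_erase_of_mem hlseg, hs] at e2
      have e3 : 2 ^ s = 2 * 2 ^ (s - 1) := by
        rw [← pow_succ', Nat.sub_add_cancel hspos]
      omega

/-! ### The outer loops -/

theorem hundred_le_roundTime (n : ℕ) : 100 ≤ roundTime n := by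
  have := le_roundTime (n := n) (a := 100) (b := 0) (c := 0) (d := 0) (by norm_num)
  omega

/-- The states through which the program runs. -/
abbrev guard (n : ℕ) (B : ℤ) : RamState → Prop := WithinBounds (memSize n) (2 ^ roundTime n * B)

theorem guard_of_withinBounds {n : ℕ} {B : ℤ} (hB : 0 ≤ B) {s : RamState}
    (h : WithinBounds (memSize n) B s) : guard n B s :=
  ⟨h.1, h.2.mono (le_mul_of_one_le_left hB (one_le_pow₀ (by norm_num)))⟩

/-- The registers of the outer loops, with all other registers zero. -/
def outerRegs (start pos op j cj best bj st : ℤ) : Regs where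
  start := start
  pos := pos
  op := op
  j := j
  cj := cj
  best := best
  bj := bj
  st := st

/-- Started with an empty stack and `b = 0`, the loop covers all of `A`, and the corner entry `(0,
n)` of the table is the optimum for the whole set. The constant `4 * 2 ^ n` already leaves three
rounds unused, which pay for initialisation and exit. -/
theorem guardedRun_solve_program {n : ℕ} {R : Regs} {B Δ : ℤ} (hB : (memSize n : ℤ) ≤ B)
    (hR : OuterBounded B R) (hΔ0 : 0 ≤ Δ) (hΔB : n * Δ ≤ B) {M : Mem} {A : Finset ℕ}
    (hM : SolveInv n B M A) (hΔ : ∀ i < n, R.st + ∑ i ∈ A, M.P i - M.D i ≤ Δ) :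
    ∃ M' t, GuardedRun (guard n B) [solve] [] (mkState n (outer R) M) (mkState n (outer R) M') t ∧
      SolveInv n B M' A ∧ M' = { M with L := M'.L, B := M'.B, T := M'.T } ∧
      M'.T 0 n = optCost M.P M.D R.st A ∧
      t ≤ 4 * 2 ^ n * (roundTime n + 1) ∧
      ((∀ i j, i < j → j < n → M.P j < M.P i) → 2 ^ A.card ≤ t) := by
  have h8 := add_eight_le_memSize n
  have hB1 : 1 ≤ B := by omega
  have h1B : |(1 : ℤ)| ≤ B := by simpa using hB1
  have h0B : |(0 : ℤ)| ≤ B := by simpa using hB1.trans' zero_le_one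
  have hseg : seg A 0 n = A := by
    ext i
    rw [mem_seg]
    exact ⟨fun h => h.1, fun h => ⟨h, Nat.zero_le _, Finset.mem_range.1 (hM.subset h)⟩⟩
  have hcard : A.card ≤ n := by simpa using Finset.card_le_card hM.subset
  have hstart : WithinBounds (memSize n) B (mkState n (outer R) M) :=
    withinBounds_head (b := 0) (h := 0) (m := 0) (g := 0) (l := 0) (y := 0) hB hR hM.bounded
      h0B h0B h0B h0B h0B h0B
  have hinit : LocalExec (memSize n)
      (block [.const r_b 0, .const r_h 0, .const r_m 1, .const r_go 1]) (mkState n (outer R) M)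
      (mkState n { outer R with b := (0 : ℕ), h := (0 : ℕ), m := 1, go := 1 } M) 20 :=
    LocalExec.mono (LocalExec.of_effect (by simp [block, Straight]) (by simp [block, effect, outer]))
      (by decide)
  obtain ⟨t₀, ht₀, hrun₀⟩ := hinit.guarded (τ := roundTime n)
    (by have := hundred_le_roundTime n; omega) hB1 hstart
  obtain ⟨M', t₁, hrun₁, hpost, ht₁, ht₁'⟩ := guardedRun_solve hB hR hΔ0 hΔB A.card (M := M) (A := A)
    (b := 0) (h := 0) (by rw [hseg]) (Nat.zero_le n) (by omega) hM hΔ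
  obtain ⟨t₂, ht₂, ht₂', hrun₂⟩ := guarded_round hB rfl
    (localExec_round_stop n R (M := M') 1 0)
    (withinBounds_head (h := 0) (m := 0) (l := 0) (y := 0) hB hR hpost.inv.bounded
      h0B h0B h0B h1B h0B h0B)
  have hend : guard n B (mkState n (outer R) M') :=
    guard_of_withinBounds (by omega) (withinBounds_head (b := 0) (h := 0) (m := 0) (g := 0) (l := 0)
      (y := 0) hB hR hpost.inv.bounded h0B h0B h0B h0B h0B h0B)
  have hexit : GuardedRun (guard n B) [.loop r_go solveBody] [] (mkState n (outer R) M')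
      (mkState n (outer R) M') 1 := GuardedRun.loop_exit (by simp [outer]) hend
  refine ⟨M', _, GuardedRun.seq hrun₀ (hrun₁.trans (hrun₂.trans hexit))
      (guard_of_withinBounds (by omega) hstart),
    hpost.inv, hpost.frame, ?_, ?_, fun hanti => ?_⟩
  · rw [hpost.correct 0 n le_rfl (Nat.zero_le n) le_rfl, segCost, hseg, prefixSum_zero, add_zero]
  · have e1 : 2 ^ A.card ≤ 2 ^ n := Nat.pow_le_pow_right (by norm_num) hcard
    have e2 := Nat.mul_le_mul_right (roundTime n + 1) (Nat.mul_le_mul_left 4 e1)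
    have := hundred_le_roundTime n
    omega
  · have := ht₁' hanti
    omega

/-- The cost of the best sequence of `A` from time `t` on that starts with `j`. -/
noncomputable def firstCost (p d : ℕ → ℤ) (t : ℤ) (A : Finset ℕ) (j : ℕ) : ℤ :=
  optCost p d (t + p j) (A.erase j) + max (t + p j - d j) 0

/-- The best first job among the first `k` jobs. -/
noncomputable def bestFirst (p d : ℕ → ℤ) (t : ℤ) (A : Finset ℕ) : ℕ → ℤ × ℕ
  | 0 => (-1, 0)
  | k + 1 =>
    if k ∈ A ∧ ((bestFirst p d t A k).1 < 0 ∨ firstCost p d t A k < (bestFirst p d t A k).1) then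
      (firstCost p d t A k, k)
    else bestFirst p d t A k

theorem firstCost_nonneg (p d : ℕ → ℤ) (t : ℤ) (A : Finset ℕ) (j : ℕ) :
    0 ≤ firstCost p d t A j :=
  add_nonneg (optCost_nonneg _ _ _ _) (le_max_right _ _)

theorem bestFirst_spec (p d : ℕ → ℤ) (t : ℤ) (A : Finset ℕ) (k : ℕ) :
    ((∀ i ∈ A, ¬ i < k) ∧ bestFirst p d t A k = (-1, 0)) ∨
    ∃ j ∈ A, j < k ∧ bestFirst p d t A k = (firstCost p d t A j, j) ∧
      ∀ i ∈ A, i < k → firstCost p d t A j ≤ firstCost p d t A i := by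
  induction k with
  | zero => exact Or.inl ⟨by simp, rfl⟩
  | succ k ih =>
    rw [bestFirst]
    rcases ih with ⟨h1, h2⟩ | ⟨j, hj, hjk, h2, h3⟩
    · rw [h2]
      by_cases hA : k ∈ A
      · rw [if_pos ⟨hA, Or.inl (by norm_num)⟩]
        refine Or.inr ⟨k, hA, by omega, rfl, fun i hi hik => ?_⟩
        have := h1 i hi
        obtain rfl : i = k := by omega
        exact le_rfl
      · rw [if_neg fun h => hA h.1]
        refine Or.inl ⟨fun i hi hik => ?_, rfl⟩
        have := h1 i hi
        obtain rfl : i = k := by omega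
        exact hA hi
    · rw [h2]
      have h0 := firstCost_nonneg p d t A j
      refine Or.inr ?_
      by_cases hA : k ∈ A ∧ firstCost p d t A k < firstCost p d t A j
      · rw [if_pos ⟨hA.1, Or.inr hA.2⟩]
        refine ⟨k, hA.1, by omega, rfl, fun i hi hik => ?_⟩
        rcases Nat.lt_succ_iff_lt_or_eq.1 hik with h | rfl
        · exact hA.2.le.trans (h3 i hi h)
        · exact le_rfl
      · rw [if_neg (by rintro ⟨h4, h5⟩; exact hA ⟨h4, h5.resolve_left (not_lt.2 h0)⟩)]
        refine ⟨j, hj, by omega, rfl, fun i hi hik => ?_⟩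
        rcases Nat.lt_succ_iff_lt_or_eq.1 hik with h | rfl
        · exact h3 i hi h
        · exact not_lt.1 fun h => hA ⟨hi, h⟩

/-- Since some optimal sequence has a first job in `A`, the cheapest choice of a first job reaches
the optimum. -/
theorem bestFirst_optimal (p d : ℕ → ℤ) (t : ℤ) {A : Finset ℕ} {n : ℕ} (hA : A ⊆ Finset.range n)
    (hne : A.Nonempty) :
    ∃ j ∈ A, bestFirst p d t A n = (optCost p d t A, j) ∧ optCost p d t A = firstCost p d t A j := by
  rcases bestFirst_spec p d t A n with ⟨h1, -⟩ | ⟨j, hj, -, h2, h3⟩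
  · obtain ⟨i, hi⟩ := hne
    exact absurd (Finset.mem_range.1 (hA hi)) (h1 i hi)
  · have h : optCost p d t A = firstCost p d t A j := by
      apply le_antisymm
      · rw [firstCost, add_comm]
        exact optCost_cons_le p d t hj
      · obtain ⟨i, hi, h⟩ := exists_optCost_cons p d t hne
        rw [h, add_comm]
        exact h3 i hi (Finset.mem_range.1 (hA hi))
    exact ⟨j, hj, by rw [h2, h], h⟩

/-! ### Trying a job at the next position -/

section Try

variable (n : ℕ) {M : Mem} {A : Finset ℕ} {j : ℕ} (S q o cj best bj : ℤ)

theorem localExec_tryBegin (hA : M.A = ind A) (hj : j ≤ n) (y : ℤ) :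
    LocalExec (memSize n) tryBegin
      (mkState n { outerRegs S q o j cj best bj 0 with y := y } M)
      (mkState n (outerRegs S q o j cj best bj (S + M.P j)) { M with A := ind (A.erase j) }) 40 := by
  refine LocalExec.mono (LocalExec.of_effect ?_ ?_) (by decide)
  · simp [tryBegin, block, Straight, effect, outerRegs, hj, cellBase_add_lt]
  · simp [tryBegin, block, effect, outerRegs, hj, hA, update_ind_zero]

theorem localExec_tryEnd (hA : M.A = ind (A.erase j)) (hX : ∀ u ≤ n, M.X u = cellBase n (u + 7))
    (hjA : j ∈ A) (hj : j ≤ n) (st : ℤ) :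
    LocalExec (memSize n) tryEnd
      (mkState n (outerRegs S q o j cj best bj st) M)
      (mkState n (outerRegs S q o j cj
        (if best < 0 ∨ M.T 0 n + max (st - M.D j) 0 < best then M.T 0 n + max (st - M.D j) 0 else best)
        (if best < 0 ∨ M.T 0 n + max (st - M.D j) 0 < best then j else bj) 0)
        { M with A := ind A }) 80 := by
  have hX0 : M.X 0 = cellBase n 7 := by simpa using hX 0 (Nat.zero_le n)
  have hT : ∀ R : Regs, (mkState n R M).mem (cellBase n 7 + (n : ℤ)).toNat = M.T 0 n := fun R => by
    simpa using mem_T n R M (Nat.zero_le n) (le_refl n)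
  have hA' : Function.update (ind (A.erase j)) j 1 = ind A := by
    rw [update_ind_one, Finset.insert_erase hjA]
  refine LocalExec.mono (LocalExec.of_effect ?_ ?_) (by decide)
  · by_cases hd : M.D j < st
    · by_cases hw : best < 0
      · simp [tryEnd, block, Straight, effect, skip, outerRegs, hj, cellBase_add_lt, hX0, hT, hd, hw]
      · by_cases hw' : M.T 0 n + (st - M.D j) < best <;>
        simp [tryEnd, block, Straight, effect, skip, outerRegs, hj, cellBase_add_lt, hX0, hT, hd, hw,
          hw']
    · by_cases hw : best < 0
      · simp [tryEnd, block, Straight, effect, skip, outerRegs, hj, cellBase_add_lt, hX0, hT, hd, hw]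
      · by_cases hw' : M.T 0 n < best <;>
        simp [tryEnd, block, Straight, effect, skip, outerRegs, hj, cellBase_add_lt, hX0, hT, hd, hw,
          hw']
  · by_cases hd : M.D j < st
    · rw [max_eq_left (by linarith : 0 ≤ st - M.D j)]
      by_cases hw : best < 0
      · simp [tryEnd, block, effect, skip, outerRegs, hj, hX0, hT, hd, hw, hA, hA']
      · by_cases hw' : M.T 0 n + (st - M.D j) < best <;>
        simp [tryEnd, block, effect, skip, outerRegs, hj, hX0, hT, hd, hw, hw', hA, hA']
    · rw [max_eq_right (by linarith : st - M.D j ≤ 0), add_zero]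
      by_cases hw : best < 0
      · simp [tryEnd, block, effect, skip, outerRegs, hj, hX0, hT, hd, hw, hA, hA']
      · by_cases hw' : M.T 0 n < best <;>
        simp [tryEnd, block, effect, skip, outerRegs, hj, hX0, hT, hd, hw, hw', hA, hA']

theorem localExec_tryTest (hj : j ≤ n) :
    LocalExec (memSize n) (block [.plus r_y r_A r_j, .load r_y r_y])
      (mkState n (outerRegs S q o j cj best bj 0) M)
      (mkState n { outerRegs S q o j cj best bj 0 with y := M.A j } M) 10 := by
  refine LocalExec.mono (LocalExec.of_effect ?_ ?_) (by decide)
  · simp [block, Straight]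
  · simp [block, effect, outerRegs, hj]

theorem localExec_tryNext (j y : ℤ) :
    LocalExec (memSize n) (block [.plus r_j r_j r_one, .minus r_cj r_cj r_one, .const r_y 0])
      (mkState n { outerRegs S q o j cj best bj 0 with y := y } M)
      (mkState n (outerRegs S q o (j + 1) (cj - 1) best bj 0) M) 10 := by
  refine LocalExec.mono (LocalExec.of_effect ?_ ?_) (by decide)
  · simp [block, Straight]
  · simp [block, effect, outerRegs]

theorem localExec_positionEnd {b o : ℕ} (hA : M.A = ind A) (hb : b ≤ n) (ho : o < 3 * n) :
    LocalExec (memSize n) positionEnd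
      (mkState n (outerRegs S q o j cj best b 0) M)
      (mkState n (outerRegs (S + M.P b) (q - 1) (o + 1) 0 cj 0 0 0)
        { M with A := ind (A.erase b), inp := Function.update M.inp o (M.I b) }) 60 := by
  have ho' : o < memSize n := by rw [memSize]; omega
  refine LocalExec.mono (LocalExec.of_effect ?_ ?_) (by decide)
  · simp [positionEnd, block, Straight, effect, outerRegs, hb, ho', cellBase_add_lt]
  · simp [positionEnd, block, effect, outerRegs, hb, ho, hA, update_ind_zero]

end Try

theorem outerBounded_outerRegs {B start pos op j cj best bj st : ℤ} (h1 : |start| ≤ B)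
    (h2 : |pos| ≤ B) (h3 : |op| ≤ B) (h4 : |j| ≤ B) (h5 : |cj| ≤ B) (h6 : |best| ≤ B)
    (h7 : |bj| ≤ B) (h8 : |st| ≤ B) : OuterBounded B (outerRegs start pos op j cj best bj st) := by
  simp only [OuterBounded, outerRegs, List.mem_cons, List.not_mem_nil, or_false, forall_eq_or_imp,
    forall_eq]
  exact ⟨h1, h2, h3, h4, h5, h6, h7, h8⟩

theorem withinBounds_outerRegs {n : ℕ} {M : Mem} {B start pos op j cj best bj st y : ℤ}
    (hB : (memSize n : ℤ) ≤ B)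
    (hR : OuterBounded B (outerRegs start pos op j cj best bj st)) (hM : MemBounded n B M)
    (hy : |y| ≤ B) :
    WithinBounds (memSize n) B
      (mkState n { outerRegs start pos op j cj best bj st with y := y } M) := by
  have h8 := add_eight_le_memSize n
  have h0B : |(0 : ℤ)| ≤ B := by rw [abs_zero]; omega
  have h := withinBounds_head (b := 0) (h := 0) (m := 0) (g := 0) (l := 0) hB hR hM h0B h0B h0B h0B
    h0B hy
  simpa only [outer, outerRegs] using h

theorem firstCost_le {p d : ℕ → ℤ} (hp : ∀ i, 0 ≤ p i) {t Δ : ℤ} {A : Finset ℕ} {n j : ℕ}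
    (hA : A ⊆ Finset.range n) (hj : j ∈ A) (hΔ0 : 0 ≤ Δ)
    (hΔ : ∀ i < n, t + ∑ i ∈ A, p i - d i ≤ Δ) : firstCost p d t A j ≤ (n + 1) * Δ := by
  have hsum := Finset.add_sum_erase A p hj
  have h1 := optCost_le_card_mul d hp (t + p j) (t + ∑ i ∈ A, p i) Δ
    (S := A.erase j) (by linarith) hΔ0
    (fun i hi => hΔ i (Finset.mem_range.1 (hA (Finset.mem_of_mem_erase hi))))
  have h2 : ((A.erase j).card : ℤ) ≤ n := by
    have := Finset.card_le_card ((Finset.erase_subset j A).trans hA)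
    rw [Finset.card_range] at this
    exact_mod_cast this
  have h3 := mul_le_mul_of_nonneg_right h2 hΔ0
  have h4 : max (t + p j - d j) 0 ≤ Δ := by
    refine max_le ?_ hΔ0
    have h5 := hΔ j (Finset.mem_range.1 (hA hj))
    have h6 : 0 ≤ ∑ i ∈ A.erase j, p i := Finset.sum_nonneg fun i _ => hp i
    linarith
  rw [firstCost]
  linarith

theorem bestFirst_bounds {p d : ℕ → ℤ} (hp : ∀ i, 0 ≤ p i) {t Δ B : ℤ} {A : Finset ℕ} {n : ℕ}
    (hA : A ⊆ Finset.range n) (hΔ0 : 0 ≤ Δ) (hΔ : ∀ i < n, t + ∑ i ∈ A, p i - d i ≤ Δ)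
    (hB : (n + 1) * Δ ≤ B) (hB1 : 1 ≤ B) (k : ℕ) :
    |(bestFirst p d t A k).1| ≤ B ∧ (bestFirst p d t A k).2 ≤ n := by
  rcases bestFirst_spec p d t A k with ⟨-, h⟩ | ⟨j, hj, -, h, -⟩
  · rw [h]
    simpa using hB1
  · rw [h]
    refine ⟨?_, (Finset.mem_range.1 (hA hj)).le⟩
    rw [abs_of_nonneg (firstCost_nonneg _ _ _ _ _)]
    exact (firstCost_le hp hA hj hΔ0 hΔ).trans hB

/-- One candidate for the next position: the table is computed for the other alive jobs, started
after the candidate. Only stack and table are changed in the end, and a job that is already placed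
costs no table computation; this is why the lower bound requires `j ∈ A`. -/
theorem guardedRun_tryBody {n : ℕ} {B Δ : ℤ} (hB : (memSize n : ℤ) ≤ B) (hΔ0 : 0 ≤ Δ)
    (hΔB : (n + 1) * Δ ≤ B) {M : Mem} {A : Finset ℕ} (hM : SolveInv n B M A) {S q o : ℤ}
    (hS : 0 ≤ S) (hSB : S + ∑ i ∈ A, M.P i ≤ B) (hq : |q| ≤ B) (ho : |o| ≤ B)
    (hΔ : ∀ i < n, S + ∑ i ∈ A, M.P i - M.D i ≤ Δ) {j : ℕ} (hj : j < n) :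
    ∃ M' t, GuardedRun (guard n B) [tryBody] []
        (mkState n (outerRegs S q o j (n - j) (bestFirst M.P M.D S A j).1
          (bestFirst M.P M.D S A j).2 0) M)
        (mkState n (outerRegs S q o (j + 1 : ℕ) (n - (j + 1 : ℕ)) (bestFirst M.P M.D S A (j + 1)).1
          (bestFirst M.P M.D S A (j + 1)).2 0) M') t ∧
      SolveInv n B M' A ∧ M' = { M with L := M'.L, B := M'.B, T := M'.T } ∧
      t ≤ 5 * 2 ^ n * (roundTime n + 1) ∧
      ((∀ i j, i < j → j < n → M.P j < M.P i) → j ∈ A → 2 ^ (A.card - 1) ≤ t) := by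
  have h8 := add_eight_le_memSize n
  have hB1 : 1 ≤ B := by omega
  have h1B : |(1 : ℤ)| ≤ B := by simpa using hB1
  have h0B : |(0 : ℤ)| ≤ B := by simpa using hB1.trans' zero_le_one
  have hτ := hundred_le_roundTime n
  have habs : ∀ i : ℕ, i ≤ n → |(i : ℤ)| ≤ B := fun i hi => by
    rw [abs_of_nonneg (by omega)]; omega
  have hK : 200 ≤ 2 * 2 ^ n * (roundTime n + 1) := by
    have := Nat.one_le_two_pow (n := n)
    nlinarith
  have hsum0 : 0 ≤ ∑ i ∈ A, M.P i := Finset.sum_nonneg fun i _ => hM.nonneg i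
  have hS' : |S| ≤ B := by rw [abs_of_nonneg hS]; linarith
  have hcj : |(n : ℤ) - j| ≤ B := by rw [abs_of_nonneg (by omega)]; omega
  have hbf := bestFirst_bounds hM.nonneg hM.subset hΔ0 hΔ hΔB hB1
  have hreg : ∀ (k : ℕ) (st : ℤ), |st| ≤ B → OuterBounded B (outerRegs S q o j (n - j)
      (bestFirst M.P M.D S A k).1 (bestFirst M.P M.D S A k).2 st) := fun k st hst =>
    outerBounded_outerRegs hS' hq ho (habs j hj.le) hcj (hbf k).1 (habs _ (hbf k).2) hst
  have hw : ∀ (M' : Mem) (k : ℕ) (st y : ℤ), MemBounded n B M' → |st| ≤ B → |y| ≤ B →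
      WithinBounds (memSize n) B (mkState n { outerRegs S q o j (n - j)
        (bestFirst M.P M.D S A k).1 (bestFirst M.P M.D S A k).2 st with y := y } M') :=
    fun M' k st y hM' hst hy => withinBounds_outerRegs hB (hreg k st hst) hM' hy
  have hg : ∀ (M' : Mem) (k : ℕ) (st y : ℤ), MemBounded n B M' → |st| ≤ B → |y| ≤ B →
      guard n B (mkState n { outerRegs S q o j (n - j)
        (bestFirst M.P M.D S A k).1 (bestFirst M.P M.D S A k).2 st with y := y } M') :=
    fun M' k st y hM' hst hy => guard_of_withinBounds (by omega) (hw M' k st y hM' hst hy)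
  have e1 : ((j + 1 : ℕ) : ℤ) = j + 1 := by push_cast; rfl
  have e2 : (n : ℤ) - (j + 1 : ℕ) = n - j - 1 := by push_cast; ring
  rw [e2, e1]
  obtain ⟨t₀, ht₀, hrun₀⟩ := (localExec_tryTest n (M := M) S q o (n - j)
    (bestFirst M.P M.D S A j).1 (bestFirst M.P M.D S A j).2 hj.le).guarded (τ := roundTime n)
    (by omega) hB1 (hw M j 0 0 hM.bounded h0B h0B)
  rw [hM.alive] at hrun₀
  by_cases hjA : j ∈ A
  · rw [ind_mem hjA] at hrun₀
    have hPj : |S + M.P j| ≤ B := by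
      have h1 := Finset.single_le_sum (f := M.P) (fun i _ => hM.nonneg i) hjA
      have h2 := hM.nonneg j
      rw [abs_of_nonneg (by omega)]
      linarith
    obtain ⟨t₁, ht₁, hrun₁⟩ := (localExec_tryBegin n S q o (n - j) (bestFirst M.P M.D S A j).1
      (bestFirst M.P M.D S A j).2 hM.alive hj.le 1).guarded (τ := roundTime n) (by omega) hB1
      (hw M j 0 1 hM.bounded h0B h1B)
    have hinv := hM.withAlive hB1 ((Finset.erase_subset j A).trans hM.subset)
    obtain ⟨M₂, t₂, hrun₂, hinv₂, hframe₂, hT₂, ht₂, ht₂'⟩ := guardedRun_solve_program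
      (R := outerRegs S q o j (n - j) (bestFirst M.P M.D S A j).1 (bestFirst M.P M.D S A j).2
        (S + M.P j)) (Δ := Δ) hB (hreg j _ hPj) hΔ0 (by linarith) hinv (fun i hi => by
          have h1 := hΔ i hi
          have h2 := Finset.add_sum_erase A M.P hjA
          simp only [outerRegs]
          linarith)
    obtain ⟨t₃, ht₃, hrun₃⟩ := (localExec_tryEnd n S q o (n - j) (bestFirst M.P M.D S A j).1
      (bestFirst M.P M.D S A j).2 hinv₂.alive hinv₂.lines hjA hj.le (S + M.P j)).guarded
      (τ := roundTime n) (by omega) hB1 (hw M₂ j _ 0 hinv₂.bounded hPj h0B)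
    have hD₂ : M₂.D = M.D := by rw [hframe₂]
    have hval : M₂.T 0 n + max (S + M.P j - M₂.D j) 0 = firstCost M.P M.D S A j := by
      rw [hT₂, hD₂]
      rfl
    rw [hval] at hrun₃
    have hinv₃ := hinv₂.withAlive hB1 hM.subset
    have hbest : bestFirst M.P M.D S A (j + 1) =
        (if (bestFirst M.P M.D S A j).1 < 0 ∨
            firstCost M.P M.D S A j < (bestFirst M.P M.D S A j).1 then firstCost M.P M.D S A j
          else (bestFirst M.P M.D S A j).1,
         if (bestFirst M.P M.D S A j).1 < 0 ∨
            firstCost M.P M.D S A j < (bestFirst M.P M.D S A j).1 then j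
          else (bestFirst M.P M.D S A j).2) := by
      simp only [bestFirst, hjA, true_and]
      split_ifs <;> rfl
    have hrun₃' : GuardedRun (guard n B) [tryEnd] []
        (mkState n (outerRegs S q o j (n - j) (bestFirst M.P M.D S A j).1
          (bestFirst M.P M.D S A j).2 (S + M.P j)) M₂)
        (mkState n (outerRegs S q o j (n - j) (bestFirst M.P M.D S A (j + 1)).1
          (bestFirst M.P M.D S A (j + 1)).2 0) { M₂ with A := ind A }) t₃ := by
      rw [hbest]
      simp only
      push_cast
      exact hrun₃
    obtain ⟨t₄, ht₄, hrun₄⟩ := (localExec_tryNext n (M := { M₂ with A := ind A }) S q o (n - j)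
      (bestFirst M.P M.D S A (j + 1)).1 (bestFirst M.P M.D S A (j + 1)).2 j 0).guarded
      (τ := roundTime n) (by omega) hB1 (hw _ (j + 1) 0 0 hinv₃.bounded h0B h0B)
    refine ⟨{ M₂ with A := ind A }, _, GuardedRun.seq hrun₀ (GuardedRun.seq
      (GuardedRun.cond_pos (by simp) (GuardedRun.seq hrun₁ (GuardedRun.seq hrun₂ hrun₃'
        (hg _ j _ 0 hinv.bounded hPj h0B)) (hg M j 0 1 hM.bounded h0B h1B))
        (hg M j 0 1 hM.bounded h0B h1B)) hrun₄ (hg M j 0 1 hM.bounded h0B h1B))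
      (hg M j 0 0 hM.bounded h0B h0B), hinv₃, ?_, ?_, fun hanti _ => ?_⟩
    · rw [hframe₂]
      simp only [← hM.alive]
    · have : 5 * 2 ^ n * (roundTime n + 1) =
        4 * 2 ^ n * (roundTime n + 1) + 2 ^ n * (roundTime n + 1) := by ring
      have : 2 * 2 ^ n * (roundTime n + 1) = 2 * (2 ^ n * (roundTime n + 1)) := by ring
      have h5 : 1000 ≤ 2 ^ n * (roundTime n + 1) := by
        have h6 := Nat.one_le_two_pow (n := n)
        have h7 := le_roundTime (n := n) (a := 1000) (b := 0) (c := 0) (d := 0) (by norm_num)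
        nlinarith
      omega
    · have := ht₂' hanti
      rw [Finset.card_erase_of_mem hjA] at this
      omega
  · rw [ind_not_mem hjA] at hrun₀
    have hskip : LocalExec (memSize n) skip
        (mkState n { outerRegs S q o j (n - j) (bestFirst M.P M.D S A j).1
          (bestFirst M.P M.D S A j).2 0 with y := 0 } M)
        (mkState n { outerRegs S q o j (n - j) (bestFirst M.P M.D S A j).1
          (bestFirst M.P M.D S A j).2 0 with y := 0 } M) 1 :=
      LocalExec.of_effect (by simp [skip, Straight]) (by simp [skip, effect])
    obtain ⟨t₁, ht₁, hrun₁⟩ := hskip.guarded (τ := roundTime n) (by omega) hB1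
      (hw M j 0 0 hM.bounded h0B h0B)
    have hbest : bestFirst M.P M.D S A (j + 1) = bestFirst M.P M.D S A j := by
      simp only [bestFirst, hjA, false_and, if_false]
    rw [hbest]
    obtain ⟨t₄, ht₄, hrun₄⟩ := (localExec_tryNext n (M := M) S q o (n - j)
      (bestFirst M.P M.D S A j).1 (bestFirst M.P M.D S A j).2 j 0).guarded
      (τ := roundTime n) (by omega) hB1 (hw _ j 0 0 hM.bounded h0B h0B)
    refine ⟨M, _, GuardedRun.seq hrun₀ (GuardedRun.seq
      (GuardedRun.cond_neg (by simp) hrun₁ (hg M j 0 0 hM.bounded h0B h0B)) hrun₄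
      (hg M j 0 0 hM.bounded h0B h0B)) (hg M j 0 0 hM.bounded h0B h0B), hM, rfl, ?_,
      fun _ h => absurd h hjA⟩
    have : 5 * 2 ^ n * (roundTime n + 1) =
        2 * 2 ^ n * (roundTime n + 1) + 3 * 2 ^ n * (roundTime n + 1) := by ring
    omega

theorem localExec_positionBegin (n : ℕ) {M : Mem} (S q o : ℤ) :
    LocalExec (memSize n)
      (block [.const r_best (-1), .const r_bj 0, .const r_j 0, .plus r_cj r_n r_zero])
      (mkState n (outerRegs S q o 0 0 0 0 0) M)
      (mkState n (outerRegs S q o (0 : ℕ) (n - (0 : ℕ)) (-1) (0 : ℕ) 0) M) 20 := by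
  refine LocalExec.mono (LocalExec.of_effect ?_ ?_) (by decide)
  · simp [block, Straight]
  · simp [block, effect, outerRegs]

theorem SolveInv.withOutput {n : ℕ} {B : ℤ} {M : Mem} {A : Finset ℕ} (h : SolveInv n B M A)
    (o : ℕ) {w : ℤ} (hw : |w| ≤ B) :
    SolveInv n B { M with inp := Function.update M.inp o w } A :=
  ⟨h.alive, h.subset, h.lines, h.nonneg, h.mono,
    ⟨fun a ha => by
      change |Function.update M.inp o w a| ≤ B
      rw [Function.update_apply]
      split_ifs
      · exact hw
      · exact h.bounded.inp a ha,
      h.bounded.P, h.bounded.D, h.bounded.I, h.bounded.A, h.bounded.L, h.bounded.B,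
      h.bounded.X, h.bounded.T⟩⟩

/-- A bound for the number of steps for one position. -/
def positionTime (n : ℕ) : ℕ := n * (5 * 2 ^ n * (roundTime n + 1) + 1) + 100

-- The loop over candidates ends with `bestFirst` over all `n` jobs, whose second component is an
-- optimal next job. Each try leaves the job data intact, so the candidates are compared under the
-- same conditions.
open Classical in
theorem guardedRun_positionBody {n : ℕ} {B Δ : ℤ} (hB : (memSize n : ℤ) ≤ B) (hΔ0 : 0 ≤ Δ)
    (hΔB : (n + 1) * Δ ≤ B) {M : Mem} {A : Finset ℕ} (hM : SolveInv n B M A) {S q : ℤ} {o : ℕ}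
    (hS : 0 ≤ S) (hSB : S + ∑ i ∈ A, M.P i ≤ B) (hq : |q| ≤ B) (ho : o < 3 * n)
    (hΔ : ∀ i < n, S + ∑ i ∈ A, M.P i - M.D i ≤ Δ) (hne : A.Nonempty) :
    ∃ j ∈ A, optCost M.P M.D S A = firstCost M.P M.D S A j ∧
    ∃ M' t, GuardedRun (guard n B) [positionBody] []
        (mkState n (outerRegs S q o 0 0 0 0 0) M)
        (mkState n (outerRegs (S + M.P j) (q - 1) (o + 1) 0 0 0 0 0) M') t ∧
      SolveInv n B M' (A.erase j) ∧ M'.P = M.P ∧ M'.D = M.D ∧ M'.I = M.I ∧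
      M'.inp = Function.update M.inp o (M.I j) ∧ t ≤ positionTime n ∧
      ((∀ i j, i < j → j < n → M.P j < M.P i) → 2 ^ (A.card - 1) ≤ t) := by
  have h8 := add_eight_le_memSize n
  have hB1 : 1 ≤ B := by omega
  have h0B : |(0 : ℤ)| ≤ B := by simpa using hB1.trans' zero_le_one
  have hτ := hundred_le_roundTime n
  have habs : ∀ i : ℕ, i ≤ n → |(i : ℤ)| ≤ B := fun i hi => by
    rw [abs_of_nonneg (by omega)]; omega
  have hsum0 : 0 ≤ ∑ i ∈ A, M.P i := Finset.sum_nonneg fun i _ => hM.nonneg i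
  have hS' : |S| ≤ B := by rw [abs_of_nonneg hS]; linarith
  have ho' : |(o : ℤ)| ≤ B := by
    have h1 : o < memSize n := ho.trans_le (Nat.le_add_right _ _)
    rw [abs_of_nonneg (by omega)]
    omega
  have hbf := bestFirst_bounds hM.nonneg hM.subset hΔ0 hΔ hΔB hB1
  obtain ⟨j, hjA, hbest, hopt⟩ := bestFirst_optimal M.P M.D S hM.subset hne
  have hj : j < n := Finset.mem_range.1 (hM.subset hjA)
  have hw0 : WithinBounds (memSize n) B (mkState n (outerRegs S q o 0 0 0 0 0) M) :=
    withinBounds_outerRegs (y := 0) hB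
      (outerBounded_outerRegs hS' hq ho' h0B h0B h0B h0B h0B) hM.bounded h0B
  obtain ⟨t₀, ht₀, hrun₀⟩ := (localExec_positionBegin n (M := M) S q o).guarded (τ := roundTime n)
    (by omega) hB1 hw0
  let Inv : ℕ → RamState → Prop := fun k s => ∃ M', s = mkState n (outerRegs S q o k (n - k)
    (bestFirst M.P M.D S A k).1 (bestFirst M.P M.D S A k).2 0) M' ∧
    SolveInv n B M' A ∧ M' = { M with L := M'.L, B := M'.B, T := M'.T }
  have hInv : ∀ k ≤ n, ∀ s, Inv k s → WithinBounds (memSize n) B s := by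
    rintro k hk s ⟨M', rfl, hM', -⟩
    refine withinBounds_outerRegs (y := 0) hB (outerBounded_outerRegs hS' hq ho' (habs k hk) ?_
      (hbf k).1 (habs _ (hbf k).2) h0B) hM'.bounded h0B
    rw [abs_of_nonneg (by omega)]
    omega
  obtain ⟨s₁, t₁, hl₁, ht₁, hrun₁, M₁, rfl, hM₁, hframe⟩ := GuardedRun.loop (G := guard n B)
    (x := r_cj) (a := tryBody) (N := n) (T := 5 * 2 ^ n * (roundTime n + 1))
    -- The lower bound for a round: exponential when an alive job is tried on a hard instance,
    -- otherwise none.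
    (fun k => if (∀ i j, i < j → j < n → M.P j < M.P i) ∧ k ∈ A then 2 ^ (A.card - 1) else 0) Inv
    (fun k hk s hs => guard_of_withinBounds (by omega) (hInv k hk s hs))
    (by
      rintro k hk s ⟨M', rfl, hM', hframe⟩
      have hP : M'.P = M.P := by rw [hframe]
      have hD : M'.D = M.D := by rw [hframe]
      obtain ⟨M'', t, hrun, hM'', hframe', ht, ht'⟩ := guardedRun_tryBody hB hΔ0 hΔB hM' hS
        (by rwa [hP]) hq ho' (by rwa [hP, hD]) hk
      rw [hP, hD] at hrun
      rw [hP] at ht'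
      refine ⟨by simp [outerRegs]; omega, _, t, ?_, ht, hrun, M'', rfl, hM'', ?_⟩
      · split_ifs with hc
        · exact ht' hc.1 hc.2
        · exact Nat.zero_le _
      · rw [hframe', hframe])
    (by
      rintro s ⟨M', rfl, -, -⟩
      simp [outerRegs])
    (s := mkState n (outerRegs S q o (0 : ℕ) (n - (0 : ℕ)) (-1) (0 : ℕ) 0) M)
    ⟨M, rfl, hM, rfl⟩
  have hP₁ : M₁.P = M.P := by rw [hframe]
  have hD₁ : M₁.D = M.D := by rw [hframe]
  have hI₁ : M₁.I = M.I := by rw [hframe]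
  have hinp₁ : M₁.inp = M.inp := by rw [hframe]
  have hw₁ := hInv n le_rfl _ ⟨M₁, rfl, hM₁, hframe⟩
  obtain ⟨t₂, ht₂, hrun₂⟩ := (localExec_positionEnd n (M := M₁) (j := n) S q ((n : ℤ) - n)
    (bestFirst M.P M.D S A n).1 (b := (bestFirst M.P M.D S A n).2) (o := o) hM₁.alive
    (hbf n).2 ho).guarded (τ := roundTime n) (by omega) hB1 hw₁
  rw [hbest] at hrun₂ hrun₁
  simp only [sub_self] at hrun₂ hrun₁
  have hrun₃ : GuardedRun (guard n B) [positionEnd] []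
      (mkState n (outerRegs S q o n 0 (optCost M.P M.D S A) j 0) M₁)
      (mkState n (outerRegs (S + M.P j) (q - 1) (o + 1) 0 0 0 0 0)
        { M₁ with A := ind (A.erase j), inp := Function.update M₁.inp o (M₁.I j) }) t₂ := by
    rw [← congrFun hP₁ j]
    exact hrun₂
  refine ⟨j, hjA, hopt, _, _, GuardedRun.seq hrun₀ (GuardedRun.seq hrun₁ hrun₃ ?_)
    (guard_of_withinBounds (by omega) hw0),
    (hM₁.withOutput o (hM₁.bounded.I j hj.le)).withAlive hB1
      ((Finset.erase_subset j A).trans hM.subset), hP₁, hD₁, hI₁, ?_, ?_, fun hanti => ?_⟩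
  · exact guard_of_withinBounds (by omega) (hInv 0 (Nat.zero_le n) _ ⟨M, rfl, hM, rfl⟩)
  · simp only [hinp₁, hI₁]
  · rw [positionTime]
    omega
  · have h1 := Finset.single_le_sum (f := fun k => if (∀ i j, i < j → j < n → M.P j < M.P i) ∧ k ∈ A
      then 2 ^ (A.card - 1) else 0) (fun i _ => Nat.zero_le _) (Finset.mem_range.2 hj)
    simp only [hjA, and_true] at h1
    rw [if_pos hanti] at h1
    have := h1.trans (by simpa using hl₁)
    omega

/-- The jobs `l` have been put in the first positions, in this order, and this choice is
optimal. -/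
structure PositionInv (n : ℕ) (B : ℤ) (M₀ M : Mem) (l : List ℕ) : Prop where
  nodup : l.Nodup
  subset : l.toFinset ⊆ Finset.range n
  solve : SolveInv n B M (Finset.range n \ l.toFinset)
  P : M.P = M₀.P
  D : M.D = M₀.D
  I : M.I = M₀.I
  out : ∀ i (h : i < l.length), M.inp (2 * n + i) = M₀.I l[i]
  optimal : seqCost M₀.P M₀.D 0 l +
    optCost M₀.P M₀.D (l.map M₀.P).sum (Finset.range n \ l.toFinset) =
      optCost M₀.P M₀.D 0 (Finset.range n)

theorem PositionInv.card {n : ℕ} {B : ℤ} {M₀ M : Mem} {l : List ℕ} (h : PositionInv n B M₀ M l) :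
    (Finset.range n \ l.toFinset).card = n - l.length := by
  rw [Finset.card_sdiff_of_subset h.subset, List.toFinset_card_of_nodup h.nodup, Finset.card_range]

theorem PositionInv.sum {n : ℕ} {B : ℤ} {M₀ M : Mem} {l : List ℕ} (h : PositionInv n B M₀ M l) :
    (l.map M₀.P).sum + ∑ i ∈ Finset.range n \ l.toFinset, M₀.P i = ∑ i ∈ Finset.range n, M₀.P i := by
  rw [← Finset.sum_sdiff h.subset, List.sum_toFinset _ h.nodup, add_comm]

/-- Appending a job that attains the optimum of the rest moves its tardiness from the remaining
optimum to the cost of the prefix, so their sum stays the overall optimum. -/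
theorem PositionInv.snoc {n : ℕ} {B : ℤ} {M₀ M M' : Mem} {l : List ℕ} (h : PositionInv n B M₀ M l)
    {j : ℕ} (hj : j ∈ Finset.range n \ l.toFinset)
    (hopt : optCost M₀.P M₀.D (l.map M₀.P).sum (Finset.range n \ l.toFinset) =
      firstCost M₀.P M₀.D (l.map M₀.P).sum (Finset.range n \ l.toFinset) j)
    (hM' : SolveInv n B M' ((Finset.range n \ l.toFinset).erase j)) (hP : M'.P = M.P)
    (hD : M'.D = M.D) (hI : M'.I = M.I)
    (hinp : M'.inp = Function.update M.inp (2 * n + l.length) (M.I j)) :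
    PositionInv n B M₀ M' (l ++ [j]) := by
  have hset : Finset.range n \ (l ++ [j]).toFinset = (Finset.range n \ l.toFinset).erase j := by
    ext i
    simp only [Finset.mem_sdiff, Finset.mem_erase, List.mem_toFinset, List.mem_append,
      List.mem_singleton]
    tauto
  simp only [Finset.mem_sdiff, List.mem_toFinset] at hj
  refine ⟨?_, ?_, by rwa [hset], hP.trans h.P, hD.trans h.D, hI.trans h.I, fun i hi => ?_, ?_⟩
  · rw [List.nodup_append']
    exact ⟨h.nodup, List.nodup_singleton j, by simpa using hj.2⟩
  · intro i hi
    simp only [List.mem_toFinset, List.mem_append, List.mem_singleton] at hi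
    rcases hi with hi | rfl
    · exact h.subset (List.mem_toFinset.2 hi)
    · exact hj.1
  · rw [hinp, Function.update_apply]
    simp only [List.length_append, List.length_singleton] at hi
    split_ifs with hc
    · obtain rfl : i = l.length := by omega
      simp [h.I]
    · have hi' : i < l.length := by omega
      rw [h.out i hi', List.getElem_append_left hi']
  · rw [hset, seqCost_append, ← h.optimal, hopt, firstCost]
    simp [seqCost, add_comm, add_left_comm]

-- After `n` rounds no job remains, so the preserved sum of prefix cost and remaining optimum says
-- that the sequence written out is optimal.
open Classical in
theorem guardedRun_positionLoop {n : ℕ} {B Δ : ℤ} (hB : (memSize n : ℤ) ≤ B) (hΔ0 : 0 ≤ Δ)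
    (hΔB : (n + 1) * Δ ≤ B) {M : Mem} (hM : SolveInv n B M (Finset.range n))
    (hSB : ∑ i ∈ Finset.range n, M.P i ≤ B)
    (hΔ : ∀ i < n, ∑ i ∈ Finset.range n, M.P i - M.D i ≤ Δ) :
    ∃ l s' t, Enumerates (Finset.range n) l ∧
      seqCost M.P M.D 0 l = optCost M.P M.D 0 (Finset.range n) ∧
      (∀ i (h : i < l.length), s'.mem (2 * n + i) = M.I l[i]) ∧ guard n B s' ∧
      GuardedRun (guard n B) [.loop r_pos positionBody] []
        (mkState n { pos := n, op := 2 * n } M) s' t ∧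
      t ≤ n * (positionTime n + 1) + 1 ∧
      ((∀ i j, i < j → j < n → M.P j < M.P i) → 0 < n → 2 ^ (n - 1) ≤ t) := by
  have h8 := add_eight_le_memSize n
  have hB1 : 1 ≤ B := by omega
  have h0B : |(0 : ℤ)| ≤ B := by simpa using hB1.trans' zero_le_one
  let Inv : ℕ → RamState → Prop := fun r s => ∃ l M', l.length = r ∧ PositionInv n B M M' l ∧
    s = mkState n (outerRegs (l.map M.P).sum (n - r) ((2 * n + r : ℕ) : ℤ) 0 0 0 0 0) M'
  have hstart : ∀ {M' : Mem} {l : List ℕ}, PositionInv n B M M' l → (l.map M.P).sum ≤ B := by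
    intro M' l h
    have h1 := h.sum
    have h2 : 0 ≤ ∑ i ∈ Finset.range n \ l.toFinset, M.P i :=
      Finset.sum_nonneg fun i _ => hM.nonneg i
    linarith
  have hG : ∀ r ≤ n, ∀ s, Inv r s → guard n B s := by
    rintro r hr s ⟨l, M', -, hI, rfl⟩
    refine guard_of_withinBounds (by omega) (withinBounds_outerRegs (y := 0) hB
      (outerBounded_outerRegs ?_ ?_ ?_ h0B h0B h0B h0B h0B) hI.solve.bounded h0B)
    · change |(l.map M.P).sum| ≤ B
      rw [abs_of_nonneg (sum_map_nonneg hM.nonneg l)]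
      exact hstart hI
    · rw [abs_of_nonneg (by omega)]
      omega
    · have : 3 * n ≤ memSize n := Nat.le_add_right _ _
      change |((2 * n + r : ℕ) : ℤ)| ≤ B
      push_cast
      rw [abs_of_nonneg (by omega)]
      omega
  obtain ⟨s', t, hl, ht, hrun, hI⟩ := GuardedRun.loop (G := guard n B) (x := r_pos)
    (a := positionBody) (N := n) (T := positionTime n)
    (fun r => if (∀ i j, i < j → j < n → M.P j < M.P i) then 2 ^ (n - r - 1) else 0) Inv hG
    (by
      rintro r hr s ⟨l, M', rfl, hI, rfl⟩
      have hS := hI.sum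
      have h0 := sum_map_nonneg hM.nonneg l
      have hne : (Finset.range n \ l.toFinset).Nonempty := by
        rw [← Finset.card_pos, hI.card]
        omega
      obtain ⟨j, hj, hopt, M'', t, hrun, hM'', hP, hD, hI', hinp, ht, ht'⟩ :=
        guardedRun_positionBody hB hΔ0 hΔB hI.solve (S := (l.map M.P).sum) (q := n - l.length)
          (o := 2 * n + l.length) h0 (by rw [hI.P, hS]; exact hSB)
          (by rw [abs_of_nonneg (by omega)]; omega) (by omega)
          (by rw [hI.P, hI.D, hS]; exact hΔ) hne
      rw [hI.P, hI.D] at hopt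
      rw [hI.P] at hrun ht'
      refine ⟨by simp [outerRegs]; omega, _, t, ?_, ht, hrun, l ++ [j], M'', by simp,
        hI.snoc hj hopt hM'' hP hD hI' hinp, ?_⟩
      · split_ifs with hc
        · rw [← hI.card]
          exact ht' hc
        · exact Nat.zero_le _
      · simp [sub_sub, add_assoc])
    (by
      rintro s ⟨l, M', -, -, rfl⟩
      simp [outerRegs])
    (s := mkState n { pos := n, op := 2 * n } M)
    ⟨[], M, rfl, ⟨List.nodup_nil, by simp, by simpa using hM, rfl, rfl, rfl, by simp,
      by simp [seqCost]⟩, by simp [outerRegs]⟩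
  have hGs := hG n le_rfl _ hI
  obtain ⟨l, M', hln, hI, rfl⟩ := hI
  have hset : Finset.range n \ l.toFinset = ∅ := by
    rw [← Finset.card_eq_zero, hI.card]
    omega
  refine ⟨l, _, t, ⟨hI.nodup, ?_⟩, ?_, fun i hi => ?_, hGs, hrun, ht, fun hanti hn => ?_⟩
  · exact hI.subset.antisymm (Finset.sdiff_eq_empty_iff_subset.1 hset)
  · have := hI.optimal
    rwa [hset, optCost_empty, add_zero] at this
  · rw [← hI.out i hi]
    exact if_pos (by omega)
  · have h1 := Finset.single_le_sum (f := fun r => if (∀ i j, i < j → j < n → M.P j < M.P i)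
      then 2 ^ (n - r - 1) else 0) (fun i _ => Nat.zero_le _) (Finset.mem_range.2 hn)
    simp only [if_pos hanti] at h1 hl
    exact h1.trans hl

/-! ### Sorting the jobs by due date -/

/-- The number of jobs among the first `c` that precede job `i` in the due date order. -/
def rankUpTo (d : ℕ → ℤ) (i c : ℕ) : ℕ :=
  ((Finset.range c).filter fun j => d j < d i ∨ d j = d i ∧ j < i).card

theorem rankUpTo_succ (d : ℕ → ℤ) (i c : ℕ) :
    rankUpTo d i (c + 1) = rankUpTo d i c + if d c < d i ∨ d c = d i ∧ c < i then 1 else 0 := by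
  rw [rankUpTo, Finset.range_add_one, Finset.filter_insert]
  split_ifs
  · rw [Finset.card_insert_of_notMem (by simp), rankUpTo]
  · rfl

theorem rankUpTo_lt_rankUpTo (d : ℕ → ℤ) {i j n : ℕ} (hj : j < n)
    (h : d j < d i ∨ d j = d i ∧ j < i) : rankUpTo d j n < rankUpTo d i n := by
  refine Finset.card_lt_card (Finset.ssubset_iff_of_subset ?_ |>.2 ⟨j, ?_, ?_⟩)
  · intro k hk
    simp only [Finset.mem_filter] at hk ⊢
    refine ⟨hk.1, ?_⟩
    omega
  · simp [hj, h]
  · simp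

theorem rankUpTo_lt (d : ℕ → ℤ) {i n : ℕ} (hi : i < n) : rankUpTo d i n < n := by
  have : (Finset.range n).filter (fun j => d j < d i ∨ d j = d i ∧ j < i) ⊂ Finset.range n :=
    (Finset.ssubset_iff_of_subset (Finset.filter_subset _ _)).2 ⟨i, by simp [hi], by simp⟩
  simpa [rankUpTo] using Finset.card_lt_card this

/-- Breaking ties by job number makes the order total, so different jobs have different ranks and
the copies of two jobs never collide. -/
theorem rankUpTo_injOn (d : ℕ → ℤ) (n : ℕ) :
    Set.InjOn (fun i => rankUpTo d i n) (Finset.range n : Set ℕ) := by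
  intro i hi j hj h
  simp only [Finset.coe_range, Set.mem_Iio] at hi hj
  by_contra hne
  rcases lt_trichotomy (d i) (d j) with hd | hd | hd
  · exact (rankUpTo_lt_rankUpTo d hi (Or.inl hd)).ne h
  · rcases Nat.lt_or_gt_of_ne hne with hij | hij
    · exact (rankUpTo_lt_rankUpTo d hi (Or.inr ⟨hd, hij⟩)).ne h
    · exact (rankUpTo_lt_rankUpTo d hj (Or.inr ⟨hd.symm, hij⟩)).ne' h
  · exact (rankUpTo_lt_rankUpTo d hj (Or.inl hd)).ne' h

theorem exists_rankUpTo_eq (d : ℕ → ℤ) {n r : ℕ} (hr : r < n) : ∃ i < n, rankUpTo d i n = r := by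
  have h := Finset.surj_on_of_inj_on_of_card_le (s := Finset.range n) (t := Finset.range n)
    (fun i _ => rankUpTo d i n)
    (fun i hi => Finset.mem_range.2 (rankUpTo_lt d (Finset.mem_range.1 hi)))
    (fun i j hi hj hij => rankUpTo_injOn d n (by simpa using hi) (by simpa using hj) hij)
    le_rfl r (Finset.mem_range.2 hr)
  obtain ⟨i, hi, h⟩ := h
  exact ⟨i, Finset.mem_range.1 hi, h.symm⟩

theorem dueDate_le_of_rankUpTo_le (d : ℕ → ℤ) {i j n : ℕ} (hj : j < n)
    (h : rankUpTo d i n ≤ rankUpTo d j n) : d i ≤ d j := by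
  by_contra! hd
  exact (rankUpTo_lt_rankUpTo d hj (Or.inl hd)).not_ge h

/-- The array in which `g 0, …, g (i - 1)` have been written to the cells `f 0, …, f (i - 1)`. -/
def scatter (f : ℕ → ℕ) (g : ℕ → ℤ) : ℕ → ℕ → ℤ
  | 0 => fun _ => 0
  | i + 1 => Function.update (scatter f g i) (f i) (g i)

/-- Injectivity of the positions guarantees that no later write destroys an earlier one. -/
theorem scatter_apply {f : ℕ → ℕ} {g : ℕ → ℤ} {n : ℕ}
    (hf : Set.InjOn f (Finset.range n : Set ℕ)) {i : ℕ} (hi : i < n) :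
    scatter f g n (f i) = g i := by
  have key : ∀ k ≤ n, i < k → scatter f g k (f i) = g i := by
    intro k hk hik
    induction k with
    | zero => omega
    | succ k ih =>
      rw [scatter, Function.update_apply]
      split_ifs with h
      · have : i = k := hf (by simpa using hi) (by simp; omega) h
        rw [this]
      · refine ih (by omega) ?_
        rcases Nat.lt_succ_iff_lt_or_eq.1 hik with h' | rfl
        · exact h'
        · exact absurd rfl h
  exact key n le_rfl hi

theorem scatter_eq_zero_or (f : ℕ → ℕ) (g : ℕ → ℤ) (n r : ℕ) :
    scatter f g n r = 0 ∨ ∃ i < n, scatter f g n r = g i := by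
  induction n with
  | zero => exact Or.inl rfl
  | succ n ih =>
    rw [scatter, Function.update_apply]
    split_ifs
    · exact Or.inr ⟨n, by omega, rfl⟩
    · rcases ih with h | ⟨i, hi, h⟩
      · exact Or.inl h
      · exact Or.inr ⟨i, by omega, h⟩

theorem toNat_add_natCast (n c : ℕ) : ((n : ℤ) + (c : ℤ)).toNat = n + c := by omega

theorem localExec_rankBody (n : ℕ) {M : Mem} {i c : ℕ} (ci x k : ℤ) (hc : c < n) :
    LocalExec (memSize n) rankBody
      (mkState n { i := i, ci := ci, x := x, dl := M.inp (n + i), c := c, cc := k } M)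
      (mkState n {
        i := i, ci := ci,
        x := x + if M.inp (n + c) < M.inp (n + i) ∨ M.inp (n + c) = M.inp (n + i) ∧ c < i
          then 1 else 0,
        dl := M.inp (n + i), c := c + 1, cc := k - 1 } M) 40 := by
  have h3 : n + c < 3 * n := by omega
  refine LocalExec.mono (LocalExec.of_effect ?_ ?_) (show rankBody.nodes ≤ 40 by decide)
  · simp [rankBody, block, Straight, skip]
  · by_cases h : c < i
    · by_cases h' : M.inp (n + c) ≤ M.inp (n + i)
      · have e1 : 0 < M.inp (n + i) - M.inp (n + c) + 1 := by omega
        have e2 := le_iff_lt_or_eq.1 h'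
        simp [rankBody, block, effect, skip, toNat_add_natCast, h3, h, e1, e2]
      · have e1 : ¬ 0 < M.inp (n + i) - M.inp (n + c) + 1 := by omega
        have e2 : ¬ (M.inp (n + c) < M.inp (n + i) ∨ M.inp (n + c) = M.inp (n + i)) := by omega
        simp [rankBody, block, effect, skip, toNat_add_natCast, h3, h, e1, e2]
    · by_cases h' : M.inp (n + c) < M.inp (n + i) <;>
      simp [rankBody, block, effect, skip, toNat_add_natCast, h3, h, h']

/-- The memory after the first `i` jobs have been copied. -/
def sortedMem (n : ℕ) (inp : ℕ → ℤ) (i : ℕ) : Mem where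
  inp := inp
  P := scatter (fun i => rankUpTo (fun j => inp (n + j)) i n) inp i
  D := scatter (fun i => rankUpTo (fun j => inp (n + j)) i n) (fun j => inp (n + j)) i
  I := scatter (fun i => rankUpTo (fun j => inp (n + j)) i n) (fun j => (j : ℤ)) i
  A := ind (Finset.range i)
  L := fun _ => 0
  B := fun _ => 0
  X := fun _ => 0
  T := fun _ _ => 0

theorem localExec_placeBody (n : ℕ) (inp : ℕ → ℤ) {i : ℕ} (k : ℤ) (hi : i < n) :
    LocalExec (memSize n) placeBody
      (mkState n { i := i, ci := k } (sortedMem n inp i))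
      (mkState n { i := i + 1, ci := k - 1 } (sortedMem n inp (i + 1))) (200 * (n + 1)) := by
  have hloop := LocalExec.loop (m := memSize n) (x := r_cc) (a := rankBody) (N := n) (T := 40)
    (fun c => mkState n {
      i := i, ci := k, x := rankUpTo (fun j => inp (n + j)) i c, dl := inp (n + i), c := c,
      cc := n - (c : ℕ) } (sortedMem n inp i))
    (fun c hc => by simp; omega)
    (fun c hc => by
      have := localExec_rankBody n (M := sortedMem n inp i) (i := i) k
        (rankUpTo (fun j => inp (n + j)) i c) (n - (c : ℕ)) hc
      refine this.congr rfl ?_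
      by_cases h : inp (n + c) < inp (n + i) ∨ inp (n + c) = inp (n + i) ∧ c < i <;>
      simp [rankUpTo_succ, sub_sub, sortedMem, h])
    (by simp)
  have hr := (rankUpTo_lt (fun j => inp (n + j)) hi).le
  have h3 : n + i < 3 * n := by omega
  have h3' : i < 3 * n := by omega
  refine ((LocalExec.of_effect ?_ ?_).seq (hloop.seq (LocalExec.of_effect ?_ ?_))).mono ?_
  · simp [block, Straight]
  · simp [block, effect, toNat_add_natCast, h3, rankUpTo, sortedMem]
  · simp [block, Straight, effect, hr, hi.le, cellBase_add_lt, h3']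
  · simp [block, effect, hr, hi.le, h3', sortedMem, scatter, update_ind_one, Finset.range_add_one]
  · simp only [nodes, block]
    nlinarith

/-- The memory after all jobs have been copied and `k` line pointers have been set. -/
def preparedMem (n : ℕ) (inp : ℕ → ℤ) (k : ℕ) : Mem :=
  { sortedMem n inp n with X := fun u => if u < k then cellBase n (u + 7) else 0 }

theorem localExec_linePointerBody (n : ℕ) (inp : ℕ → ℤ) {i : ℕ} (k : ℤ) (hi : i ≤ n) :
    LocalExec (memSize n) linePointerBody
      (mkState n { i := i, ci := k, y := cellBase n (i + 7) } (preparedMem n inp i))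
      (mkState n { i := i + 1, ci := k - 1, y := cellBase n (i + 8) }
        (preparedMem n inp (i + 1))) 20 := by
  refine LocalExec.mono (LocalExec.of_effect ?_ ?_) (show linePointerBody.nodes ≤ 20 by decide)
  · simp [linePointerBody, block, Straight, effect, hi, cellBase_add_lt]
  · have e : cellBase n (i + 7) + ((n : ℤ) + 1) = cellBase n (i + 8) := by
      simp only [cellBase]; push_cast; ring
    simp only [linePointerBody, block, effect, reg_rX, reg_rw, reg_i, reg_ci, reg_y, reg_z,
      reg_rOne, setReg_i, setReg_ci, setReg_y, setReg_z, setReg_rZero, setMem_X _ _ _ _ hi,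
      e, preparedMem]
    congr 2
    funext u
    rw [Function.update_apply]
    by_cases h : u = i
    · simp [h]
    · rw [if_neg h]
      exact if_congr (by omega) rfl rfl

theorem localExec_prepare (n : ℕ) (inp : ℕ → ℤ) :
    LocalExec (memSize n) prepare (mkState n {} (sortedMem n inp 0))
      (mkState n { pos := n, op := 2 * n } (preparedMem n inp (n + 1))) (300 * (n + 1) ^ 2) := by
  have hplace := LocalExec.loop (m := memSize n) (x := r_ci) (a := placeBody) (N := n)
    (T := 200 * (n + 1))
    (fun i => mkState n { i := i, ci := n - (i : ℕ) } (sortedMem n inp i))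
    (fun i hi => by simp; omega)
    (fun i hi => by
      refine (localExec_placeBody n inp (n - (i : ℕ)) hi).congr rfl ?_
      simp [sub_sub])
    (by simp)
  have hline := LocalExec.loop (m := memSize n) (x := r_ci) (a := linePointerBody) (N := n + 1)
    (T := 20)
    (fun i => mkState n { i := i, ci := n + 1 - (i : ℕ), y := cellBase n (i + 7) }
      (preparedMem n inp i))
    (fun i hi => by simp; omega)
    (fun i hi => by
      refine (localExec_linePointerBody n inp (n + 1 - (i : ℕ)) (by omega)).congr rfl ?_
      simp [sub_sub, add_right_comm])
    (by simp)
  have e : cellBase n 6 + ((n : ℤ) + 1) = cellBase n 7 := by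
    simp only [cellBase]; push_cast; ring
  refine ((LocalExec.of_effect ?_ ?_).seq (hplace.seq ((LocalExec.of_effect ?_ ?_).seq
    (hline.seq (LocalExec.of_effect ?_ ?_))))).mono ?_
  · simp [Straight]
  · simp [effect]
  · simp [block, Straight]
  · simp [block, effect, e, preparedMem, sortedMem]
  · simp [block, Straight]
  · simp [block, effect, two_mul]
  · simp only [nodes, block]
    nlinarith

/-- Nothing is required of register `1`: it may hold the parameter `k` and is overwritten by the
constant `1`. The same program thus serves with or without a parameter. -/
theorem localExec_initConstants {n : ℕ} {s : RamState} {M : Mem} (hn : s.reg 0 = n)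
    (hs : ∀ r, 2 ≤ r → s.reg r = 0) (hM : s.mem = M.toFun n) :
    LocalExec (memSize n) initConstants s (mkState n {} M) 40 := by
  refine LocalExec.mono (LocalExec.of_effect ?_ ?_) (show initConstants.nodes ≤ 40 by decide)
  · simp [initConstants, block, Straight]
  · have hlist : Regs.toList n {} = [(n : ℤ), 1, 0, cellBase n 0, cellBase n 1, cellBase n 2,
        cellBase n 3, cellBase n 4, cellBase n 5, cellBase n 6, (n : ℤ) + 1] ++
        List.replicate 28 0 := rfl
    simp only [initConstants, block, effect, RamState.setReg, mkState, RamState.mk.injEq]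
    refine ⟨?_, hM⟩
    funext r
    by_cases hr : r < 11
    · interval_cases r <;> simp [Function.update_apply, hn, hs, cellBase, Regs.toList] <;> ring
    · rw [hlist, List.getD_append_right _ _ _ _ (by simp; omega)]
      have h0 : ∀ q, (List.replicate 28 (0 : ℤ)).getD q 0 = 0 := fun q => by
        simp only [List.getD, List.getElem?_replicate]
        split_ifs <;> rfl
      simp only [Function.update_apply, h0]
      rw [if_neg (by omega), if_neg (by omega), if_neg (by omega), if_neg (by omega),
        if_neg (by omega), if_neg (by omega), if_neg (by omega), if_neg (by omega),
        if_neg (by omega), if_neg (by omega), if_neg (by omega)]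
      exact hs r (by omega)

/-! ### From the sorted memory back to the instance -/

theorem seqCost_ofFn {ι : Type*} (p d : ι → ℤ) (t : ℤ) {n : ℕ} (f : Fin n → ι) :
    seqCost p d t (List.ofFn f) =
      ∑ i, max (t + ∑ j ∈ Finset.univ.filter (fun j => j ≤ i), p (f j) - d (f i)) 0 := by
  induction n generalizing t with
  | zero => simp [seqCost]
  | succ n ih =>
    rw [List.ofFn_succ, seqCost, ih, Fin.sum_univ_succ]
    congr 1
    · congr 2
      simp [Finset.sum_filter, Fin.sum_univ_succ]
    · refine Finset.sum_congr rfl fun i _ => ?_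
      congr 2
      simp [Finset.sum_filter, Fin.sum_univ_succ, add_assoc]

/-- The input cells. -/
def input {n : ℕ} (I : TardinessInstance n) (a : ℕ) : ℤ := (initState [] I).mem a

section Input

variable {n : ℕ} (I : TardinessInstance n)

theorem input_p (i : Fin n) : input I i = I.p i := by simp [input, initState]

theorem input_d (i : Fin n) : input I (n + i) = I.d i := by simp [input, initState]

theorem input_eq_zero {a : ℕ} (ha : 2 * n ≤ a) : input I a = 0 := by
  rw [input, initState]
  simp only
  rw [dif_neg (by omega), dif_neg (by omega)]

/-- The position of a job in the due date order. -/
def rank (i : ℕ) : ℕ := rankUpTo (fun j => input I (n + j)) i n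

theorem rank_lt {i : ℕ} (hi : i < n) : rank I i < n := rankUpTo_lt _ hi

theorem rank_injOn : Set.InjOn (rank I) (Finset.range n : Set ℕ) := rankUpTo_injOn _ n

theorem exists_rank_eq {r : ℕ} (hr : r < n) : ∃ i < n, rank I i = r := exists_rankUpTo_eq _ hr

/-- The memory at the beginning of the search. -/
def searchMem : Mem := preparedMem n (input I) (n + 1)

theorem searchMem_P {i : ℕ} (hi : i < n) : (searchMem I).P (rank I i) = input I i :=
  scatter_apply (rank_injOn I) hi

theorem searchMem_D {i : ℕ} (hi : i < n) : (searchMem I).D (rank I i) = input I (n + i) :=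
  scatter_apply (rank_injOn I) hi

theorem searchMem_I {i : ℕ} (hi : i < n) : (searchMem I).I (rank I i) = i :=
  scatter_apply (rank_injOn I) hi

/-- The sum of the numbers in the instance. -/
def weight : ℕ := ∑ i, (I.p i + (I.d i).natAbs)

theorem abs_input_le (a : ℕ) : |input I a| ≤ weight I := by
  have key : ∀ i : Fin n, I.p i + (I.d i).natAbs ≤ weight I := fun i =>
    Finset.single_le_sum (f := fun i => I.p i + (I.d i).natAbs) (fun _ _ => Nat.zero_le _)
      (Finset.mem_univ i)
  by_cases h : a < n
  · have := key ⟨a, h⟩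
    rw [input_p I ⟨a, h⟩, Nat.abs_cast]
    omega
  · by_cases h' : a - n < n
    · have := key ⟨a - n, h'⟩
      have e := input_d I ⟨a - n, h'⟩
      simp only [Nat.add_sub_cancel' (not_lt.1 h)] at e
      rw [e, Int.abs_eq_natAbs]
      omega
    · rw [input_eq_zero I (by omega)]
      simp

/-- Ranking permutes the job numbers, so sorting does not change the total processing time. -/
theorem sum_searchMem_P : ∑ r ∈ Finset.range n, (searchMem I).P r = ∑ i, (I.p i : ℤ) := by
  calc
    _ = ∑ i ∈ Finset.range n, input I i := by
      symm
      refine Finset.sum_nbij (rank I) ?_ (rank_injOn I) ?_ ?_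
      · exact fun i hi => Finset.mem_range.2 (rank_lt I (Finset.mem_range.1 hi))
      · intro r hr
        obtain ⟨i, hi, h⟩ := exists_rank_eq I (r := r) (by simpa using hr)
        exact ⟨i, by simpa using hi, h⟩
      · exact fun i hi => (searchMem_P I (Finset.mem_range.1 hi)).symm
    _ = _ := by
      rw [Finset.sum_range]
      exact Finset.sum_congr rfl fun i _ => input_p I i

theorem sum_p_add_abs_d_le (i : Fin n) : ∑ i, (I.p i : ℤ) + |I.d i| ≤ weight I := by
  have h : (I.d i).natAbs ≤ ∑ i, (I.d i).natAbs :=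
    Finset.single_le_sum (f := fun i => (I.d i).natAbs) (fun _ _ => Nat.zero_le _)
      (Finset.mem_univ i)
  rw [weight, Finset.sum_add_distrib, Int.abs_eq_natAbs]
  push_cast
  have : ((I.d i).natAbs : ℤ) ≤ ((∑ i, (I.d i).natAbs : ℕ) : ℤ) := by exact_mod_cast h
  push_cast at this
  linarith

/-- A bound for the numbers at the beginning of the search. -/
def valueBound (K : ℕ) : ℤ := memSize n + (n + 1) * weight I + K

theorem weight_le_valueBound (K : ℕ) : (weight I : ℤ) ≤ valueBound I K := by
  rw [valueBound]
  have : 0 ≤ (n : ℤ) * weight I := by positivity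
  have : (0 : ℤ) ≤ memSize n := by positivity
  linarith

theorem memSize_le_valueBound (K : ℕ) : (memSize n : ℤ) ≤ valueBound I K := by
  rw [valueBound]
  have : 0 ≤ ((n : ℤ) + 1) * weight I := by positivity
  linarith

theorem solveInv_searchMem (K : ℕ) :
    SolveInv n (valueBound I K) (searchMem I) (Finset.range n) := by
  have h8 := add_eight_le_memSize n
  have hmem := memSize_le_valueBound I K
  have hw := weight_le_valueBound I K
  have h0 : |(0 : ℤ)| ≤ valueBound I K := by rw [abs_zero]; omega
  refine ⟨rfl, subset_rfl, fun u hu => if_pos (by omega), fun i => ?_, fun i j hij hj => ?_,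
    ⟨fun a _ => ?_, fun i _ => ?_, fun i _ => ?_, fun i _ => ?_, fun i _ => ?_, fun i _ => h0,
      fun i _ => h0, fun i hi => ?_, fun u v => ⟨le_rfl, ?_⟩⟩⟩
  · rcases scatter_eq_zero_or (rank I) (input I) n i with h | ⟨j, hj, h⟩
    · exact h.ge
    · change 0 ≤ scatter (rank I) (input I) n i
      rw [h, input_p I ⟨j, hj⟩]
      exact Int.natCast_nonneg _
  · obtain ⟨i', hi', rfl⟩ := exists_rank_eq I (hij.trans_lt hj)
    obtain ⟨j', hj', rfl⟩ := exists_rank_eq I hj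
    rw [searchMem_D I hi', searchMem_D I hj']
    exact dueDate_le_of_rankUpTo_le (fun j => input I (n + j)) hj' hij
  · exact (abs_input_le I a).trans hw
  · change |scatter (rank I) (input I) n i| ≤ _
    rcases scatter_eq_zero_or (rank I) (input I) n i with h | ⟨j, hj, h⟩ <;> rw [h]
    · exact h0
    · exact (abs_input_le I _).trans hw
  · change |scatter (rank I) (fun j => input I (n + j)) n i| ≤ _
    rcases scatter_eq_zero_or (rank I) (fun j => input I (n + j)) n i with h | ⟨j, hj, h⟩ <;>
      rw [h]
    · exact h0
    · exact (abs_input_le I _).trans hw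
  · change |scatter (rank I) (fun j => (j : ℤ)) n i| ≤ _
    rcases scatter_eq_zero_or (rank I) (fun j => (j : ℤ)) n i with h | ⟨j, hj, h⟩ <;> rw [h]
    · exact h0
    · rw [Nat.abs_cast]
      omega
  · exact (abs_ind_le_one _ _).trans (by omega)
  · change |if i < n + 1 then cellBase n (i + 7) else 0| ≤ _
    rw [if_pos (by omega)]
    exact abs_cellBase_le hmem (by omega)
  · change (0 : ℤ) ≤ _
    omega

/-- Ranks are a bijective renaming of the jobs, under which lists of ranks correspond to
permutations of equal cost. An optimal list therefore translates, through the stored job numbers,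
into an optimal permutation. -/
theorem optimal_of_seqCost_eq {l : List ℕ} (hl : Enumerates (Finset.range n) l)
    (hopt : seqCost (searchMem I).P (searchMem I).D 0 l =
      optCost (searchMem I).P (searchMem I).D 0 (Finset.range n)) :
    ∃ σ : Equiv.Perm (Fin n), I.IsOptimal σ ∧
      ∀ (i : Fin n) (h : (i : ℕ) < l.length), (searchMem I).I l[i] = ((σ i : ℕ) : ℤ) := by
  have hlen : l.length = n := by
    rw [← List.toFinset_card_of_nodup hl.1, hl.2, Finset.card_range]
  -- Stated for arbitrary maps, so that it applies to `f` before `f` is known to be a permutation.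
  have hcost : ∀ σ : Fin n → Fin n, seqCost (searchMem I).P (searchMem I).D 0
      ((List.ofFn σ).map fun i : Fin n => rank I i) =
      ∑ i, max (∑ j ∈ Finset.univ.filter (fun j => j ≤ i), (I.p (σ j) : ℤ) - I.d (σ i)) 0 := by
    intro σ
    rw [seqCost_map, seqCost_ofFn]
    refine Finset.sum_congr rfl fun i _ => ?_
    simp only [Function.comp_apply, searchMem_P I (σ _).2, searchMem_D I (σ _).2, input_p, input_d,
      zero_add]
  have hmem : ∀ i : Fin n, ∃ j : Fin n, rank I j = l[(i : ℕ)]'(by omega) := fun i => by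
    have : l[(i : ℕ)]'(by omega) ∈ Finset.range n := hl.mem_iff.1 (List.getElem_mem _)
    obtain ⟨j, hj, h⟩ := exists_rank_eq I (Finset.mem_range.1 this)
    exact ⟨⟨j, hj⟩, h⟩
  choose f hf using hmem
  have hinj : Function.Injective f := by
    intro i j h
    have h1 : l[(i : ℕ)]'(by omega) = l[(j : ℕ)]'(by omega) := by rw [← hf, ← hf, h]
    exact Fin.ext ((hl.1.getElem_inj_iff).1 h1)
  have hfl : (List.ofFn f).map (fun i : Fin n => rank I i) = l := by
    refine List.ext_getElem (by simp [hlen]) fun i h1 h2 => ?_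
    simp [hf]
  refine ⟨Equiv.ofBijective f (Finite.injective_iff_bijective.1 hinj), fun τ => ?_, fun i h => ?_⟩
  · have h1 := hcost f
    rw [hfl, hopt] at h1
    have h2 := hcost τ
    have h3 : Enumerates (Finset.range n) ((List.ofFn τ).map fun i : Fin n => rank I i) := by
      have hnodup : ((List.ofFn τ).map fun i : Fin n => rank I i).Nodup := by
        refine List.Nodup.map_on (fun i _ j _ h => ?_) (List.nodup_ofFn.2 τ.injective)
        exact Fin.ext (rank_injOn I (by simp) (by simp) h)
      refine ⟨hnodup, Finset.eq_of_subset_of_card_le (fun r hr => ?_) ?_⟩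
      · simp only [List.mem_toFinset, List.mem_map] at hr
        obtain ⟨i, -, rfl⟩ := hr
        exact Finset.mem_range.2 (rank_lt I i.2)
      · rw [List.toFinset_card_of_nodup hnodup]
        simp
    exact h1.symm.trans_le ((optCost_le _ _ _ h3).trans h2.le)
  · rw [Equiv.ofBijective_apply]
    have := searchMem_I I (f i).2
    rwa [hf] at this

end Input

/-- A bound for the running time of the program. -/
def programTime (n : ℕ) : ℕ := n * (positionTime n + 1) + 300 * (n + 1) ^ 2 + 50

section Program

variable {n : ℕ} (I : TardinessInstance n) (args : List ℕ)

theorem initState_mem : (initState args I).mem = (sortedMem n (input I) 0).toFun n := by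
  funext a
  change input I a = _
  rw [Mem.toFun]
  split_ifs with h h'
  · rfl
  · have hrow : ∀ r, (sortedMem n (input I) 0).row r = fun _ => 0 := fun r => by
      unfold Mem.row
      split <;> rfl
    rw [input_eq_zero I (by omega), hrow]
  · exact input_eq_zero I (by omega)

theorem memBounded_sortedMem_zero (K : ℕ) :
    MemBounded n (valueBound I K) (sortedMem n (input I) 0) := by
  have h0 : |(0 : ℤ)| ≤ valueBound I K := by
    rw [abs_zero]
    exact (Int.natCast_nonneg _).trans (memSize_le_valueBound I K)
  refine ⟨fun a _ => (abs_input_le I a).trans (weight_le_valueBound I K), fun i _ => h0,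
    fun i _ => h0, fun i _ => h0, fun i _ => h0, fun i _ => h0, fun i _ => h0, fun i _ => h0,
    fun u v => ⟨le_rfl, ?_⟩⟩
  rwa [abs_zero] at h0

/-- The complete run, from which correctness, time, space and the lower bound are all read off. At
most one parameter is allowed, since only register `1` is reset; `K` bounds that parameter, which
counts towards the size of the numbers in the registers. The tardiness of any job is at most `weight
I`, which serves as `Δ`. -/
theorem guardedRun_program {K : ℕ} (hlen : args.length ≤ 1) (hK : ∀ k ∈ args, k ≤ K) :
    ∃ (σ : Equiv.Perm (Fin n)) (s' : RamState) (t : ℕ), I.IsOptimal σ ∧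
      (∀ i : Fin n, s'.mem (2 * n + i) = ((σ i : ℕ) : ℤ)) ∧ guard n (valueBound I K) s' ∧
      GuardedRun (guard n (valueBound I K)) [program] [] (initState args I) s' t ∧
      t ≤ programTime n ∧
      ((∀ i j : Fin n, i < j → I.p j < I.p i ∧ I.d i < I.d j) → 0 < n → 2 ^ (n - 1) ≤ t) := by
  have h8 := add_eight_le_memSize n
  have hmem := memSize_le_valueBound I K
  have hw := weight_le_valueBound I K
  have hB1 : 1 ≤ valueBound I K := by omega
  have h0 : |(0 : ℤ)| ≤ valueBound I K := by rw [abs_zero]; omega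
  have hinit : WithinBounds (memSize n) (valueBound I K) (initState args I) := by
    refine ⟨fun a ha => ?_, fun r => ?_, fun a => (abs_input_le I a).trans hw⟩
    · refine input_eq_zero I (le_trans ?_ ha)
      rw [memSize]
      omega
    · change |(((n :: args).getD r 0 : ℕ) : ℤ)| ≤ _
      rw [Nat.abs_cast]
      have hKB : (K : ℤ) ≤ valueBound I K := by
        rw [valueBound]
        exact le_add_of_nonneg_left (by positivity)
      rcases r with _ | r
      · simp only [List.getD_cons_zero]
        omega
      · rw [List.getD_cons_succ]
        by_cases hr : r < args.length
        · rw [List.getD_eq_getElem _ _ hr]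
          have := hK _ (List.getElem_mem hr)
          omega
        · rw [List.getD_eq_default _ _ (by omega)]
          omega
  have hstart : WithinBounds (memSize n) (valueBound I K)
      (mkState n {} (sortedMem n (input I) 0)) :=
    withinBounds_outerRegs (y := 0) hmem
      (outerBounded_outerRegs h0 h0 h0 h0 h0 h0 h0 h0) (memBounded_sortedMem_zero I K) h0
  have hτ : 300 * (n + 1) ^ 2 ≤ roundTime n := by
    rw [roundTime]
    nlinarith [Nat.zero_le n, Nat.zero_le ((n + 1) ^ 2)]
  obtain ⟨t₁, ht₁, hrun₁⟩ := (localExec_initConstants (n := n) (s := initState args I)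
    (M := sortedMem n (input I) 0) (by simp [initState]) (fun r hr => by
      obtain ⟨r, rfl⟩ := Nat.exists_eq_add_of_le' hr
      change (((n :: args).getD (r + 2) 0 : ℕ) : ℤ) = 0
      rw [List.getD_cons_succ, List.getD_eq_default _ _ (by omega), Nat.cast_zero])
    (initState_mem I args)).guarded (τ := roundTime n) (by nlinarith) hB1 hinit
  obtain ⟨t₂, ht₂, hrun₂⟩ := (localExec_prepare n (input I)).guarded hτ hB1 hstart
  have hinv := solveInv_searchMem I K
  have hsum := sum_searchMem_P I
  have hW : ∑ i, (I.p i : ℤ) ≤ weight I := by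
    rw [weight]
    push_cast
    exact Finset.sum_le_sum fun i _ => le_add_of_nonneg_right (abs_nonneg _)
  obtain ⟨l, s', t₃, hl, hcost, hout, hs', hrun₃, ht₃, hlow⟩ := guardedRun_positionLoop hmem
    (Δ := weight I) (Int.natCast_nonneg _) (by rw [valueBound]; omega) hinv
    (by rw [hsum]; exact hW.trans hw) (fun r hr => by
      obtain ⟨i, hi, rfl⟩ := exists_rank_eq I hr
      rw [hsum, searchMem_D I hi, input_d I ⟨i, hi⟩]
      have := sum_p_add_abs_d_le I ⟨i, hi⟩
      have := neg_abs_le (I.d ⟨i, hi⟩)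
      linarith)
  obtain ⟨σ, hσ, hσl⟩ := optimal_of_seqCost_eq I hl hcost
  have hlen' : l.length = n := by
    rw [← List.toFinset_card_of_nodup hl.1, hl.2, Finset.card_range]
  refine ⟨σ, s', _, hσ, fun i => ?_, hs', GuardedRun.seq hrun₁ (GuardedRun.seq hrun₂ hrun₃
    (guard_of_withinBounds (by omega) hstart)) (guard_of_withinBounds (by omega) hinit), ?_,
    fun hJ hn => ?_⟩
  · rw [hout i (by omega), ← hσl i (by omega)]
    rfl
  · rw [programTime]
    omega
  -- With strictly increasing due dates sorting changes nothing, so the processing times also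
  -- decrease strictly in the order seen by the search.
  · have hrank : ∀ i < n, rank I i = i := by
      intro i hi
      have : (Finset.range n).filter (fun j => input I (n + j) < input I (n + i) ∨
          input I (n + j) = input I (n + i) ∧ j < i) = Finset.range i := by
        ext j
        simp only [Finset.mem_filter, Finset.mem_range]
        constructor
        · rintro ⟨hj, h⟩
          by_contra! hij
          rcases hij.lt_or_eq with hij | rfl
          · have := (hJ ⟨i, hi⟩ ⟨j, hj⟩ hij).2
            rw [← input_d, ← input_d] at this
            simp only at this
            omega
          · omega
        · intro hj
          refine ⟨by omega, Or.inl ?_⟩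
          rw [input_d I ⟨i, hi⟩, input_d I ⟨j, hj.trans hi⟩]
          exact (hJ ⟨j, hj.trans hi⟩ ⟨i, hi⟩ hj).2
      rw [rank, rankUpTo, this, Finset.card_range]
    have := hlow (fun i j hij hj => by
      have h1 := searchMem_P I (hij.trans hj)
      have h2 := searchMem_P I hj
      rw [hrank _ (hij.trans hj)] at h1
      rw [hrank _ hj] at h2
      rw [h1, h2, input_p I ⟨i, hij.trans hj⟩, input_p I ⟨j, hj⟩]
      exact_mod_cast (hJ ⟨i, hij.trans hj⟩ ⟨j, hj⟩ hij).1) hn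
    omega

end Program

/-! ### Time and space -/

section Halting

variable {n : ℕ} {A : RamProg} {args : List ℕ} {I : TardinessInstance n} {G : RamState → Prop}
  {s : RamState} {t : ℕ}

theorem run_eq_of_le (h : GuardedRun G [A] [] (initState args I) s t) {t' : ℕ} (ht : t ≤ t') :
    A.run args I t' = ⟨[], s⟩ := by
  obtain ⟨u, rfl⟩ := Nat.exists_eq_add_of_le' ht
  rw [run, Function.iterate_add_apply, show RamConfig.step^[t] ⟨[A], initState args I⟩ = ⟨[], s⟩
    from (h []).1]
  exact Function.iterate_fixed rfl u

/-- A guarded run keeps something to do at every step before `t`, so `t` is the exact halting time.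
The lower bound on hard instances depends on this. -/
theorem haltsWithin_iff (h : GuardedRun G [A] [] (initState args I) s t) {t' : ℕ} :
    A.HaltsWithin args I t' ↔ t ≤ t' := by
  refine ⟨fun ht => ?_, fun ht => by rw [HaltsWithin, run_eq_of_le h ht]⟩
  by_contra! hlt
  have h1 := ((h []).2 t' hlt).1
  rw [HaltsWithin, run] at ht
  simp [ht] at h1

/-- A halted configuration is a fixed point of the step function, so the guard also covers all later
times. -/
theorem guard_run (h : GuardedRun G [A] [] (initState args I) s t) (hs : G s) (t' : ℕ) :
    G (A.run args I t').state := by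
  rcases lt_or_ge t' t with ht | ht
  · exact ((h []).2 t' ht).2
  · rwa [run_eq_of_le h ht]

end Halting

/-- The degree is five: `n` positions, `n` candidates for each, and cubic time for each of the
exponentially many rounds. -/
theorem programTime_le (n : ℕ) : programTime n ≤ 6000 * (n + 1) ^ 5 * 2 ^ n := by
  have h2 : 1 ≤ 2 ^ n := Nat.one_le_two_pow
  have h : n * (n * (5 * (1000 * (n + 1) ^ 3 + 1) + 1) + 101) + 300 * (n + 1) ^ 2 + 50 ≤
      6000 * (n + 1) ^ 5 := by
    ring_nf
    nlinarith [Nat.zero_le (n ^ 2), Nat.zero_le (n ^ 3), Nat.zero_le (n ^ 4), Nat.zero_le (n ^ 5)]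
  refine le_trans ?_ (Nat.mul_le_mul_right _ h)
  rw [programTime, positionTime, roundTime]
  nlinarith [Nat.mul_le_mul_left (n * n) h2, Nat.mul_le_mul_left (n * 101) h2,
    Nat.mul_le_mul_left (300 * (n + 1) ^ 2 + 50) h2]

theorem haltsWithin_programTime {n : ℕ} (I : TardinessInstance n) {args : List ℕ}
    (hlen : args.length ≤ 1) : program.HaltsWithin args I (programTime n) := by
  obtain ⟨-, s, t, -, -, -, hrun, ht, -⟩ := guardedRun_program I args hlen
    (fun k hk => List.single_le_sum (by simp) k hk)
  exact (haltsWithin_iff hrun).2 ht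

theorem solvesTotalTardiness_program {args : List ℕ} (hlen : args.length ≤ 1) :
    program.SolvesTotalTardiness args := by
  intro n I
  obtain ⟨σ, s, t, hσ, hout, -, hrun, -, -⟩ := guardedRun_program I args hlen
    (fun k hk => List.single_le_sum (by simp) k hk)
  refine ⟨t, (haltsWithin_iff hrun).2 le_rfl, σ, hσ, fun i => ?_⟩
  rw [run_eq_of_le hrun le_rfl]
  exact hout i

theorem runsInOStar_program {args : List ℕ} (hlen : args.length ≤ 1) {c : ℝ} (hc : 2 ≤ c) :
    program.RunsInOStar args c := by
  refine ⟨6000 * (Polynomial.X + 1) ^ 5, fun n I =>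
    ⟨_, haltsWithin_programTime I hlen, ?_⟩⟩
  have h1 : (programTime n : ℝ) ≤ ((6000 * (n + 1) ^ 5 * 2 ^ n : ℕ) : ℝ) := by
    exact_mod_cast programTime_le n
  have h2 : (2 : ℝ) ^ n ≤ c ^ n := pow_le_pow_left₀ (by norm_num) hc n
  refine h1.trans ?_
  simp only [Polynomial.eval_mul, Polynomial.eval_pow, Polynomial.eval_add, Polynomial.eval_X,
    Polynomial.eval_one, Polynomial.eval_ofNat]
  push_cast
  gcongr

/-- An instance on which the program needs exponential time. -/
def hardInstance (n : ℕ) : TardinessInstance n where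
  p i := n - i
  d i := (i : ℕ)

/-- One hard instance for each `n` is compared with all instances: it needs at least `2 ^ (n - 1)`
steps, while no instance needs more than `6000 * (n + 1) ^ 5 * 2 ^ n`. The missing factor two makes
the constant `12000`. -/
theorem worstCase_program {args : List ℕ} (hlen : args.length ≤ 1) :
    program.WorstCaseLPTEqEDD args := by
  refine ⟨12000 * (Polynomial.X + 1) ^ 5, fun n I => ⟨hardInstance n, ⟨1, ?_, ?_⟩, fun t ht => ?_⟩⟩
  · intro i j hij
    refine Or.inl ?_
    simp only [hardInstance, Equiv.Perm.coe_one, id]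
    have : (i : ℕ) < j := hij
    omega
  · intro i j hij
    refine Or.inl ?_
    simp only [hardInstance, Equiv.Perm.coe_one, id]
    have : (i : ℕ) < j := hij
    omega
  · obtain ⟨-, s, u, -, -, -, hrun, -, hlow⟩ := guardedRun_program (hardInstance n) args hlen
      (fun k hk => List.single_le_sum (by simp) k hk)
    have hut := (haltsWithin_iff hrun).1 ht
    obtain ⟨-, s', v, -, -, -, hrun', hv, -⟩ := guardedRun_program I args hlen
      (fun k hk => List.single_le_sum (by simp) k hk)
    refine (haltsWithin_iff hrun').2 (hv.trans ((programTime_le n).trans ?_))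
    simp only [Polynomial.eval_mul, Polynomial.eval_pow, Polynomial.eval_add, Polynomial.eval_X,
      Polynomial.eval_one, Polynomial.eval_ofNat]
    have h2 : 2 ^ n ≤ 2 * t := by
      -- The lower bound is void for `n = 0`; there it suffices that the program has not halted
      -- before its first step.
      rcases Nat.eq_zero_or_pos n with rfl | hn
      · have : t ≠ 0 := by
          rintro rfl
          simp [HaltsWithin, run] at ht
        rw [pow_zero]
        omega
      · have := hlow (fun i j hij => by
          have : (i : ℕ) < j := hij
          simp only [hardInstance]
          omega) hn
        obtain ⟨m, rfl⟩ := Nat.exists_eq_add_of_le' hn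
        rw [Nat.add_sub_cancel] at this
        rw [pow_succ]
        omega
    calc
      6000 * (n + 1) ^ 5 * 2 ^ n ≤ 6000 * (n + 1) ^ 5 * (2 * t) := Nat.mul_le_mul_left _ h2
      _ = 12000 * (n + 1) ^ 5 * t := by ring

/-! ### Bit lengths and polynomial space -/

theorem weight_le {n : ℕ} (I : TardinessInstance n) :
    weight I ≤ 2 * I.bitSize * 2 ^ I.bitSize := by
  have key : ∀ i, I.p i + (I.d i).natAbs ≤ 2 * 2 ^ I.bitSize := by
    intro i
    have h : Nat.size (I.p i) + Nat.size (I.d i).natAbs ≤ I.bitSize := by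
      refine le_trans ?_ (Nat.le_add_left _ _)
      exact Finset.single_le_sum (f := fun i => Nat.size (I.p i) + Nat.size (I.d i).natAbs)
        (fun _ _ => Nat.zero_le _) (Finset.mem_univ i)
    have h1 := (Nat.lt_size_self (I.p i)).le.trans
      (Nat.pow_le_pow_right (n := 2) (by norm_num) (show Nat.size (I.p i) ≤ I.bitSize by omega))
    have h2 := (Nat.lt_size_self (I.d i).natAbs).le.trans (Nat.pow_le_pow_right (n := 2)
      (by norm_num) (show Nat.size (I.d i).natAbs ≤ I.bitSize by omega))
    omega
  have hn : n ≤ I.bitSize := Nat.le_add_right _ _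
  calc
    weight I ≤ ∑ _i : Fin n, 2 * 2 ^ I.bitSize := Finset.sum_le_sum fun i _ => key i
    _ = n * (2 * 2 ^ I.bitSize) := by simp
    _ ≤ I.bitSize * (2 * 2 ^ I.bitSize) := Nat.mul_le_mul_right _ hn
    _ = _ := by ring

/-- The number of bits that suffice for instances of length `L`. -/
def bitBound (K L : ℕ) : ℕ :=
  roundTime L + (memSize L + (L + 1) * (2 * L) + K + L)

/-- The doublings within a round add `roundTime n` bits, and the starting values are a polynomial
times `2 ^ L`; the polynomial factor `x` is absorbed by `x < 2 ^ x`. -/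
theorem two_pow_mul_valueBound_lt {n : ℕ} (I : TardinessInstance n) (K : ℕ) :
    2 ^ roundTime n * valueBound I K < 2 ^ bitBound K I.bitSize := by
  have hn : n ≤ I.bitSize := Nat.le_add_right _ _
  set L := I.bitSize with hL
  have hround : roundTime n ≤ roundTime L := by
    unfold roundTime
    gcongr
  have hmem : memSize n ≤ memSize L := by
    unfold memSize
    gcongr
  have h2 : 1 ≤ 2 ^ L := Nat.one_le_two_pow
  have hval : memSize n + (n + 1) * weight I + K ≤
      (memSize L + (L + 1) * (2 * L) + K) * 2 ^ L := by
    have h3 : (n + 1) * weight I ≤ (L + 1) * (2 * L * 2 ^ L) :=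
      Nat.mul_le_mul (by omega) (weight_le I)
    have h4 := Nat.mul_le_mul_left (memSize L) h2
    have h5 := Nat.mul_le_mul_left K h2
    nlinarith
  have hlt : (memSize L + (L + 1) * (2 * L) + K) * 2 ^ L <
      2 ^ (memSize L + (L + 1) * (2 * L) + K + L) := by
    rw [pow_add _ _ L]
    exact Nat.mul_lt_mul_of_pos_right Nat.lt_two_pow_self (by positivity)
  have : 2 ^ roundTime n * (memSize n + (n + 1) * weight I + K) < 2 ^ bitBound K L := by
    rw [bitBound, pow_add]
    exact Nat.mul_lt_mul_of_le_of_lt (Nat.pow_le_pow_right (by norm_num) hround)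
      (hval.trans_lt hlt) (by positivity)
  rw [valueBound]
  exact_mod_cast this

theorem usesPolySpace_program {args : List ℕ} (hlen : args.length ≤ 1) :
    program.UsesPolySpace args := by
  obtain ⟨K, hK⟩ : ∃ K, ∀ k ∈ args, k ≤ K :=
    ⟨args.sum, fun k hk => List.single_le_sum (by simp) k hk⟩
  -- A single polynomial bounds both the bit length and the number of cells in use. It may depend on
  -- the parameter through `K`.
  obtain ⟨q, hq⟩ : ∃ q : Polynomial ℕ, ∀ L, q.eval L = bitBound K L :=
    ⟨1000 * (Polynomial.X + 1) ^ 3 + (3 * Polynomial.X + (Polynomial.X + 8) *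
      (Polynomial.X + 1) + (Polynomial.X + 1) * (2 * Polynomial.X) + Polynomial.C K +
      Polynomial.X), fun L => by simp [bitBound, roundTime, memSize]⟩
  refine ⟨q, fun n I t => ?_⟩
  obtain ⟨-, s, u, -, -, hs, hrun, -, -⟩ := guardedRun_program I args hlen hK
  have hG := guard_run hrun hs t
  have hlt := two_pow_mul_valueBound_lt I K
  have hbits : ∀ v : ℤ, |v| ≤ 2 ^ roundTime n * valueBound I K →
      v.natAbs < 2 ^ bitBound K I.bitSize := by
    intro v hv
    have := hv.trans_lt hlt
    rw [Int.abs_eq_natAbs] at this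
    exact_mod_cast this
  refine ⟨fun a ha => ?_, fun a => ?_, fun r => ?_⟩
  · rw [hq, bitBound]
    by_contra! hle
    exact ha (hG.1 a (by omega))
  · rw [hq]
    exact hbits _ (hG.2.2 a)
  · rw [hq]
    exact hbits _ (hG.2.1 r)

/-- The time bound, with a shift `N` that makes it satisfy the recurrence. -/
def shiftedTime (N n : ℕ) : ℕ := 6000 * (n + N) ^ 5 * 2 ^ n

/-- The term `2 * T (n - 1)` reproduces the factor `2 ^ n`; only the increase of the polynomial
factor must be paid by the other term. That increase is of degree four and the payment of degree
five, so it is enough that `n + N` is large, which the shift ensures from the start. -/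
theorem shiftedTime_recurrence {k N n : ℕ} (hk : 2 ≤ k) (hN : N = 80 * 2 ^ (k + 1))
    (hn : 2 * k ≤ n) :
    shiftedTime N n ≤ 2 * shiftedTime N (n - 1) + (5 * k - 1) * shiftedTime N (n - k - 1) := by
  obtain ⟨a, rfl⟩ := Nat.exists_eq_add_of_le' (show k + 1 ≤ n by omega)
  rw [show a + (k + 1) - 1 = a + k by omega, show a + (k + 1) - k - 1 = a by omega]
  unfold shiftedTime
  have hkN : k + 1 ≤ N := by
    have : k + 1 < 2 ^ (k + 1) := Nat.lt_two_pow_self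
    omega
  obtain ⟨y, hy⟩ : ∃ y, y = a + N := ⟨_, rfl⟩
  have h1 : ∀ z : ℕ, (z + 1) ^ 5 ≤ z ^ 5 + 5 * (z + 1) ^ 4 := by
    intro z
    ring_nf
    nlinarith [Nat.zero_le (z ^ 2), Nat.zero_le (z ^ 3), Nat.zero_le (z ^ 4)]
  -- Because `k + 1 ≤ N ≤ y`, the base at most doubles, and `5 * 2 ^ 4 = 80` explains the choice of
  -- `N`.
  have h2 : 5 * (y + k + 1) ^ 4 * 2 ^ (k + 1) ≤ (5 * k - 1) * y ^ 5 := by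
    calc
      5 * (y + k + 1) ^ 4 * 2 ^ (k + 1) ≤ 5 * (2 * y) ^ 4 * 2 ^ (k + 1) := by
        gcongr
        omega
      _ = N * y ^ 4 := by rw [hN]; ring
      _ ≤ y * y ^ 4 := Nat.mul_le_mul_right _ (by omega)
      _ = 1 * y ^ 5 := by ring
      _ ≤ (5 * k - 1) * y ^ 5 := Nat.mul_le_mul_right _ (by omega)
  have h3 := Nat.mul_le_mul_right (2 ^ (k + 1)) (h1 (y + k))
  have h4 : (y + k + 1) ^ 5 * 2 ^ (k + 1) ≤ (y + k) ^ 5 * 2 ^ (k + 1) + (5 * k - 1) * y ^ 5 := by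
    rw [add_mul] at h3
    omega
  have h5 := Nat.mul_le_mul_left (6000 * 2 ^ a) h4
  rw [show a + (k + 1) + N = y + k + 1 by omega, show a + k + N = y + k by omega, ← hy]
  calc
    6000 * (y + k + 1) ^ 5 * 2 ^ (a + (k + 1)) =
        6000 * 2 ^ a * ((y + k + 1) ^ 5 * 2 ^ (k + 1)) := by rw [pow_add]; ring
    _ ≤ _ := h5
    _ = _ := by rw [pow_add, pow_add]; ring

theorem timeBoundedBy_shiftedTime {args : List ℕ} (hlen : args.length ≤ 1) {N : ℕ} (hN : 1 ≤ N) :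
    program.TimeBoundedBy args (shiftedTime N) := by
  intro n I
  obtain ⟨-, s, t, -, -, -, hrun, ht, -⟩ := guardedRun_program I args hlen
    (fun k hk => List.single_le_sum (by simp) k hk)
  refine (haltsWithin_iff hrun).2 (ht.trans ((programTime_le n).trans ?_))
  unfold shiftedTime
  gcongr

end Tardiness

/-- The program runs in time `O*(2 ^ n)`, which is stronger than the bounds in the statement: the
same program serves for every value of the parameter, and the numbers `e k` can be taken to
be zero. -/
theorem mainTheorem1 :
    (∃ (A : RamProg) (e : ℕ → ℝ), Filter.Tendsto e Filter.atTop (nhds 0) ∧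
      ∀ k : ℕ, 2 ≤ k →
        A.SolvesTotalTardiness [k] ∧
        A.UsesPolySpace [k] ∧
        A.RunsInOStar [k] (2 + e k) ∧
        A.WorstCaseLPTEqEDD [k] ∧
        ∃ (T : ℕ → ℕ) (q : Polynomial ℕ), A.TimeBoundedBy [k] T ∧
          ∀ n : ℕ, 2 * k ≤ n →
            T n ≤ 2 * T (n - 1) + (5 * k - 1) * T (n - k - 1) + q.eval n) ∧
    (∀ ε : ℝ, 0 < ε → ∃ A : RamProg,
      A.SolvesTotalTardiness [] ∧
      A.UsesPolySpace [] ∧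
      A.RunsInOStar [] (2 + ε)) := by
  refine ⟨⟨Tardiness.program, fun _ => 0, tendsto_const_nhds, fun k hk => ?_⟩, fun ε hε => ?_⟩
  · have hlen : [k].length ≤ 1 := le_rfl
    refine ⟨Tardiness.solvesTotalTardiness_program hlen, Tardiness.usesPolySpace_program hlen,
      Tardiness.runsInOStar_program hlen (by norm_num), Tardiness.worstCase_program hlen,
      -- The recurrence holds without the additive polynomial, which is taken to be zero.
      Tardiness.shiftedTime (80 * 2 ^ (k + 1)), 0,
      Tardiness.timeBoundedBy_shiftedTime hlen (Nat.mul_pos (by norm_num) (by positivity)),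
      fun n hn => ?_⟩
    exact (Tardiness.shiftedTime_recurrence hk rfl hn).trans (Nat.le_add_right _ _)
  · have hlen : ([] : List ℕ).length ≤ 1 := Nat.zero_le _
    exact ⟨Tardiness.program, Tardiness.solvesTotalTardiness_program hlen,
      Tardiness.usesPolySpace_program hlen, Tardiness.runsInOStar_program hlen (by linarith)⟩
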